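/- Let $X$ be a connected space with base point $*$ which is well-pointed (the point $*$ is closed and its inclusion into $X$ has the homotopy extension property) and has the homotopy type of a CW complex; for instance, any connected pointed CW complex. Let $\operatorname{cat} X\in\{0,1,2,\dots,\infty\}$ be the Lusternik–Schnirelmann category of $X$, i.e. the smallest $n$ such that $X$ is covered by $n+1$ open subsets $U$ whose inclusions $U\hookrightarrow X$ are homotopic to the constant map at $*$ (and $\infty$ if there is no such $n$). Let $\Omega X$ be the space of (Moore) loops of $X$ at $*$: the pairs $(\gamma,\ell)$ of a map $\gamma:[0,\infty)\to X$ and a length $\ell\ge 0$ with $\gamma(0)=*$ and $\gamma(t)=*$ for $t\ge \ell$. It is a topological monoid under concatenation, whose unit $e$ is the loop of length $0$, and hence an $A_\infty$-space with the $A_\infty$-form $\alpha_n(\tau;g_1,\dots,g_n)=g_1\cdots g_n$, $\tau\in K(n)$, where $$K(n)=\{(t_1,\dots,t_n)\in\mathbb R_{\ge 0}^n \mid t_1+\dots+t_i\le i-1 \text{ for all } i,\ t_1+\dots+t_n=n-1\}$$ is the associahedron, with Stasheff's face operators $\partial_k: K(r)\times K(s)\to K(r+s-1)$, $1\le k\le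 r$, $r,s\ge 2$, given by $$\partial_k((t_1,\dots,t_r),(u_1,\dots,u_s))=(t_1,\dots,t_{k-1},u_1,\dots,u_{s-1},u_s+t_k,t_{k+1},\dots,t_r),$$ and degeneracies $s_j:K(n)\to K(n-1)$, given for $1<j\le n$ by $$s_j(t_1,\dots,t_n)=(t_1,\dots,t_{j-2},t_{j-1}+t'_j,t'_{j+1},\dots,t'_n),\qquad (t'_j,\dots,t'_n)=\xi(t_j,\dots,t_n);$$ here $\xi(t_1,t_2,\dots)=(t'_1,t'_2,\dots)$ with $t'_1=\max\{0,t_1-1\}$ and, for $k>1$, $t'_k=\min\{t_k,\ \max_{1\le j\le k}\sum_{i=1}^{j}(t_i-1)-\sum_{i=1}^{k-1}(t'_i-1)\}$. For $m\ge 0$ let $P^m\Omega X$ be the $m$-th (Stasheff) projective space of $\Omega X$: the quotient of $\coprod_{0\le n\le m}K(n+2)\times(\Omega X)^n$, with points written $(\tau;g_2,\dots,g_{n+1})$, by the identifications (for $\rho\in K(r)$, $\sigma\in K(s)$, $r,s\ge2$, $r+s=n+3$) $$(\partial_k(\rho,\sigma);g_2,\dots,g_{n+1})\sim\begin{cases}(\rho;g_{s+1},\dots,g_{n+1}),&k=1,\\(\rho;g_2,\dots,g_{k-1},\alpha_s(\sigma;g_k,\dots,g_{k+s-1}),g_{k+s},\dots,g_{n+1}),&1<k<r,\\(\rho;g_2,\dots,g_{r-1}),&k=r,\end{cases}$$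 $$(\tau;g_2,\dots,g_{j-1},e,g_{j+1},\dots,g_{n+1})\sim(s_j(\tau);g_2,\dots,g_{j-1},g_{j+1},\dots,g_{n+1}),\quad 1<j<n+2.$$ Its base point is the image of the one-point space $K(2)\times(\Omega X)^0$. Let $e_m:P^m\Omega X\to X$ be the natural (pointed) map, which sends the class of $(\tau;g_2,\dots,g_{n+1})$ to the value of the loop $g_2\cdots g_{n+1}$ at the time $\sum_i w_i(\tau)\,\ell(g_i)$. Here $\ell(g_i)$ is the length of $g_i$, and $w_i(\tau)\in[0,1]$ is the second coordinate of the point of $K(3)=\{(0,a,2-a)\mid 0\le a\le 1\}$ obtained from $\tau$ by the degeneracies that delete all the indices $2,\dots,n+1$ except $i$. (On $P^1\Omega X$, the reduced suspension of $\Omega X$, this is the evaluation map.) Then, for every integer $m\ge 0$, $\operatorname{cat}X\le m$ if and only if $e_m$ has a right homotopy inverse in the category of pointed spaces, i.e. there is a pointed map $\sigma:X\to P^m\Omega X$ such that $e_m\circ\sigma$ is homotopic to $\mathrm{id}_X$ relative to $*$. -/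

import Mathlib

open scoped NNReal

noncomputable section

/-! ## Associahedra

Indices are shifted by one: the coordinates `(t_1, …, t_n)` of a point of `K(n)` are
`t 0, …, t (n - 1)`, and a point of `ℝ^n` is a sequence `ℕ → ℝ` that vanishes from `n` on. -/

/-- The associahedron `K(n)`: nonnegative `(t_1, …, t_n)` with `t_1 + ⋯ + t_i ≤ i - 1` for all `i`
and `t_1 + ⋯ + t_n = n - 1`, with the subspace topology of `ℝ^n`. -/
def Assoc (n : ℕ) : Set (ℕ → ℝ) :=
  {t | (∀ i, 0 ≤ t i) ∧ (∀ i, n ≤ i → t i = 0) ∧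
    (∀ i < n, ∑ l ∈ Finset.range (i + 1), t l ≤ i) ∧
    ∑ l ∈ Finset.range n, t l = (n : ℝ) - 1}

namespace Assoc

/-- The face operator
`∂_{k+1}((t_1,…,t_r),(u_1,…,u_s)) = (t_1,…,t_k,u_1,…,u_{s-1},u_s + t_{k+1},t_{k+2},…,t_r)`. -/
def faceSeq (k s : ℕ) (t u : ℕ → ℝ) (i : ℕ) : ℝ :=
  if i < k then t i
  else if i < k + s - 1 then u (i - k)
  else if i = k + s - 1 then u (s - 1) + t k
  else t (i + 1 - s)

/-- `runMax t k` is the maximum of the sums `∑_{i ≤ j} (t i - 1)` for `0 ≤ j ≤ k`. -/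
def runMax (t : ℕ → ℝ) (k : ℕ) : ℝ :=
  (Finset.range (k + 1)).sup' Finset.nonempty_range_add_one
    (fun j => ∑ i ∈ Finset.range (j + 1), (t i - 1))

/-- The map `ξ(t_1, t_2, …) = (t'_1, t'_2, …)` with `t'_1 = max {0, t_1 - 1}` and
`t'_k = min {t_k, max_{1 ≤ j ≤ k} ∑_{i ≤ j} (t_i - 1) - ∑_{i < k} (t'_i - 1)}` for `k > 1`. -/
def xi (t : ℕ → ℝ) : ℕ → ℝ
  | 0 => max 0 (t 0 - 1)
  | k + 1 => min (t (k + 1)) (runMax t (k + 1) - ∑ i : Fin (k + 1), (xi t i - 1))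

/-- The degeneracy `s_{j+1}(t_1,…,t_n) = (t_1,…,t_{j-1},t_j + t'_{j+1},t'_{j+2},…,t'_n)`, where
`(t'_{j+1},…,t'_n) = ξ(t_{j+1},…,t_n)`, and `s_1(t_1,…,t_n) = (t'_2,…,t'_n)`, where
`(t'_1,…,t'_n) = ξ(t_1,…,t_n)`. -/
def degenSeq (j : ℕ) (t : ℕ → ℝ) (i : ℕ) : ℝ :=
  if i + 1 < j then t i
  else if i + 1 = j then t i + xi (fun l => t (j + l)) 0
  else xi (fun l => t (j + l)) (i + 1 - j)

/-- `excess t i = i - (t 0 + ⋯ + t i)`, which is nonnegative on `K(n)` for `i < n`. -/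
def excess (t : ℕ → ℝ) (i : ℕ) : ℝ := i - ∑ l ∈ Finset.range (i + 1), t l

/-! ### The operators preserve associahedra -/

lemma excess_succ (t : ℕ → ℝ) (i : ℕ) : excess t (i + 1) = excess t i + 1 - t (i + 1) := by
  unfold excess
  rw [Finset.sum_range_succ _ (i + 1)]
  push_cast
  ring

lemma excess_nonneg {n : ℕ} {t : ℕ → ℝ} (ht : t ∈ Assoc n) {i : ℕ} (hi : i < n) :
    0 ≤ excess t i := by
  have := ht.2.2.1 i hi
  unfold excess
  linarith

lemma mem_of_excess {n : ℕ} {t : ℕ → ℝ} (h0 : ∀ i, 0 ≤ t i) (h1 : ∀ i, n + 1 ≤ i → t i = 0)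
    (h2 : ∀ i < n, 0 ≤ excess t i) (h3 : excess t n = 0) : t ∈ Assoc (n + 1) := by
  unfold excess at h2 h3
  refine ⟨h0, h1, fun i hi => ?_, ?_⟩
  · rcases Nat.lt_succ_iff_lt_or_eq.1 hi with h | rfl
    · linarith [h2 i h]
    · linarith
  · push_cast
    linarith

lemma excess_last {n : ℕ} {t : ℕ → ℝ} (ht : t ∈ Assoc (n + 1)) : excess t n = 0 := by
  have := ht.2.2.2
  unfold excess
  push_cast at this
  linarith

lemma excess_zero {n : ℕ} {t : ℕ → ℝ} (ht : t ∈ Assoc (n + 1)) : excess t 0 = 0 := by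
  have h := ht.2.2.1 0 (Nat.succ_pos n)
  have h' := ht.1 0
  simp only [zero_add, Finset.sum_range_one, Nat.cast_zero] at h
  simp only [excess, zero_add, Finset.sum_range_one, Nat.cast_zero]
  linarith

lemma apply_zero {n : ℕ} {t : ℕ → ℝ} (ht : t ∈ Assoc (n + 1)) : t 0 = 0 := by
  have h := excess_zero ht
  simp only [excess, zero_add, Finset.sum_range_one, Nat.cast_zero] at h
  linarith

lemma excess_faceSeq_lt {k s : ℕ} {t u : ℕ → ℝ} {i : ℕ} (hi : i < k) :
    excess (faceSeq k s t u) i = excess t i := by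
  unfold excess
  congr 1
  refine Finset.sum_congr rfl fun l hl => ?_
  rw [Finset.mem_range] at hl
  simp [faceSeq, show l < k by omega]

lemma excess_faceSeq_zero {s : ℕ} {t u : ℕ → ℝ} {i : ℕ} (hi : i + 1 < s) :
    excess (faceSeq 0 s t u) i = excess u i := by
  unfold excess
  congr 1
  refine Finset.sum_congr rfl fun l hl => ?_
  rw [Finset.mem_range] at hl
  simp [faceSeq, show l < s - 1 by omega]

lemma excess_faceSeq_mid {k s : ℕ} {t u : ℕ → ℝ} {i : ℕ} (hu : u 0 = 0) (hi : i + 1 < s) :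
    excess (faceSeq (k + 1) s t u) (k + 1 + i) = excess t k + 1 + excess u i := by
  induction i with
  | zero =>
    have h0 : faceSeq (k + 1) s t u (k + 1) = 0 := by
      rw [faceSeq, if_neg (by omega), if_pos (by omega), Nat.sub_self, hu]
    rw [add_zero, excess_succ, excess_faceSeq_lt (Nat.lt_succ_self k), h0]
    simp [excess, hu]
  | succ i ih =>
    rw [← add_assoc, excess_succ, ih (by omega), excess_succ u i]
    have : faceSeq (k + 1) s t u (k + 1 + i + 1) = u (i + 1) := by
      rw [faceSeq, if_neg (by omega), if_pos (by omega),
        show k + 1 + i + 1 - (k + 1) = i + 1 by omega]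
    rw [this]
    ring

lemma excess_faceSeq_ge {k s : ℕ} {t u : ℕ → ℝ} (hs : 2 ≤ s) (ht : t 0 = 0) (hu : u ∈ Assoc s)
    (i : ℕ) : excess (faceSeq k s t u) (k + s - 1 + i) = excess t (k + i) := by
  obtain ⟨s, rfl⟩ : ∃ s', s = s' + 2 := ⟨s - 2, by omega⟩
  have hu0 := apply_zero hu
  have hul := excess_last hu
  rw [excess_succ] at hul
  induction i with
  | zero =>
    have hval : faceSeq k (s + 2) t u (k + s + 1) = u (s + 1) + t k := by
      rw [faceSeq, if_neg (by omega), if_neg (by omega), if_pos (by omega)]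
      rfl
    rw [show k + (s + 2) - 1 + 0 = k + s + 1 by omega, excess_succ, hval, add_zero]
    rcases k with _ | k
    · rw [zero_add, excess_faceSeq_zero (by omega), ht]
      simp only [excess, zero_add, Finset.sum_range_one, Nat.cast_zero, ht] at hul ⊢
      linarith
    · rw [excess_faceSeq_mid hu0 (by omega), excess_succ]
      linarith
  | succ i ih =>
    have hval : faceSeq k (s + 2) t u (k + (s + 2) - 1 + i + 1) = t (k + i + 1) := by
      rw [faceSeq, if_neg (by omega), if_neg (by omega), if_neg (by omega)]
      congr 1
      omega
    rw [← add_assoc, excess_succ, ih, hval, ← add_assoc, excess_succ]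

lemma faceSeq_mem {n r s k : ℕ} (h : r + s = n + 1) (hs : 2 ≤ s) (hk : k < r)
    {t u : ℕ → ℝ} (ht : t ∈ Assoc r) (hu : u ∈ Assoc s) : faceSeq k s t u ∈ Assoc n := by
  obtain ⟨r, rfl⟩ : ∃ r', r = r' + 1 := ⟨r - 1, by omega⟩
  obtain ⟨n, rfl⟩ : ∃ n', n = n' + 1 := ⟨n - 1, by omega⟩
  have hs1 : s = s - 1 + 1 := by omega
  have hu0 : u 0 = 0 := by
    rw [hs1] at hu
    exact apply_zero hu
  have ht0 : t 0 = 0 := apply_zero ht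
  refine mem_of_excess (fun i => ?_) (fun i hi => ?_) (fun i hi => ?_) ?_
  · unfold faceSeq
    split_ifs
    exacts [ht.1 _, hu.1 _, add_nonneg (hu.1 _) (ht.1 _), ht.1 _]
  · simp only [faceSeq, show ¬ (i < k) by omega, show ¬ (i < k + s - 1) by omega,
      show i ≠ k + s - 1 by omega, if_false]
    exact ht.2.1 _ (by omega)
  · rcases lt_or_ge i k with h1 | h1
    · rw [excess_faceSeq_lt h1]
      exact excess_nonneg ht (by omega)
    rcases lt_or_ge i (k + s - 1) with h2 | h2
    · rcases k with _ | k
      · rw [excess_faceSeq_zero (by omega)]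
        exact excess_nonneg hu (by omega)
      · obtain ⟨l, rfl⟩ : ∃ l, i = k + 1 + l := ⟨i - (k + 1), by omega⟩
        rw [excess_faceSeq_mid hu0 (by omega)]
        have e1 := excess_nonneg ht (i := k) (by omega)
        have e2 := excess_nonneg hu (i := l) (by omega)
        linarith
    · obtain ⟨l, rfl⟩ : ∃ l, i = k + s - 1 + l := ⟨i - (k + s - 1), by omega⟩
      rw [excess_faceSeq_ge hs ht0 hu]
      exact excess_nonneg ht (by omega)
  · obtain ⟨l, rfl⟩ : ∃ l, n = k + s - 1 + l := ⟨n - (k + s - 1), by omega⟩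
    rw [excess_faceSeq_ge hs ht0 hu, show k + l = r by omega]
    exact excess_last ht

/-- The face operator `∂_{k+1} : K(r) × K(s) → K(n)`, `r + s = n + 1`. -/
def face {n r s : ℕ} (k : ℕ) (h : r + s = n + 1) (hs : 2 ≤ s) (hk : k < r)
    (ρ : Assoc r) (σ : Assoc s) : Assoc n :=
  ⟨faceSeq k s ρ σ, faceSeq_mem h hs hk ρ.2 σ.2⟩

/-- The mass that `ξ` has still to remove after the `k`-th coordinate. -/
def defect (t : ℕ → ℝ) (k : ℕ) : ℝ :=
  ∑ i ∈ Finset.range (k + 1), (xi t i - 1) + 1 - ∑ i ∈ Finset.range (k + 1), (t i - 1)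

lemma le_runMax (t : ℕ → ℝ) {j k : ℕ} (h : j ≤ k) :
    ∑ i ∈ Finset.range (j + 1), (t i - 1) ≤ runMax t k :=
  Finset.le_sup' (fun j => ∑ i ∈ Finset.range (j + 1), (t i - 1))
    (Finset.mem_range.2 (Nat.lt_succ_of_le h))

lemma exists_runMax (t : ℕ → ℝ) (k : ℕ) :
    ∃ j ≤ k, runMax t k = ∑ i ∈ Finset.range (j + 1), (t i - 1) := by
  obtain ⟨j, hj, h⟩ := Finset.exists_mem_eq_sup' (s := Finset.range (k + 1))
    Finset.nonempty_range_add_one (fun j => ∑ i ∈ Finset.range (j + 1), (t i - 1))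
  exact ⟨j, Nat.lt_succ_iff.1 (Finset.mem_range.1 hj), h⟩

lemma runMax_mono (t : ℕ → ℝ) {j k : ℕ} (h : j ≤ k) : runMax t j ≤ runMax t k := by
  obtain ⟨l, hl, e⟩ := exists_runMax t j
  rw [e]
  exact le_runMax t (hl.trans h)

lemma xi_succ (t : ℕ → ℝ) (k : ℕ) : xi t (k + 1) =
    min (t (k + 1)) (runMax t (k + 1) - ∑ i ∈ Finset.range (k + 1), (xi t i - 1)) := by
  rw [xi, Finset.sum_range (fun i => xi t i - 1)]

lemma defect_zero (t : ℕ → ℝ) : defect t 0 = max 0 (1 - t 0) := by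
  simp only [defect, zero_add, Finset.sum_range_one, xi]
  rcases le_total (t 0) 1 with h | h
  · rw [max_eq_left (by linarith), max_eq_right (by linarith)]
    ring
  · rw [max_eq_right (by linarith), max_eq_left (by linarith)]
    ring

lemma defect_succ (t : ℕ → ℝ) (k : ℕ) : defect t (k + 1) =
    min (defect t k) (runMax t (k + 1) - ∑ i ∈ Finset.range (k + 2), (t i - 1)) := by
  have e1 := Finset.sum_range_succ (fun i => xi t i - 1) (k + 1)
  have e2 := Finset.sum_range_succ (fun i => t i - 1) (k + 1)
  unfold defect
  rw [e1, xi_succ]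
  rcases le_total (t (k + 1)) (runMax t (k + 1) - ∑ i ∈ Finset.range (k + 1), (xi t i - 1))
    with h | h
  · rw [min_eq_left h, min_eq_left]
    · linarith
    · linarith
  · rw [min_eq_right h, min_eq_right]
    · linarith
    · linarith

lemma defect_nonneg (t : ℕ → ℝ) (k : ℕ) : 0 ≤ defect t k := by
  induction k with
  | zero => rw [defect_zero]; exact le_max_left _ _
  | succ k ih =>
    rw [defect_succ]
    exact le_min ih (sub_nonneg.2 (le_runMax t le_rfl))

lemma defect_anti (t : ℕ → ℝ) {j k : ℕ} (h : j ≤ k) : defect t k ≤ defect t j := by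
  induction k, h using Nat.le_induction with
  | base => exact le_rfl
  | succ k _ ih => rw [defect_succ]; exact (min_le_left _ _).trans ih

lemma defect_le (t : ℕ → ℝ) (k : ℕ) :
    defect t (k + 1) ≤ runMax t (k + 1) - ∑ i ∈ Finset.range (k + 2), (t i - 1) := by
  rw [defect_succ]
  exact min_le_right _ _

/-- Either the defect is still the initial one, or it was fixed at some later index. -/
lemma defect_cases (t : ℕ → ℝ) {j k : ℕ} (h : j ≤ k) : defect t k = defect t j ∨
    ∃ l, j < l ∧ l ≤ k ∧
      defect t k = runMax t l - ∑ i ∈ Finset.range (l + 1), (t i - 1) := by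
  induction k, h using Nat.le_induction with
  | base => exact Or.inl rfl
  | succ k hk ih =>
    rw [defect_succ]
    rcases min_choice (defect t k) (runMax t (k + 1) - ∑ i ∈ Finset.range (k + 2), (t i - 1))
      with h | h
    · rw [h]
      rcases ih with h' | ⟨l, h1, h2, h3⟩
      · exact Or.inl h'
      · exact Or.inr ⟨l, h1, by omega, h3⟩
    · exact Or.inr ⟨k + 1, by omega, le_rfl, h⟩

lemma xi_nonneg {t : ℕ → ℝ} (ht : ∀ i, 0 ≤ t i) (k : ℕ) : 0 ≤ xi t k := by
  rcases k with _ | k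
  · rw [xi]; exact le_max_left _ _
  rw [xi_succ]
  refine le_min (ht _) ?_
  rcases k with _ | k
  · have h := le_runMax t (show 0 ≤ 0 + 1 by omega)
    simp only [zero_add, Finset.sum_range_one, xi] at h ⊢
    have h0 := ht 0
    have h1 := ht 1
    have h2 := le_runMax t (show 1 ≤ 1 by omega)
    rcases le_total (t 0) 1 with h3 | h3
    · rw [max_eq_left (by linarith)]
      linarith
    · rw [max_eq_right (by linarith)]
      linarith
  · have h := defect_le t k
    have h' := runMax_mono t (show k + 1 ≤ k + 1 + 1 by omega)
    unfold defect at h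
    linarith

lemma excess_degenSeq_lt {j : ℕ} (t : ℕ → ℝ) {i : ℕ} (hi : i + 1 < j) :
    excess (degenSeq j t) i = excess t i := by
  unfold excess
  congr 1
  refine Finset.sum_congr rfl fun l hl => ?_
  rw [Finset.mem_range] at hl
  simp [degenSeq, show l + 1 < j by omega]

lemma sub_sum_tail (t : ℕ → ℝ) (j k : ℕ) :
    ∑ i ∈ Finset.range (k + 1), (t (j + 1 + i) - 1) = excess t j - excess t (j + 1 + k) := by
  induction k with
  | zero =>
    rw [zero_add, Finset.sum_range_one, add_zero, excess_succ]
    ring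
  | succ k ih =>
    rw [Finset.sum_range_succ, ih, ← add_assoc, excess_succ t (j + 1 + k)]
    ring

lemma defect_tail_succ (t : ℕ → ℝ) (k : ℕ) : xi t (k + 1) =
    t (k + 1) + defect t (k + 1) - defect t k := by
  unfold defect
  rw [Finset.sum_range_succ (fun i => xi t i - 1) (k + 1),
    Finset.sum_range_succ (fun i => t i - 1) (k + 1)]
  ring

lemma excess_degenSeq_ge {j : ℕ} (t : ℕ → ℝ) (hj : j = 0 → t 0 = 0) {i : ℕ} (hi : j ≤ i + 1) :
    excess (degenSeq j t) i =
      excess t (i + 1) - defect (fun l => t (j + l)) (i + 1 - j) := by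
  have key : ∀ i, i + 1 > j → degenSeq j t i = t (i + 1) +
      defect (fun l => t (j + l)) (i + 1 - j) - defect (fun l => t (j + l)) (i - j) := by
    intro i hi
    simp only [degenSeq, show ¬ (i + 1 < j) by omega, show i + 1 ≠ j by omega, if_false]
    rw [show i + 1 - j = (i - j) + 1 by omega, defect_tail_succ,
      show j + (i - j + 1) = i + 1 by omega]
  have step : ∀ i, i + 1 ≥ j →
      excess (degenSeq j t) i = excess t (i + 1) - defect (fun l => t (j + l)) (i + 1 - j) →
      excess (degenSeq j t) (i + 1) =
        excess t (i + 2) - defect (fun l => t (j + l)) (i + 2 - j) := by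
    intro i hi ih
    rw [excess_succ, ih, excess_succ t (i + 1), key (i + 1) (by omega)]
    ring
  rcases j with _ | j
  · have ht := hj rfl
    clear hi
    induction i with
    | zero =>
      have h1 := key 0 (by omega)
      have h2 := excess_succ t 0
      have h3 := defect_zero (fun l => t (0 + l))
      simp only [add_zero, ht, sub_zero, zero_add, Nat.sub_zero] at h1 h2 h3
      rw [max_eq_right zero_le_one] at h3
      simp only [zero_add, Nat.sub_zero]
      rw [h2]
      simp only [excess, zero_add, Finset.sum_range_one, Nat.cast_zero, ht, h1]
      rw [h3]
      ring
    | succ i ih => exact step i (by omega) ih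
  · have hi' : j ≤ i := by omega
    clear hi
    induction i, hi' using Nat.le_induction with
    | base =>
      have h0 : degenSeq (j + 1) t j = t j + xi (fun l => t (j + 1 + l)) 0 := by
        simp [degenSeq]
      have h1 : defect (fun l => t (j + 1 + l)) 0 =
          xi (fun l => t (j + 1 + l)) 0 + 1 - t (j + 1) := by
        simp only [defect, zero_add, Finset.sum_range_one, add_zero]
        ring
      rw [Nat.sub_self, h1, excess_succ t j]
      rcases j with _ | j
      · simp only [zero_add] at h0
        simp only [excess, zero_add, Finset.sum_range_one, Nat.cast_zero, h0]
        ring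
      · rw [excess_succ, excess_degenSeq_lt t (Nat.lt_succ_self _), h0, excess_succ t j]
        ring
    | succ i hi ih => exact step i (by omega) ih

/-- Past the first index, what `ξ` leaves of the excess dominates an earlier excess. -/
lemma exists_excess_le (t : ℕ → ℝ) (j k : ℕ) : ∃ q, j < q ∧ q ≤ j + 2 + k ∧
    excess t q ≤ excess t (j + 2 + k) - defect (fun l => t (j + 1 + l)) (k + 1) := by
  have h := defect_le (fun l => t (j + 1 + l)) k
  obtain ⟨l, hl, e⟩ := exists_runMax (fun l => t (j + 1 + l)) (k + 1)
  rw [e, sub_sum_tail] at h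
  rw [sub_sum_tail, show j + 1 + (k + 1) = j + 2 + k by omega] at h
  exact ⟨j + 1 + l, by omega, by omega, by linarith⟩

lemma excess_sub_defect_zero (t : ℕ → ℝ) (j : ℕ) :
    excess t (j + 1) - defect (fun l => t (j + 1 + l)) 0 = min (excess t j) (excess t (j + 1)) := by
  rw [defect_zero, excess_succ]
  simp only [add_zero]
  rcases le_total (t (j + 1)) 1 with h | h
  · rw [max_eq_right (by linarith), min_eq_left (by linarith)]
    ring
  · rw [max_eq_left (by linarith), min_eq_right (by linarith)]
    ring

lemma excess_degenSeq_nonneg {n j : ℕ} {t : ℕ → ℝ} (ht : t ∈ Assoc (n + 2)) {i : ℕ}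
    (hi : i < n + 1) : 0 ≤ excess (degenSeq j t) i := by
  rcases lt_or_ge (i + 1) j with h | h
  · rw [excess_degenSeq_lt t h]
    exact excess_nonneg ht (by omega)
  rw [excess_degenSeq_ge t (fun _ => apply_zero ht) h]
  rcases j with _ | j
  · have h1 := defect_anti (fun l => t (0 + l)) (Nat.zero_le (i + 1 - 0))
    have h2 := defect_le (fun l => t (0 + l)) i
    obtain ⟨l, hl, e⟩ := exists_runMax (fun l => t (0 + l)) (i + 1)
    rw [e] at h2
    have conv : ∀ m, ∑ x ∈ Finset.range (m + 1), ((fun l => t (0 + l)) x - 1)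
        = - excess t m - 1 := by
      intro m
      simp only [zero_add, Finset.sum_sub_distrib, excess, Finset.sum_const, Finset.card_range,
        nsmul_eq_mul, mul_one]
      push_cast
      ring
    rw [conv, show i + 2 = (i + 1) + 1 from rfl, conv] at h2
    have h3 := excess_nonneg ht (i := l) (by omega)
    rw [Nat.sub_zero]
    linarith
  · rcases Nat.eq_or_lt_of_le h with h' | h'
    · obtain rfl : j = i := by omega
      rw [Nat.sub_self, excess_sub_defect_zero]
      exact le_min (excess_nonneg ht (by omega)) (excess_nonneg ht (by omega))
    · obtain ⟨k, rfl⟩ : ∃ k, i = j + 1 + k := ⟨i - (j + 1), by omega⟩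
      rw [show j + 1 + k + 1 = j + 2 + k by omega, show j + 2 + k - (j + 1) = k + 1 by omega]
      obtain ⟨q, -, h2, h3⟩ := exists_excess_le t j k
      exact (excess_nonneg ht (by omega)).trans h3

lemma degenSeq_mem {n j : ℕ} (hj : j < n + 2) {t : ℕ → ℝ} (ht : t ∈ Assoc (n + 2)) :
    degenSeq j t ∈ Assoc (n + 1) := by
  have hx : ∀ k, 0 ≤ xi (fun l => t (j + l)) k := xi_nonneg fun i => ht.1 _
  refine mem_of_excess (fun i => ?_) (fun i hi => ?_)
    (fun i hi => excess_degenSeq_nonneg ht (by omega)) ?_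
  · unfold degenSeq
    split_ifs
    exacts [ht.1 _, add_nonneg (ht.1 _) (hx 0), hx _]
  · simp only [degenSeq, show ¬ (i + 1 < j) by omega, show i + 1 ≠ j by omega, if_false]
    refine le_antisymm ?_ (hx _)
    rw [show i + 1 - j = (i - j) + 1 by omega, xi_succ]
    refine (min_le_left _ _).trans (le_of_eq ?_)
    exact ht.2.1 _ (by omega)
  · refine le_antisymm ?_ (excess_degenSeq_nonneg ht (by omega))
    rw [excess_degenSeq_ge t (fun _ => apply_zero ht) (by omega), excess_last ht]
    linarith [defect_nonneg (fun l => t (j + l)) (n + 1 - j)]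

/-- The degeneracy `s_{j+1} : K(n+2) → K(n+1)`, `0 ≤ j < n + 2`. -/
def degen {n : ℕ} (j : ℕ) (hj : j < n + 2) (τ : Assoc (n + 2)) : Assoc (n + 1) :=
  ⟨degenSeq j τ, degenSeq_mem hj τ.2⟩

/-- The unique point `(0, 1)` of `K(2)`. -/
def pt : Assoc 2 :=
  ⟨fun i => if i = 1 then 1 else 0, by
    refine mem_of_excess (fun i => ?_) (fun i hi => ?_) (fun i hi => ?_) ?_
    · split_ifs <;> norm_num
    · simp [show i ≠ 1 by omega]
    · obtain rfl : i = 0 := by omega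
      simp [excess]
    · simp [excess]⟩

/-! ### The coordinates of a point of `K(n + 2)` that weigh the loops -/

/-- The minimum of `excess t p` for `i ≤ p ≤ n`. -/
def futMin (t : ℕ → ℝ) (n i : ℕ) : ℝ :=
  (Finset.range (n - i + 1)).inf' Finset.nonempty_range_add_one (fun p => excess t (i + p))

/-- `futMin t n (i + 1) - futMin t n i`. -/
def incr (t : ℕ → ℝ) (n i : ℕ) : ℝ := futMin t n (i + 1) - futMin t n i

/-- The maximum of the increments `incr t n i` for `0 ≤ i ≤ q`. -/
def height (t : ℕ → ℝ) (n q : ℕ) : ℝ :=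
  (Finset.range (q + 1)).sup' Finset.nonempty_range_add_one (incr t n)

/-- For `t ∈ K(n + 2)` and `q < n`, the number `weight t n q ∈ [0, 1]` is the coordinate in
`K(3) = {(0, a, 2 - a) | 0 ≤ a ≤ 1}` of the point obtained from `t` by the degeneracies that delete
all the indices `2, …, n + 1` except `q + 2`. -/
def weight (t : ℕ → ℝ) (n q : ℕ) : ℝ := 1 - height t n q

lemma le_futMin {t : ℕ → ℝ} {n i : ℕ} (hi : i ≤ n) {a : ℝ} :
    a ≤ futMin t n i ↔ ∀ p, i ≤ p → p ≤ n → a ≤ excess t p := by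
  unfold futMin
  rw [Finset.le_inf'_iff]
  constructor
  · intro h p h1 h2
    have := h (p - i) (Finset.mem_range.2 (by omega))
    rwa [show i + (p - i) = p by omega] at this
  · intro h p hp
    rw [Finset.mem_range] at hp
    exact h _ (by omega) (by omega)

lemma futMin_le {t : ℕ → ℝ} {n i p : ℕ} (h1 : i ≤ p) (h2 : p ≤ n) :
    futMin t n i ≤ excess t p :=
  (le_futMin (h1.trans h2)).1 le_rfl p h1 h2

lemma futMin_succ {t : ℕ → ℝ} {n i : ℕ} (hi : i < n) :
    futMin t n i = min (excess t i) (futMin t n (i + 1)) := by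
  refine eq_of_forall_le_iff fun a => ?_
  rw [le_min_iff, le_futMin hi.le, le_futMin hi]
  constructor
  · exact fun h => ⟨h i le_rfl hi.le, fun p h1 h2 => h p (by omega) h2⟩
  · rintro ⟨h0, h⟩ p h1 h2
    rcases Nat.eq_or_lt_of_le h1 with rfl | h1
    · exact h0
    · exact h p h1 h2

lemma futMin_self (t : ℕ → ℝ) (n : ℕ) : futMin t n n = excess t n := by
  simp [futMin]

lemma incr_nonneg {t : ℕ → ℝ} {n i : ℕ} (hi : i < n) : 0 ≤ incr t n i := by
  rw [incr, futMin_succ hi]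
  linarith [min_le_right (excess t i) (futMin t n (i + 1))]

lemma incr_le_one {t : ℕ → ℝ} (ht : ∀ i, 0 ≤ t i) {n i : ℕ} (hi : i < n) : incr t n i ≤ 1 := by
  have h1 : futMin t n (i + 1) ≤ excess t (i + 1) := futMin_le le_rfl hi
  rw [excess_succ] at h1
  have h2 := ht (i + 1)
  rw [incr, futMin_succ hi]
  rcases min_choice (excess t i) (futMin t n (i + 1)) with h | h <;> rw [h] <;> linarith

lemma height_le {t : ℕ → ℝ} {n q : ℕ} {a : ℝ} :
    height t n q ≤ a ↔ ∀ i ≤ q, incr t n i ≤ a := by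
  unfold height
  rw [Finset.sup'_le_iff]
  exact ⟨fun h i hi => h i (Finset.mem_range.2 (by omega)),
    fun h i hi => h i (Nat.lt_succ_iff.1 (Finset.mem_range.1 hi))⟩

lemma incr_le_height {t : ℕ → ℝ} {n i q : ℕ} (h : i ≤ q) : incr t n i ≤ height t n q :=
  height_le.1 le_rfl i h

lemma height_nonneg {t : ℕ → ℝ} {n q : ℕ} (hn : 0 < n) : 0 ≤ height t n q :=
  (incr_nonneg hn).trans (incr_le_height (Nat.zero_le q))

lemma weight_le_one {t : ℕ → ℝ} {n q : ℕ} (hn : 0 < n) : weight t n q ≤ 1 := by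
  unfold weight
  linarith [height_nonneg (t := t) (q := q) hn]

lemma weight_nonneg {t : ℕ → ℝ} (ht : ∀ i, 0 ≤ t i) {n q : ℕ} (hq : q < n) :
    0 ≤ weight t n q := by
  have : height t n q ≤ 1 := height_le.2 fun i hi => incr_le_one ht (by omega)
  unfold weight
  linarith

/-! Weights and faces. -/

section face

variable {n p s : ℕ} {t u : ℕ → ℝ}

lemma futMin_first_zero (h : p + s = n + 1) (hs : 2 ≤ s) (ht : t ∈ Assoc (p + 2))
    (hu : u ∈ Assoc s) {i : ℕ} (hi : i < s) : futMin (faceSeq 0 s t u) n i = 0 := by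
  have hmem := faceSeq_mem (n := n + 2) (k := 0) (by omega) hs (by omega) ht hu
  refine le_antisymm ?_ ((le_futMin (by omega)).2 fun q _ h2 => excess_nonneg hmem (by omega))
  have h1 : futMin (faceSeq 0 s t u) n i ≤ _ :=
    futMin_le (p := 0 + s - 1 + 0) (by omega) (by omega)
  rwa [excess_faceSeq_ge hs (apply_zero ht) hu, excess_zero ht] at h1

lemma futMin_ge {k : ℕ} (h : p + s = n + 1) (hs : 2 ≤ s) (ht : t ∈ Assoc (p + 2))
    (hu : u ∈ Assoc s) {i : ℕ} (hi : k + i ≤ p) :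
    futMin (faceSeq k s t u) n (k + s - 1 + i) = futMin t p (k + i) := by
  refine eq_of_forall_le_iff fun a => ?_
  rw [le_futMin (by omega), le_futMin hi]
  constructor
  · intro H q h1 h2
    have := H (k + s - 1 + (q - k)) (by omega) (by omega)
    rwa [excess_faceSeq_ge hs (apply_zero ht) hu, show k + (q - k) = q by omega] at this
  · intro H q h1 h2
    obtain ⟨l, rfl⟩ : ∃ l, q = k + s - 1 + l := ⟨q - (k + s - 1), by omega⟩
    rw [excess_faceSeq_ge hs (apply_zero ht) hu]
    exact H _ (by omega) (by omega)

lemma futMin_before {k : ℕ} (h : p + s = n + 1) (hs : 2 ≤ s) (hk : k ≤ p)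
    (ht : t ∈ Assoc (p + 2)) (hu : u ∈ Assoc s) {i : ℕ} (hi : i ≤ k) :
    futMin (faceSeq (k + 1) s t u) n i = futMin t p i := by
  have hu0 : u 0 = 0 := by
    rw [show s = s - 1 + 1 by omega] at hu
    exact apply_zero hu
  refine eq_of_forall_le_iff fun a => ?_
  rw [le_futMin (by omega), le_futMin (by omega)]
  constructor
  · intro H q h1 h2
    rcases lt_or_ge q (k + 1) with h3 | h3
    · have := H q h1 (by omega)
      rwa [excess_faceSeq_lt h3] at this
    · have := H (k + 1 + s - 1 + (q - (k + 1))) (by omega) (by omega)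
      rwa [excess_faceSeq_ge hs (apply_zero ht) hu, show k + 1 + (q - (k + 1)) = q by omega]
        at this
  · intro H q h1 h2
    rcases lt_or_ge q (k + 1) with h3 | h3
    · rw [excess_faceSeq_lt h3]
      exact H q h1 (by omega)
    rcases lt_or_ge q (k + s) with h4 | h4
    · obtain ⟨l, rfl⟩ : ∃ l, q = k + 1 + l := ⟨q - (k + 1), by omega⟩
      rw [excess_faceSeq_mid hu0 (by omega)]
      have e1 := H k hi hk
      have e2 := excess_nonneg hu (i := l) (by omega)
      linarith
    · obtain ⟨l, rfl⟩ : ∃ l, q = k + 1 + s - 1 + l := ⟨q - (k + s), by omega⟩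
      rw [excess_faceSeq_ge hs (apply_zero ht) hu]
      exact H _ (by omega) (by omega)

lemma futMin_mid {k : ℕ} (h : p + s = n + 1) (hs : 2 ≤ s) (hk : k < p)
    (ht : t ∈ Assoc (p + 2)) (hu : u ∈ Assoc s) {i : ℕ} (h1 : k + 1 ≤ i) (h2 : i ≤ k + s) :
    futMin (faceSeq (k + 1) s t u) n i = futMin t p (k + 1) := by
  have hu0 : u 0 = 0 := by
    rw [show s = s - 1 + 1 by omega] at hu
    exact apply_zero hu
  refine eq_of_forall_le_iff fun a => ?_
  rw [le_futMin (by omega), le_futMin (by omega)]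
  constructor
  · intro H q h3 h4
    have := H (k + 1 + s - 1 + (q - (k + 1))) (by omega) (by omega)
    rwa [excess_faceSeq_ge hs (apply_zero ht) hu, show k + 1 + (q - (k + 1)) = q by omega]
      at this
  · intro H q h3 h4
    rcases lt_or_ge q (k + s) with h5 | h5
    · obtain ⟨l, rfl⟩ : ∃ l, q = k + 1 + l := ⟨q - (k + 1), by omega⟩
      rw [excess_faceSeq_mid hu0 (by omega)]
      have e1 := H (k + 1) le_rfl hk
      have e2 := excess_nonneg hu (i := l) (by omega)
      have e3 := ht.1 (k + 1)
      rw [excess_succ] at e1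
      linarith
    · obtain ⟨l, rfl⟩ : ∃ l, q = k + 1 + s - 1 + l := ⟨q - (k + s), by omega⟩
      rw [excess_faceSeq_ge hs (apply_zero ht) hu]
      exact H _ (by omega) (by omega)

lemma weight_first_lt (h : p + s = n + 1) (hs : 2 ≤ s) (ht : t ∈ Assoc (p + 2))
    (hu : u ∈ Assoc s) {q : ℕ} (hq : q + 1 < s) : weight (faceSeq 0 s t u) n q = 1 := by
  have : height (faceSeq 0 s t u) n q = 0 := by
    refine le_antisymm (height_le.2 fun i hi => ?_) (height_nonneg (by omega))
    rw [incr, futMin_first_zero h hs ht hu (by omega), futMin_first_zero h hs ht hu (by omega),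
      sub_zero]
  rw [weight, this, sub_zero]

lemma weight_first_ge (h : p + s = n + 1) (hs : 2 ≤ s) (ht : t ∈ Assoc (p + 2))
    (hu : u ∈ Assoc s) {q : ℕ} (hq : q < p) :
    weight (faceSeq 0 s t u) n (s - 1 + q) = weight t p q := by
  have key : ∀ i < p, incr (faceSeq 0 s t u) n (s - 1 + i) = incr t p i := by
    intro i hi
    have e1 := futMin_ge (k := 0) (i := i) h hs ht hu (by omega)
    have e2 := futMin_ge (k := 0) (i := i + 1) h hs ht hu (by omega)
    simp only [zero_add] at e1 e2
    rw [incr, incr, ← e1, ← e2, add_assoc]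
  unfold weight
  congr 1
  refine eq_of_forall_ge_iff fun a => ?_
  rw [height_le, height_le]
  constructor
  · intro H i hi
    rw [← key i (by omega)]
    exact H _ (by omega)
  · intro H i hi
    rcases lt_or_ge i (s - 1) with h1 | h1
    · have : incr (faceSeq 0 s t u) n i = 0 := by
        rw [incr, futMin_first_zero h hs ht hu (by omega),
          futMin_first_zero h hs ht hu (by omega), sub_zero]
      rw [this]
      exact (incr_nonneg (by omega)).trans (H 0 (Nat.zero_le _))
    · obtain ⟨l, rfl⟩ : ∃ l, i = s - 1 + l := ⟨i - (s - 1), by omega⟩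
      rw [key l (by omega)]
      exact H l (by omega)

lemma weight_before {k : ℕ} (h : p + s = n + 1) (hs : 2 ≤ s) (hk : k ≤ p)
    (ht : t ∈ Assoc (p + 2)) (hu : u ∈ Assoc s) {q : ℕ} (hq : q < k) :
    weight (faceSeq (k + 1) s t u) n q = weight t p q := by
  unfold weight
  congr 1
  refine eq_of_forall_ge_iff fun a => ?_
  rw [height_le, height_le]
  refine forall₂_congr fun i hi => ?_
  rw [incr, incr, futMin_before h hs hk ht hu (by omega), futMin_before h hs hk ht hu (by omega)]

lemma weight_mid {k : ℕ} (h : p + s = n + 1) (hs : 2 ≤ s) (hk : k < p)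
    (ht : t ∈ Assoc (p + 2)) (hu : u ∈ Assoc s) {q : ℕ} (h1 : k ≤ q) (h2 : q < k + s) :
    weight (faceSeq (k + 1) s t u) n q = weight t p k := by
  unfold weight
  congr 1
  refine eq_of_forall_ge_iff fun a => ?_
  rw [height_le, height_le]
  have key : ∀ i ≤ k, incr (faceSeq (k + 1) s t u) n i = incr t p i := by
    intro i hi
    rw [incr, incr, futMin_before h hs hk.le ht hu hi]
    rcases Nat.eq_or_lt_of_le hi with rfl | hi
    · rw [futMin_mid h hs hk ht hu le_rfl (by omega)]
    · rw [futMin_before h hs hk.le ht hu hi]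
  constructor
  · intro H i hi
    rw [← key i hi]
    exact H i (by omega)
  · intro H i hi
    rcases le_or_gt i k with h3 | h3
    · rw [key i h3]
      exact H i h3
    · have : incr (faceSeq (k + 1) s t u) n i = 0 := by
        rw [incr, futMin_mid h hs hk ht hu (by omega) (by omega),
          futMin_mid h hs hk ht hu (by omega) (by omega), sub_self]
      rw [this]
      exact (incr_nonneg (by omega)).trans (H 0 (Nat.zero_le _))

lemma weight_after {k : ℕ} (h : p + s = n + 1) (hs : 2 ≤ s) (hk : k < p)
    (ht : t ∈ Assoc (p + 2)) (hu : u ∈ Assoc s) {q : ℕ} (hq : k + 1 + q < p) :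
    weight (faceSeq (k + 1) s t u) n (k + s + q) = weight t p (k + 1 + q) := by
  have key : ∀ i, k + 1 + i < p →
      incr (faceSeq (k + 1) s t u) n (k + s + i) = incr t p (k + 1 + i) := by
    intro i hi
    have e1 := futMin_ge (k := k + 1) (i := i) h hs ht hu (by omega)
    have e2 := futMin_ge (k := k + 1) (i := i + 1) h hs ht hu (by omega)
    rw [show k + 1 + s - 1 + i = k + s + i by omega] at e1
    rw [show k + 1 + s - 1 + (i + 1) = k + s + i + 1 by omega] at e2
    rw [incr, incr, e1, e2, add_assoc (k + 1)]
  have mid : ∀ a, (∀ i < k + s, incr (faceSeq (k + 1) s t u) n i ≤ a) ↔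
      ∀ i ≤ k, incr t p i ≤ a := by
    intro a
    have := congrArg (fun x => 1 - x)
      (weight_mid h hs hk ht hu (show k ≤ k + s - 1 by omega) (by omega))
    simp only [weight, sub_sub_cancel] at this
    rw [← height_le, ← this, height_le]
    exact forall_congr' fun i => by
      rw [show i < k + s ↔ i ≤ k + s - 1 by omega]
  unfold weight
  congr 1
  refine eq_of_forall_ge_iff fun a => ?_
  rw [height_le, height_le]
  constructor
  · intro H i hi
    rcases le_or_gt i k with h3 | h3
    · exact (mid a).1 (fun i hi => H i (by omega)) i h3
    · obtain ⟨l, rfl⟩ : ∃ l, i = k + 1 + l := ⟨i - (k + 1), by omega⟩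
      rw [← key l (by omega)]
      exact H _ (by omega)
  · intro H i hi
    rcases lt_or_ge i (k + s) with h3 | h3
    · exact (mid a).2 (fun i hi => H i (by omega)) i h3
    · obtain ⟨l, rfl⟩ : ∃ l, i = k + s + l := ⟨i - (k + s), by omega⟩
      rw [key l (by omega)]
      exact H _ (by omega)

lemma weight_last (h : p + s = n + 1) (hs : 2 ≤ s)
    (ht : t ∈ Assoc (p + 2)) (hu : u ∈ Assoc s) {q : ℕ} (h1 : p ≤ q) (h2 : q < n) :
    weight (faceSeq (p + 1) s t u) n q = 0 := by
  have hu0 : u 0 = 0 := by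
    rw [show s = s - 1 + 1 by omega] at hu
    exact apply_zero hu
  have hmem := faceSeq_mem (n := n + 2) (k := p + 1) (by omega) hs (by omega) ht hu
  refine le_antisymm ?_ (weight_nonneg hmem.1 h2)
  have e1 : futMin (faceSeq (p + 1) s t u) n p = excess t p := by
    rw [futMin_before h hs le_rfl ht hu le_rfl, futMin_self]
  have e2 : excess t p + 1 ≤ futMin (faceSeq (p + 1) s t u) n (p + 1) := by
    refine (le_futMin (by omega)).2 fun i h3 h4 => ?_
    obtain ⟨l, rfl⟩ : ∃ l, i = p + 1 + l := ⟨i - (p + 1), by omega⟩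
    rw [excess_faceSeq_mid hu0 (by omega)]
    linarith [excess_nonneg hu (i := l) (by omega)]
  have e3 : incr (faceSeq (p + 1) s t u) n p ≤ _ := incr_le_height h1
  rw [incr] at e3
  unfold weight
  linarith

end face

/-! Weights and degeneracies. -/

section degen

variable {n j : ℕ} {t : ℕ → ℝ}

lemma futMin_degen_le (hj : j ≤ n) {i : ℕ} (hi : i ≤ j) :
    futMin (degenSeq (j + 1) t) n i = futMin t (n + 1) i := by
  have e : excess (degenSeq (j + 1) t) j = min (excess t j) (excess t (j + 1)) := by
    rw [excess_degenSeq_ge t (by omega) le_rfl, Nat.sub_self, excess_sub_defect_zero]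
  refine eq_of_forall_le_iff fun a => ?_
  rw [le_futMin (by omega), le_futMin (by omega)]
  constructor
  · intro H q h1 h2
    rcases lt_or_ge q j with h3 | h3
    · have := H q h1 (by omega)
      rwa [excess_degenSeq_lt t (by omega)] at this
    rcases lt_or_ge q (j + 2) with h4 | h4
    · have := H j hi hj
      rw [e, le_min_iff] at this
      rcases Nat.eq_or_lt_of_le h3 with rfl | h5
      · exact this.1
      · obtain rfl : q = j + 1 := by omega
        exact this.2
    · have := H (q - 1) (by omega) (by omega)
      rw [excess_degenSeq_ge t (by omega) (by omega), show q - 1 + 1 = q by omega] at this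
      linarith [defect_nonneg (fun l => t (j + 1 + l)) (q - (j + 1))]
  · intro H q h1 h2
    rcases lt_trichotomy q j with h3 | rfl | h3
    · rw [excess_degenSeq_lt t (by omega)]
      exact H q h1 (by omega)
    · rw [e]
      exact le_min (H _ h1 (by omega)) (H _ (by omega) (by omega))
    · obtain ⟨k, rfl⟩ : ∃ k, q = j + 1 + k := ⟨q - (j + 1), by omega⟩
      rw [excess_degenSeq_ge t (by omega) (by omega), show j + 1 + k + 1 = j + 2 + k by omega,
        show j + 2 + k - (j + 1) = k + 1 by omega]
      obtain ⟨q, h4, h5, h6⟩ := exists_excess_le t j k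
      exact (H q (by omega) (by omega)).trans h6

lemma futMin_degen_gt {i : ℕ} (hi : j < i) (hn : i ≤ n) :
    futMin (degenSeq (j + 1) t) n i =
      futMin t (n + 1) (i + 1) - defect (fun l => t (j + 1 + l)) (n - j) := by
  refine eq_of_forall_le_iff fun a => ?_
  rw [le_sub_iff_add_le, le_futMin hn, le_futMin (by omega)]
  constructor
  · intro H q h1 h2
    have := H (q - 1) (by omega) (by omega)
    rw [excess_degenSeq_ge t (by omega) (by omega), show q - 1 + 1 = q by omega] at this
    have h3 := defect_anti (fun l => t (j + 1 + l)) (show q - (j + 1) ≤ n - j by omega)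
    linarith
  · intro H q h1 h2
    rw [excess_degenSeq_ge t (by omega) (by omega)]
    obtain ⟨k, rfl⟩ : ∃ k, q = j + 1 + k := ⟨q - (j + 1), by omega⟩
    rw [show j + 1 + k + 1 = j + 2 + k by omega, show j + 2 + k - (j + 1) = k + 1 by omega]
    rcases defect_cases (fun l => t (j + 1 + l)) (show k + 1 ≤ n - j by omega)
      with h | ⟨l, h3, h4, h5⟩
    · rw [← h]
      linarith [H (j + 2 + k) (by omega) (by omega)]
    · obtain ⟨q, h6, h7, h8⟩ := exists_excess_le t j k
      have h9 := le_runMax (fun l => t (j + 1 + l)) (show q - (j + 1) ≤ l by omega)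
      rw [sub_sum_tail, show j + 1 + (q - (j + 1)) = q by omega] at h9
      rw [sub_sum_tail] at h5
      have := H (j + 1 + l) (by omega) (by omega)
      linarith

lemma defect_eq_min (hj : j < n) : defect (fun l => t (j + 1 + l)) (n - j) =
    min (incr t (n + 1) j) (incr t (n + 1) (j + 1)) := by
  have f1 : futMin t (n + 1) j = _ := futMin_succ (by omega)
  have f2 : futMin t (n + 1) (j + 1) = _ := futMin_succ (by omega)
  refine le_antisymm (le_min ?_ ?_) ?_
  · have : futMin t (n + 1) j + defect (fun l => t (j + 1 + l)) (n - j) ≤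
        futMin t (n + 1) (j + 1) := by
      refine (le_futMin (by omega)).2 fun p h1 h2 => ?_
      rcases Nat.eq_or_lt_of_le h1 with rfl | h1
      · have e := excess_sub_defect_zero t j
        have e1 := defect_anti (fun l => t (j + 1 + l)) (Nat.zero_le (n - j))
        have e2 : futMin t (n + 1) j ≤ min (excess t j) (excess t (j + 1)) :=
          le_min (futMin_le le_rfl (by omega)) (futMin_le (by omega) (by omega))
        linarith
      · obtain ⟨k, rfl⟩ : ∃ k, p = j + 2 + k := ⟨p - (j + 2), by omega⟩
        obtain ⟨q, h6, h7, h8⟩ := exists_excess_le t j k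
        have e1 := defect_anti (fun l => t (j + 1 + l)) (show k + 1 ≤ n - j by omega)
        have e2 : futMin t (n + 1) j ≤ excess t q := futMin_le (by omega) (by omega)
        linarith
    rw [incr]
    linarith
  · have : futMin t (n + 1) (j + 1) + defect (fun l => t (j + 1 + l)) (n - j) ≤
        futMin t (n + 1) (j + 2) := by
      refine (le_futMin (by omega)).2 fun p h1 h2 => ?_
      obtain ⟨k, rfl⟩ : ∃ k, p = j + 2 + k := ⟨p - (j + 2), by omega⟩
      obtain ⟨q, h6, h7, h8⟩ := exists_excess_le t j k
      have e1 := defect_anti (fun l => t (j + 1 + l)) (show k + 1 ≤ n - j by omega)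
      have e2 : futMin t (n + 1) (j + 1) ≤ excess t q := futMin_le (by omega) (by omega)
      linarith
    rw [incr]
    linarith
  · rcases defect_cases (fun l => t (j + 1 + l)) (Nat.zero_le (n - j))
      with h | ⟨l, h3, h4, h5⟩
    · refine (min_le_left _ _).trans ?_
      have e := excess_sub_defect_zero t j
      have e1 : futMin t (n + 1) (j + 1) ≤ excess t (j + 1) := futMin_le le_rfl (by omega)
      have e2 := min_le_left (excess t j) (excess t (j + 1))
      have e3 := defect_nonneg (fun l => t (j + 1 + l)) 0
      rw [incr, h, f1]
      rcases min_choice (excess t j) (futMin t (n + 1) (j + 1)) with h | h <;> rw [h] <;> linarith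
    · refine (min_le_right _ _).trans ?_
      have h0 := le_runMax (fun l => t (j + 1 + l)) (Nat.zero_le l)
      have e3 := defect_nonneg (fun l => t (j + 1 + l)) (n - j)
      rw [sub_sum_tail] at h5
      rw [sub_sum_tail, add_zero] at h0
      have e1 : futMin t (n + 1) (j + 2) ≤ excess t (j + 1 + l) :=
        futMin_le (by omega) (by omega)
      rw [incr, f2]
      rcases min_choice (excess t (j + 1)) (futMin t (n + 1) (j + 1 + 1)) with h | h <;>
        rw [h] <;> linarith

lemma weight_degen_lt (hj : j ≤ n) {q : ℕ} (hq : q < j) :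
    weight (degenSeq (j + 1) t) n q = weight t (n + 1) q := by
  unfold weight
  congr 1
  refine eq_of_forall_ge_iff fun a => ?_
  rw [height_le, height_le]
  refine forall₂_congr fun i hi => ?_
  rw [incr, incr, futMin_degen_le hj (by omega), futMin_degen_le hj (by omega)]

lemma weight_degen_ge {q : ℕ} (h1 : j ≤ q) (h2 : q < n) :
    weight (degenSeq (j + 1) t) n q = weight t (n + 1) (q + 1) := by
  have e1 : ∀ i < j, incr (degenSeq (j + 1) t) n i = incr t (n + 1) i := by
    intro i hi
    rw [incr, incr, futMin_degen_le (by omega) (by omega), futMin_degen_le (by omega) (by omega)]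
  have e2 : incr (degenSeq (j + 1) t) n j =
      max (incr t (n + 1) j) (incr t (n + 1) (j + 1)) := by
    rw [incr, futMin_degen_gt (by omega) (by omega), futMin_degen_le (by omega) le_rfl,
      defect_eq_min (by omega)]
    have := min_add_max (incr t (n + 1) j) (incr t (n + 1) (j + 1))
    have d1 : incr t (n + 1) j = futMin t (n + 1) (j + 1) - futMin t (n + 1) j := rfl
    have d2 : incr t (n + 1) (j + 1) = futMin t (n + 1) (j + 1 + 1) - futMin t (n + 1) (j + 1) :=
      rfl
    linarith
  have e3 : ∀ i, j < i → i < n → incr (degenSeq (j + 1) t) n i = incr t (n + 1) (i + 1) := by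
    intro i h3 h4
    rw [incr, incr, futMin_degen_gt (by omega) (by omega), futMin_degen_gt (by omega) (by omega)]
    ring
  unfold weight
  congr 1
  refine eq_of_forall_ge_iff fun a => ?_
  rw [height_le, height_le]
  constructor
  · intro H i hi
    rcases lt_or_ge i j with h3 | h3
    · rw [← e1 i h3]
      exact H i (by omega)
    rcases lt_or_ge i (j + 2) with h4 | h4
    · have := H j h1
      rw [e2, max_le_iff] at this
      rcases Nat.eq_or_lt_of_le h3 with rfl | h5
      · exact this.1
      · obtain rfl : i = j + 1 := by omega
        exact this.2
    · obtain ⟨i, rfl⟩ : ∃ i', i = i' + 1 := ⟨i - 1, by omega⟩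
      rw [← e3 i (by omega) (by omega)]
      exact H i (by omega)
  · intro H i hi
    rcases lt_trichotomy i j with h3 | rfl | h3
    · rw [e1 i h3]
      exact H i (by omega)
    · rw [e2]
      exact max_le (H _ (by omega)) (H _ (by omega))
    · rw [e3 i h3 (by omega)]
      exact H _ (by omega)

end degen

lemma continuous_weight (n q : ℕ) : Continuous fun t : ℕ → ℝ => weight t n q := by
  have h1 : ∀ i, Continuous fun t : ℕ → ℝ => excess t i := fun i => by
    unfold excess
    fun_prop
  have h2 : ∀ i, Continuous fun t : ℕ → ℝ => futMin t n i := fun i => by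
    unfold futMin
    exact Continuous.finset_inf'_apply _ fun p _ => h1 (i + p)
  have h3 : ∀ i, Continuous fun t : ℕ → ℝ => incr t n i := fun i => by
    unfold incr
    exact (h2 _).sub (h2 _)
  unfold weight height
  exact continuous_const.sub (Continuous.finset_sup'_apply _ fun i _ => h3 i)

end Assoc

/-! ## `A_∞`-spaces and their projective spaces -/

/-- `(g_1,…,g_n) ↦ (g_1,…,g_k, a, g_{k+s+1},…,g_n)`, a sequence of length `r = n + 1 - s`. -/
def mergeSeq {G : Type*} {n r s : ℕ} (k : ℕ) (h : r + s = n + 1) (hs : 2 ≤ s) (g : Fin n → G)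
    (a : G) (i : Fin r) : G :=
  if (i : ℕ) < k then g ⟨i, by omega⟩
  else if (i : ℕ) = k then a
  else g ⟨i + s - 1, by omega⟩

/-- An `A_∞`-form on a space `G` with (strict) unit `e`: maps `α_n : K(n) × G^n → G`, with `α_1` the
identity, that satisfy the boundary and the unital conditions. -/
structure AInfForm (G : Type*) [TopologicalSpace G] (e : G) where
  α : ∀ n : ℕ, C(Assoc n × (Fin n → G), G)
  α_one : ∀ (τ : Assoc 1) (g : Fin 1 → G), α 1 (τ, g) = g 0
  boundary : ∀ {n r s : ℕ} (k : ℕ) (h : r + s = n + 1) (_ : 2 ≤ r) (hs : 2 ≤ s) (hk : k < r)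
    (ρ : Assoc r) (σ : Assoc s) (g : Fin n → G),
    α n (Assoc.face k h hs hk ρ σ, g) =
      α r (ρ, mergeSeq k h hs g (α s (σ, fun i : Fin s => g ⟨k + i, by omega⟩)))
  unital : ∀ {n : ℕ} (j : Fin (n + 2)) (τ : Assoc (n + 2)) (g : Fin (n + 2) → G), g j = e →
    α (n + 2) (τ, g) = α (n + 1) (Assoc.degen j j.2 τ, fun i => g (j.succAbove i))

section ProjectiveSpace

variable {G : Type*} [TopologicalSpace G] {e : G}

/-- The disjoint union of the `K(n + 2) × G^n` for `0 ≤ n ≤ m`. A point of `K(n + 2) × G^n` is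
written `(τ; g_2, …, g_{n+1})`, so that `g_{i+2}` is the value at `i : Fin n`. -/
abbrev ProjCells (G : Type*) (m : ℕ) : Type _ :=
  Σ n : Fin (m + 1), Assoc (n + 2) × (Fin n → G)

/-- The point `(τ; g_2, …, g_{n+1})` of `K(n + 2) × G^n`. -/
abbrev ProjCells.mk {m : ℕ} (n : ℕ) (hn : n < m + 1) (τ : Assoc (n + 2)) (g : Fin n → G) :
    ProjCells G m :=
  ⟨⟨n, hn⟩, τ, g⟩

/-- The identifications that attach `K(n + 2) × G^n` along
`∂K(n + 2) × G^n ∪ K(n + 2) × G^[n]` to the cells of lower dimension. For a point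
`(∂_k(ρ, σ); g_2, …, g_{n+1})` with `ρ ∈ K(r)`, `σ ∈ K(s)`, `r = p + 2` and `r + s = n + 3`, it is
identified with
* `(ρ; g_{s+1}, …, g_{n+1})` if `k = 1`,
* `(ρ; g_2, …, α_s(σ; g_k, …, g_{k+s-1}), …, g_{n+1})` if `1 < k < r`,
* `(ρ; g_2, …, g_{r-1})` if `k = r`;

and `(τ; g_2, …, g_{j-1}, e, g_{j+1}, …, g_{n+1})` is identified with
`(s_j(τ); g_2, …, g_{j-1}, g_{j+1}, …, g_{n+1})` for `1 < j < n + 2`. -/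
inductive ProjRel (A : AInfForm G e) (m : ℕ) : ProjCells G m → ProjCells G m → Prop
  | first {n p s : ℕ} (hn : n < m + 1) (hp : p < m + 1) (h : p + s = n + 1) (hs : 2 ≤ s)
      (ρ : Assoc (p + 2)) (σ : Assoc s) (g : Fin n → G) :
      ProjRel A m
        (.mk n hn (Assoc.face 0 (by omega) hs (by omega) ρ σ) g)
        (.mk p hp ρ fun i : Fin p => g ⟨s - 1 + i, by omega⟩)
  | middle {n p s : ℕ} (k : ℕ) (hk : k < p) (hn : n < m + 1) (hp : p < m + 1)
      (h : p + s = n + 1) (hs : 2 ≤ s)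
      (ρ : Assoc (p + 2)) (σ : Assoc s) (g : Fin n → G) :
      ProjRel A m
        (.mk n hn (Assoc.face (k + 1) (by omega) hs (by omega) ρ σ) g)
        (.mk p hp ρ (mergeSeq k h hs g (A.α s (σ, fun i : Fin s => g ⟨k + i, by omega⟩))))
  | last {n p s : ℕ} (hn : n < m + 1) (hp : p < m + 1) (h : p + s = n + 1) (hs : 2 ≤ s)
      (ρ : Assoc (p + 2)) (σ : Assoc s) (g : Fin n → G) :
      ProjRel A m
        (.mk n hn (Assoc.face (p + 1) (by omega) hs (by omega) ρ σ) g)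
        (.mk p hp ρ fun i : Fin p => g ⟨i, by omega⟩)
  | degen {n : ℕ} (hn : n + 1 < m + 1) (hn' : n < m + 1) (j : Fin (n + 1))
      (τ : Assoc (n + 1 + 2)) (g : Fin (n + 1) → G) (hg : g j = e) :
      ProjRel A m
        (.mk (n + 1) hn τ g)
        (.mk n hn' (Assoc.degen (n := n + 1) (j + 1) (by omega) τ) fun i => g (j.succAbove i))

/-- The projective `m`-space `P^m(G)` of an `A_∞`-space `G` (the base of its standard
`A_∞`-structure). -/
def ProjSpace (A : AInfForm G e) (m : ℕ) : Type _ := Quot (ProjRel A m)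

instance (A : AInfForm G e) (m : ℕ) : TopologicalSpace (ProjSpace A m) :=
  inferInstanceAs (TopologicalSpace (Quot (ProjRel A m)))

/-- The base point of `P^m(G)`, the point `P^0(G)`. -/
def ProjSpace.base (A : AInfForm G e) (m : ℕ) : ProjSpace A m :=
  Quot.mk _ (.mk 0 (Nat.succ_pos m) Assoc.pt Fin.elim0)

end ProjectiveSpace

/-! ## The loop space -/

/-- The space `ΩX` of (Moore) loops at `x₀`: pairs of a path `γ : [0, ∞) → X` and a length `ℓ ≥ 0`
such that `γ` starts at `x₀` and stays at `x₀` from time `ℓ` on. -/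
def MooreLoop {X : Type*} [TopologicalSpace X] (x₀ : X) : Type _ :=
  {γ : C(ℝ≥0, X) × ℝ≥0 // γ.1 0 = x₀ ∧ ∀ t, γ.2 ≤ t → γ.1 t = x₀}

namespace MooreLoop

variable {X : Type*} [TopologicalSpace X] {x₀ : X}

instance : TopologicalSpace (MooreLoop x₀) := instTopologicalSpaceSubtype

/-- The underlying path. -/
def path (a : MooreLoop x₀) : C(ℝ≥0, X) := a.1.1

/-- The length. -/
def len (a : MooreLoop x₀) : ℝ≥0 := a.1.2

lemma path_zero (a : MooreLoop x₀) : a.path 0 = x₀ := a.2.1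

lemma path_of_le (a : MooreLoop x₀) {t : ℝ≥0} (h : a.len ≤ t) : a.path t = x₀ := a.2.2 t h

@[ext]
lemma ext {a b : MooreLoop x₀} (h : ∀ t, a.path t = b.path t) (h' : a.len = b.len) : a = b :=
  Subtype.ext (Prod.ext (ContinuousMap.ext h) h')

lemma continuous_path : Continuous (path : MooreLoop x₀ → C(ℝ≥0, X)) :=
  continuous_fst.comp continuous_subtype_val

lemma continuous_len : Continuous (len : MooreLoop x₀ → ℝ≥0) :=
  continuous_snd.comp continuous_subtype_val

lemma continuous_path_eval {Y : Type*} [TopologicalSpace Y] {f : Y → MooreLoop x₀}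
    {t : Y → ℝ≥0} (hf : Continuous f) (ht : Continuous t) :
    Continuous fun y => (f y).path (t y) :=
  continuous_eval.comp ((continuous_path.comp hf).prodMk ht)

lemma continuous_concat : Continuous fun x : (MooreLoop x₀ × MooreLoop x₀) × ℝ≥0 =>
    if x.2 ≤ x.1.1.len then x.1.1.path x.2 else x.1.2.path (x.2 - x.1.1.len) := by
  have h1 : Continuous fun x : (MooreLoop x₀ × MooreLoop x₀) × ℝ≥0 => x.1.1.len :=
    continuous_len.comp (continuous_fst.comp continuous_fst)
  refine Continuous.if_le ?_ ?_ continuous_snd h1 ?_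
  · exact continuous_path_eval (continuous_fst.comp continuous_fst) continuous_snd
  · exact continuous_path_eval (continuous_snd.comp continuous_fst) (continuous_snd.sub h1)
  · intro x hx
    rw [path_of_le _ hx.ge, hx, tsub_self, path_zero]

/-- Concatenation of loops. -/
instance : Mul (MooreLoop x₀) where
  mul a b := ⟨(⟨fun t => if t ≤ a.len then a.path t else b.path (t - a.len),
      continuous_concat.comp (Continuous.prodMk_right (a, b))⟩, a.len + b.len), by
    constructor
    · simpa using a.path_zero
    · intro t ht
      simp only [ContinuousMap.coe_mk]
      split_ifs with h
      · exact a.path_of_le ((le_add_of_nonneg_right zero_le).trans ht)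
      · exact b.path_of_le (le_tsub_of_add_le_left ht)⟩

/-- The loop of length `0`. -/
instance : One (MooreLoop x₀) where
  one := ⟨(ContinuousMap.const _ x₀, 0), rfl, fun _ _ => rfl⟩

lemma mul_path (a b : MooreLoop x₀) (t : ℝ≥0) :
    (a * b).path t = if t ≤ a.len then a.path t else b.path (t - a.len) := rfl

lemma mul_len (a b : MooreLoop x₀) : (a * b).len = a.len + b.len := rfl

lemma one_path (t : ℝ≥0) : (1 : MooreLoop x₀).path t = x₀ := rfl

lemma one_len : (1 : MooreLoop x₀).len = 0 := rfl

lemma mul_path_of_le (a b : MooreLoop x₀) {t : ℝ≥0} (h : t ≤ a.len) :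
    (a * b).path t = a.path t := by
  rw [mul_path, if_pos h]

lemma mul_path_add (a b : MooreLoop x₀) (t : ℝ≥0) :
    (a * b).path (a.len + t) = b.path t := by
  rw [mul_path]
  split_ifs with h
  · have : t = 0 := by simpa using h
    rw [this, add_zero, path_of_le _ le_rfl, path_zero]
  · rw [add_tsub_cancel_left]

instance : Monoid (MooreLoop x₀) where
  mul_assoc a b c := by
    refine ext (fun t => ?_) (add_assoc _ _ _)
    rcases le_total t a.len with h | h
    · rw [mul_path_of_le _ _ (h.trans (le_add_of_nonneg_right zero_le)),
        mul_path_of_le _ _ h, mul_path_of_le _ _ h]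
    · obtain ⟨t, rfl⟩ := exists_add_of_le h
      rw [mul_path_add]
      rcases le_total t b.len with h | h
      · rw [mul_path_of_le _ _ (by rw [mul_len]; gcongr), mul_path_add, mul_path_of_le _ _ h]
      · obtain ⟨t, rfl⟩ := exists_add_of_le h
        rw [mul_path_add, ← add_assoc, ← mul_len, mul_path_add]
  one_mul a := by
    refine ext (fun t => ?_) (zero_add _)
    have := mul_path_add 1 a t
    rwa [one_len, zero_add] at this
  mul_one a := by
    refine ext (fun t => ?_) (add_zero _)
    rw [mul_path]
    split_ifs with h
    · rfl
    · rw [one_path, path_of_le _ (not_le.1 h).le]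

instance : ContinuousMul (MooreLoop x₀) where
  continuous_mul := by
    refine Continuous.subtype_mk (Continuous.prodMk ?_ ?_) _
    · exact ContinuousMap.continuous_of_continuous_uncurry _ continuous_concat
    · exact (continuous_len.comp continuous_fst).add (continuous_len.comp continuous_snd)

end MooreLoop

/-! ### Products of segments of a sequence in a monoid -/

section Segments

variable {M : Type*} [Monoid M]

/-- `f a * f (a + 1) * ⋯ * f (a + b - 1)`. -/
def segProd (f : ℕ → M) (a b : ℕ) : M := ((List.range' a b).map f).prod

/-- A finite sequence, continued by `1`. -/
def padOne {n : ℕ} (g : Fin n → M) (i : ℕ) : M := if h : i < n then g ⟨i, h⟩ else 1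

lemma padOne_of_lt {n : ℕ} (g : Fin n → M) {i : ℕ} (h : i < n) : padOne g i = g ⟨i, h⟩ :=
  dif_pos h

lemma segProd_add (f : ℕ → M) (a b c : ℕ) :
    segProd f a (b + c) = segProd f a b * segProd f (a + b) c := by
  unfold segProd
  rw [← List.prod_append, ← List.map_append, List.range'_append_1]

lemma segProd_one (f : ℕ → M) (a : ℕ) : segProd f a 1 = f a := by
  simp [segProd]

lemma segProd_congr {f f' : ℕ → M} {a a' b : ℕ} (h : ∀ i < b, f (a + i) = f' (a' + i)) :
    segProd f a b = segProd f' a' b := by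
  induction b with
  | zero => rfl
  | succ b ih =>
    rw [segProd_add, segProd_add, segProd_one, segProd_one, ih fun i hi => h i (by omega),
      h b (Nat.lt_succ_self b)]

lemma prod_ofFn_eq {n : ℕ} (g : Fin n → M) : (List.ofFn g).prod = segProd (padOne g) 0 n := by
  unfold segProd
  congr 1
  refine List.ext_getElem (by simp) fun i h1 h2 => ?_
  have : i < n := by simpa using h1
  simp [padOne, this]

lemma prod_ofFn_eq_shift {n s k : ℕ} (g : Fin n → M) (h : k + s ≤ n) :
    (List.ofFn fun i : Fin s => g ⟨k + i, by omega⟩).prod = segProd (padOne g) k s := by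
  rw [prod_ofFn_eq]
  refine segProd_congr fun i hi => ?_
  rw [zero_add, padOne_of_lt _ hi, padOne_of_lt _ (by omega)]

lemma padOne_mergeSeq_lt {n r s k : ℕ} (h : r + s = n + 1) (hs : 2 ≤ s) (g : Fin n → M) (a : M)
    (hk : k < r) {i : ℕ} (hi : i < k) : padOne (mergeSeq k h hs g a) i = padOne g i := by
  rw [padOne_of_lt _ (by omega), padOne_of_lt _ (by omega)]
  simp [mergeSeq, hi]

lemma padOne_mergeSeq_self {n r s k : ℕ} (h : r + s = n + 1) (hs : 2 ≤ s) (g : Fin n → M) (a : M)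
    (hk : k < r) : padOne (mergeSeq k h hs g a) k = a := by
  rw [padOne_of_lt _ hk]
  simp [mergeSeq]

lemma padOne_mergeSeq_gt {n r s k : ℕ} (h : r + s = n + 1) (hs : 2 ≤ s) (g : Fin n → M) (a : M)
    {i : ℕ} (hi : k + 1 + i < r) :
    padOne (mergeSeq k h hs g a) (k + 1 + i) = padOne g (k + s + i) := by
  rw [padOne_of_lt _ hi, padOne_of_lt _ (by omega)]
  simp only [mergeSeq, show ¬ (k + 1 + i < k) by omega, show k + 1 + i ≠ k by omega, if_false]
  congr 2
  omega

lemma padOne_succAbove_lt {n : ℕ} (g : Fin (n + 1) → M) (j : Fin (n + 1)) {i : ℕ} (hi : i < j) :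
    padOne (fun l : Fin n => g (j.succAbove l)) i = padOne g i := by
  rw [padOne_of_lt _ (by omega), padOne_of_lt _ (by omega), Fin.succAbove_of_castSucc_lt]
  · rfl
  · exact hi

lemma padOne_succAbove_ge {n : ℕ} (g : Fin (n + 1) → M) (j : Fin (n + 1)) {i : ℕ} (hi : j ≤ i)
    (hn : i < n) : padOne (fun l : Fin n => g (j.succAbove l)) i = padOne g (i + 1) := by
  rw [padOne_of_lt _ hn, padOne_of_lt _ (by omega), Fin.succAbove_of_le_castSucc]
  · rfl
  · exact hi

/-- Deleting a unit does not change a product. -/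
lemma prod_succAbove {n : ℕ} (g : Fin (n + 1) → M) (j : Fin (n + 1)) (hg : g j = 1) :
    (List.ofFn fun l : Fin n => g (j.succAbove l)).prod = (List.ofFn g).prod := by
  obtain ⟨l, hl⟩ : ∃ l, n = j + l := ⟨n - j, by omega⟩
  have e1 := congrArg (segProd (padOne fun l : Fin n => g (j.succAbove l)) 0) hl
  have e2 := congrArg (segProd (padOne g) 0) (show n + 1 = j + (1 + l) by omega)
  rw [prod_ofFn_eq, prod_ofFn_eq, e1, e2, segProd_add, segProd_add, segProd_add _ _ 1, segProd_one, zero_add,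
    padOne_of_lt g j.2, Fin.eta, hg, one_mul]
  congr 1
  · exact segProd_congr fun i hi => by rw [zero_add, padOne_succAbove_lt g j hi]
  · refine segProd_congr fun i hi => ?_
    rw [padOne_succAbove_ge g j (by omega) (by omega)]
    congr 1
    omega

/-- Merging a segment into its product does not change a product. -/
lemma prod_mergeSeq {n r s k : ℕ} (h : r + s = n + 1) (hs : 2 ≤ s) (hk : k < r) (g : Fin n → M) :
    (List.ofFn (mergeSeq k h hs g
      (List.ofFn fun i : Fin s => g ⟨k + i, by omega⟩).prod)).prod = (List.ofFn g).prod := by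
  obtain ⟨l, rfl⟩ : ∃ l, r = k + (1 + l) := ⟨r - k - 1, by omega⟩
  obtain rfl : n = k + (s + l) := by omega
  rw [prod_ofFn_eq, prod_ofFn_eq g, segProd_add, segProd_add _ _ 1, segProd_add _ _ k,
    segProd_add _ _ s, segProd_one, zero_add, padOne_mergeSeq_self h hs g _ hk,
    prod_ofFn_eq_shift g (by omega)]
  congr 1
  · exact segProd_congr fun i hi => by rw [zero_add, padOne_mergeSeq_lt h hs g _ hk hi]
  · congr 1
    exact segProd_congr fun i hi => padOne_mergeSeq_gt h hs g _ (by omega)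

end Segments

/-! ## The natural maps `P^m ΩX → X` -/

section Natural

variable {X : Type*} [TopologicalSpace X]

/-- The `A_∞`-form of the associative `H`-space `ΩX`: `α_n(τ; g_1, …, g_n) = g_1 ⋯ g_n`. -/
def loopForm (x₀ : X) : AInfForm (MooreLoop x₀) 1 where
  α n := ⟨fun x => (List.ofFn x.2).prod, by
    simp only [List.ofFn_eq_map]
    exact continuous_list_prod _ fun i _ => (continuous_apply i).comp continuous_snd⟩
  α_one τ g := by simp
  boundary k h hr hs hk ρ σ g := (prod_mergeSeq h hs hk g).symm
  unital j τ g hg := (prod_succAbove g j hg).symm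

/-- The projective `m`-space `P^m ΩX` of the loop space of `X` at `x₀`. -/
abbrev LoopProjSpace (x₀ : X) (m : ℕ) : Type _ := ProjSpace (loopForm x₀) m

/-- The map `K(n + 2) × (ΩX)^n → X` that sends `(τ; g_2, …, g_{n+1})` to the point that the
concatenation `g_2 ⋯ g_{n+1}` reaches at the time `∑ w_i ℓ_i`, where `ℓ_i` is the length of `g_i`
and `w_i ∈ [0, 1]` is the corresponding weight of `τ`. -/
def cellEval (x₀ : X) (n : ℕ) (x : Assoc (n + 2) × (Fin n → MooreLoop x₀)) : X :=
  (List.ofFn x.2).prod.path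
    (∑ i : Fin n, (Assoc.weight x.1 n i).toNNReal * (x.2 i).len)

variable {x₀ : X}

lemma continuous_cellEval (n : ℕ) : Continuous (cellEval x₀ n) := by
  unfold cellEval
  refine MooreLoop.continuous_path_eval ?_ ?_
  · simp only [List.ofFn_eq_map]
    exact continuous_list_prod _ fun i _ => (continuous_apply i).comp continuous_snd
  · refine continuous_finsetSum _ fun i _ => Continuous.mul ?_ ?_
    · exact continuous_real_toNNReal.comp
        ((Assoc.continuous_weight n i).comp (continuous_subtype_val.comp continuous_fst))
    · exact MooreLoop.continuous_len.comp ((continuous_apply i).comp continuous_snd)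

/-- The time `∑ w_i ℓ_i`. -/
def evalTime (w : ℕ → ℝ) (f : ℕ → MooreLoop x₀) (n : ℕ) : ℝ≥0 :=
  ∑ i ∈ Finset.range n, (w i).toNNReal * (f i).len

lemma cellEval_eq (n : ℕ) (τ : Assoc (n + 2)) (g : Fin n → MooreLoop x₀) :
    cellEval x₀ n (τ, g) =
      (segProd (padOne g) 0 n).path (evalTime (Assoc.weight τ n) (padOne g) n) := by
  rw [cellEval, prod_ofFn_eq, evalTime, Finset.sum_range]
  congr 1
  refine Finset.sum_congr rfl fun i _ => ?_
  rw [padOne_of_lt g i.2]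

lemma segProd_len (f : ℕ → MooreLoop x₀) (a b : ℕ) :
    (segProd f a b).len = ∑ i ∈ Finset.range b, (f (a + i)).len := by
  induction b with
  | zero => rfl
  | succ b ih => rw [segProd_add, segProd_one, MooreLoop.mul_len, ih, Finset.sum_range_succ]

lemma evalTime_add (w : ℕ → ℝ) (f : ℕ → MooreLoop x₀) (a b : ℕ) : evalTime w f (a + b) =
    evalTime w f a + evalTime (fun i => w (a + i)) (fun i => f (a + i)) b :=
  Finset.sum_range_add _ a b

lemma evalTime_congr {w w' : ℕ → ℝ} {f f' : ℕ → MooreLoop x₀} {n : ℕ} (hw : ∀ i < n, w i = w' i)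
    (hf : ∀ i < n, f i = f' i) : evalTime w f n = evalTime w' f' n :=
  Finset.sum_congr rfl fun i hi => by
    rw [hw i (Finset.mem_range.1 hi), hf i (Finset.mem_range.1 hi)]

lemma evalTime_const {w : ℕ → ℝ} {c : ℝ} {f : ℕ → MooreLoop x₀} {a n : ℕ}
    (hw : ∀ i < n, w i = c) :
    evalTime w (fun i => f (a + i)) n = c.toNNReal * (segProd f a n).len := by
  rw [segProd_len, Finset.mul_sum]
  exact Finset.sum_congr rfl fun i hi => by rw [hw i (Finset.mem_range.1 hi)]

lemma cellEval_first {n p s : ℕ} (h : p + s = n + 1) (hs : 2 ≤ s) (ρ : Assoc (p + 2))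
    (σ : Assoc s) (g : Fin n → MooreLoop x₀) :
    cellEval x₀ n (Assoc.face 0 (by omega) hs (by omega) ρ σ, g) =
      cellEval x₀ p (ρ, fun i : Fin p => g ⟨s - 1 + i, by omega⟩) := by
  rw [cellEval_eq, cellEval_eq]
  obtain ⟨a, rfl⟩ : ∃ a, s = a + 1 := ⟨s - 1, by omega⟩
  obtain rfl : n = a + p := by omega
  have h1 : evalTime (Assoc.weight (Assoc.faceSeq 0 (a + 1) ρ σ) (a + p)) (padOne g) a =
      (segProd (padOne g) 0 a).len := by
    have := evalTime_const (c := 1) (f := padOne g) (a := 0) (n := a)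
      (w := Assoc.weight (Assoc.faceSeq 0 (a + 1) ρ σ) (a + p))
      (fun i hi => Assoc.weight_first_lt h hs ρ.2 σ.2 (by omega))
    simpa using this
  simp only [Assoc.face, Nat.add_sub_cancel]
  rw [segProd_add, evalTime_add, h1, MooreLoop.mul_path_add]
  have hpad : ∀ i < p, padOne g (a + i) = padOne (fun i : Fin p => g ⟨a + i, by omega⟩) i := by
    intro i hi
    rw [padOne_of_lt _ hi, padOne_of_lt _ (by omega)]
  have h2 : segProd (padOne g) (0 + a) p =
      segProd (padOne fun i : Fin p => g ⟨a + i, by omega⟩) 0 p :=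
    segProd_congr fun i hi => by rw [zero_add, zero_add]; exact hpad i hi
  have h3 : evalTime (fun i => Assoc.weight (Assoc.faceSeq 0 (a + 1) ρ σ) (a + p) (a + i))
      (fun i => padOne g (a + i)) p =
      evalTime (Assoc.weight ρ p) (padOne fun i : Fin p => g ⟨a + i, by omega⟩) p :=
    evalTime_congr (fun i hi => Assoc.weight_first_ge h hs ρ.2 σ.2 hi) hpad
  rw [h2, h3]

lemma cellEval_middle {n p s : ℕ} (k : ℕ) (hk : k < p) (h : p + s = n + 1) (hs : 2 ≤ s)
    (ρ : Assoc (p + 2)) (σ : Assoc s) (g : Fin n → MooreLoop x₀) :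
    cellEval x₀ n (Assoc.face (k + 1) (by omega) hs (by omega) ρ σ, g) =
      cellEval x₀ p (ρ, mergeSeq k h hs g
        (List.ofFn fun i : Fin s => g ⟨k + i, by omega⟩).prod) := by
  rw [cellEval_eq, cellEval_eq, ← prod_ofFn_eq, ← prod_ofFn_eq, prod_mergeSeq h hs hk g]
  congr 1
  simp only [Assoc.face]
  obtain ⟨l, rfl⟩ : ∃ l, p = k + 1 + l := ⟨p - k - 1, by omega⟩
  obtain rfl : n = k + s + l := by omega
  rw [evalTime_add, evalTime_add _ _ (k + 1), evalTime_add, evalTime_add]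
  congr 1
  · congr 1
    · exact evalTime_congr (fun i hi => Assoc.weight_before h hs hk.le ρ.2 σ.2 hi)
        fun i hi => (padOne_mergeSeq_lt h hs g _ hk hi).symm
    · rw [evalTime_const (c := Assoc.weight ρ (k + 1 + l) k) fun i hi =>
        Assoc.weight_mid h hs hk ρ.2 σ.2 (by omega) (by omega)]
      simp only [evalTime, Finset.sum_range_one, add_zero]
      rw [padOne_mergeSeq_self h hs g _ hk, prod_ofFn_eq_shift g (by omega)]
  · exact evalTime_congr (fun i hi => Assoc.weight_after h hs hk ρ.2 σ.2 (by omega))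
      fun i hi => (padOne_mergeSeq_gt h hs g _ (by omega)).symm

lemma cellEval_last {n p s : ℕ} (h : p + s = n + 1) (hs : 2 ≤ s) (ρ : Assoc (p + 2))
    (σ : Assoc s) (g : Fin n → MooreLoop x₀) :
    cellEval x₀ n (Assoc.face (p + 1) (by omega) hs (by omega) ρ σ, g) =
      cellEval x₀ p (ρ, fun i : Fin p => g ⟨i, by omega⟩) := by
  rw [cellEval_eq, cellEval_eq]
  obtain ⟨a, rfl⟩ : ∃ a, s = a + 1 := ⟨s - 1, by omega⟩
  obtain rfl : n = p + a := by omega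
  have hpad : ∀ i < p, padOne g i = padOne (fun i : Fin p => g ⟨i, by omega⟩) i := by
    intro i hi
    rw [padOne_of_lt _ hi, padOne_of_lt _ (by omega)]
  simp only [Assoc.face]
  have h1 : evalTime
      (fun i => Assoc.weight (Assoc.faceSeq (p + 1) (a + 1) ρ σ) (p + a) (p + i))
      (fun i => padOne g (p + i)) a = 0 := by
    rw [evalTime_const (c := 0)
      fun i hi => Assoc.weight_last h hs ρ.2 σ.2 (by omega) (by omega)]
    simp
  have h2 : evalTime (Assoc.weight (Assoc.faceSeq (p + 1) (a + 1) ρ σ) (p + a)) (padOne g) p =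
      evalTime (Assoc.weight ρ p) (padOne fun i : Fin p => g ⟨i, by omega⟩) p :=
    evalTime_congr (fun i hi => Assoc.weight_before h hs le_rfl ρ.2 σ.2 hi) hpad
  have h3 : segProd (padOne g) 0 p =
      segProd (padOne fun i : Fin p => g ⟨i, by omega⟩) 0 p :=
    segProd_congr fun i hi => by rw [zero_add]; exact hpad i hi
  rw [segProd_add, evalTime_add, h1, add_zero, h2, h3, MooreLoop.mul_path_of_le]
  rw [segProd_len]
  refine Finset.sum_le_sum fun i hi => ?_
  rw [zero_add]
  refine mul_le_of_le_one_left zero_le (Real.toNNReal_le_one.2 (Assoc.weight_le_one ?_))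
  have := Finset.mem_range.1 hi
  omega

lemma cellEval_degen {n : ℕ} (j : Fin (n + 1)) (τ : Assoc (n + 1 + 2))
    (g : Fin (n + 1) → MooreLoop x₀) (hg : g j = 1) :
    cellEval x₀ (n + 1) (τ, g) =
      cellEval x₀ n (Assoc.degen (n := n + 1) (j + 1) (by omega) τ,
        fun i => g (j.succAbove i)) := by
  rw [cellEval_eq, cellEval_eq, ← prod_ofFn_eq, ← prod_ofFn_eq, prod_succAbove g j hg]
  congr 1
  simp only [Assoc.degen]
  obtain ⟨j, hj⟩ := j
  obtain ⟨l, rfl⟩ : ∃ l, n = j + l := ⟨n - j, by omega⟩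
  rw [show evalTime (Assoc.weight τ (j + l + 1)) (padOne g) (j + l + 1) =
    evalTime (Assoc.weight τ (j + l + 1)) (padOne g) (j + (1 + l)) by congr 1; omega,
    evalTime_add, evalTime_add, evalTime_add _ _ j]
  have h1 : evalTime (fun i => Assoc.weight τ (j + l + 1) (j + i)) (fun i => padOne g (j + i)) 1 =
      0 := by
    simp only [evalTime, Finset.sum_range_one, add_zero]
    rw [padOne_of_lt g hj, hg, MooreLoop.one_len, mul_zero]
  rw [h1, zero_add]
  congr 1
  · exact evalTime_congr (fun i hi => (Assoc.weight_degen_lt (by omega) hi).symm)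
      fun i hi => (padOne_succAbove_lt g ⟨j, hj⟩ hi).symm
  · refine evalTime_congr (fun i hi => ?_) fun i hi => ?_
    · rw [Assoc.weight_degen_ge (j := j) (by omega) (by omega)]
      congr 1
      omega
    · have := padOne_succAbove_ge g ⟨j, hj⟩ (i := j + i) (Nat.le_add_right j i) (by omega)
      rw [this, show j + (1 + i) = j + i + 1 by omega]

/-- The natural map `e_m : P^m ΩX → X`: the maps `cellEval` are compatible with all the
identifications in `P^m ΩX`. On `P^1 ΩX`, the reduced suspension of `ΩX`, it is the evaluation. -/
def natMap (x₀ : X) (m : ℕ) : C(LoopProjSpace x₀ m, X) where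
  toFun := Quot.lift (fun c => cellEval x₀ c.1 c.2) (by
    rintro _ _ (⟨hn, hp, h, hs, ρ, σ, g⟩ | ⟨k, hk, hn, hp, h, hs, ρ, σ, g⟩ |
      ⟨hn, hp, h, hs, ρ, σ, g⟩ | ⟨hn, hn', j, τ, g, hg⟩)
    · exact cellEval_first h hs ρ σ g
    · exact cellEval_middle k hk h hs ρ σ g
    · exact cellEval_last h hs ρ σ g
    · exact cellEval_degen j τ g hg)
  continuous_toFun := continuous_quot_lift _
    (continuous_sigma fun n => continuous_cellEval (n : ℕ))

/-- The natural map is pointed. -/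
lemma natMap_base (x₀ : X) (m : ℕ) :
    natMap x₀ m (ProjSpace.base (loopForm x₀) m) = x₀ := rfl

end Natural

/-! ## Lusternik–Schnirelmann category and standing conditions -/

section Category

universe u

variable {X : Type u} [TopologicalSpace X]

/-- A subset is categorical if its inclusion is homotopic to the constant map at the base point. -/
def IsCategorical (x₀ : X) (U : Set X) : Prop :=
  ContinuousMap.Homotopic (⟨Subtype.val, continuous_subtype_val⟩ : C(U, X))
    (ContinuousMap.const U x₀)

/-- The (normalized) Lusternik–Schnirelmann category: the smallest `n` such that the space is
covered by `n + 1` categorical open subsets, and `∞` if there is none. -/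
def lsCat (x₀ : X) : ℕ∞ :=
  sInf {c | ∃ n : ℕ, c = n ∧ ∃ U : Fin (n + 1) → Set X,
    (∀ i, IsOpen (U i) ∧ IsCategorical x₀ (U i)) ∧ ⋃ i, U i = Set.univ}

/-- A space is well-pointed if its base point is nondegenerate: it is closed, and its inclusion has
the homotopy extension property. -/
def WellPointed (x₀ : X) : Prop :=
  IsClosed {x₀} ∧ ∀ (Z : Type u) [TopologicalSpace Z] (f : C(X, Z)) (γ : C(unitInterval, Z)),
    γ 0 = f x₀ → ∃ H : C(unitInterval × X, Z), (∀ x, H (0, x) = f x) ∧ ∀ t, H (t, x₀) = γ t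

/-- The space has the homotopy type of a CW complex. -/
def HasCWHomotopyType (X : Type u) [TopologicalSpace X] : Prop :=
  ∃ (Y : Type u) (_ : TopologicalSpace Y) (_ : T2Space Y),
    Nonempty (Topology.CWComplex (Set.univ : Set Y)) ∧ Nonempty (ContinuousMap.HomotopyEquiv X Y)

end Category

end

/-! A point of `P^m ΩX` is a string of at most `m` loops together with a point `τ` of an
associahedron, and `τ` gives the loops nonincreasing weights in `[0, 1]`. The natural map follows
the concatenated loop for the weighted sum of the lengths. The faces act on weights as follows:
loops dropped at the front have weight `1`, loops dropped at the end have weight `0`, and merged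
loops share one weight.

A homotopy section bounds the category. A function on `[0, 1]` that fixes `0` and `1` may be applied
to all weights without breaking an identification (`reparamEval_projRel`). Hence `natMap` can be
deformed until every weight is `0` or `1` except those within `ε` of a chosen level `q`. If those
weights belong only to loops that stay near the base point (`gapSet`), the final value is near the
base point (`path_evalTime_lt`), and well-pointedness contracts it
(`WellPointed.exists_deformation`). A point has at most `m` weights, so it avoids one of `m + 1`
separated levels (`exists_mem_gapSet`). The gap sets therefore cover `P^m ΩX`, and their preimages
under the section are categorical.

A bound on the category gives a section. Since CW complexes are normal, a categorical covering can
be made numerable. Cutting off its contractions yields excursions, that is, paths issuing from each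
point `x`, the `i`-th of which ends at `x₀` where the `i`-th function is large. One curve performs
the excursions in turn and is at the end of the `i`-th one at time `2 i`. Cutting it at these
vertices gives loops, and the functions give a point of `K(m + 2)` (`Assoc.vertexPoint`). A vertex
whose parameter vanishes puts this point on a face that merges or drops the adjacent loops, or its
loops are dropped at the front. So such a vertex may be moved to another visit of `x₀` without
changing the class (`curveClass_eq`), and the class is continuous in `x` even where the curve no
longer reaches `x₀` at that vertex. The natural map evaluates the curve at a time that is continuous
in `x` (`markedTime_eq`), and scaling all excursions to zero deforms the composite to the identity.

This section is only free. `exists_path` joins its value over `x₀` to the base point, together with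
the homotopy, inside the space of pairs of a point and a path from its image. The homotopy extension
property of `x₀` spreads this path over `X` (`ExcursionData.exists_section`). -/

noncomputable section

/-! ## CW complexes are normal -/

section CWNormal

open Topology Metric Set

universe u

variable {Y : Type u} [TopologicalSpace Y] [T2Space Y]

/-- On a compact closed set a function that is continuous on a closed subset extends. -/
lemma exists_continuousOn_extension {K S : Set Y} (hK : IsCompact K) (hS : IsClosed S)
    {f : Y → ℝ} (hf : ContinuousOn f (S ∩ K)) :
    ∃ φ : Y → ℝ, ContinuousOn φ K ∧ ∀ y ∈ S ∩ K, φ y = f y := by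
  classical
  have : CompactSpace K := isCompact_iff_compactSpace.1 hK
  have hcl : IsClosed ((↑) ⁻¹' S : Set K) := hS.preimage continuous_subtype_val
  have hfr : Continuous fun y : ((↑) ⁻¹' S : Set K) => f y := by
    refine hf.comp_continuous (continuous_subtype_val.comp continuous_subtype_val) ?_
    exact fun y => ⟨y.2, y.1.2⟩
  -- Tietze's theorem applies because a compact subset of a Hausdorff space is normal.
  obtain ⟨g, hg⟩ := ContinuousMap.exists_restrict_eq hcl ⟨_, hfr⟩
  refine ⟨fun y => if h : y ∈ K then g ⟨y, h⟩ else 0, ?_, ?_⟩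
  · rw [continuousOn_iff_continuous_domRestrict]
    convert g.continuous using 1
    ext y
    simp
  · rintro y ⟨h1, h2⟩
    have := DFunLike.congr_fun hg ⟨⟨y, h2⟩, h1⟩
    simpa [h2] using this

variable [CWComplex (univ : Set Y)]

open CWComplex

/-- A function on the `n`-skeleton of a CW complex, prescribed on two disjoint closed sets, extends
over the cells of dimension `n`. -/
lemma exists_extension_step {A B : Set Y} (hA : IsClosed A) (hB : IsClosed B) (n : ℕ)
    {f : Y → ℝ} (fA : ∀ y ∈ A, f y = 0) (fB : ∀ y ∈ B, f y = 1)
    (hf : ∀ m < n, ∀ j : RelCWComplex.cell (univ : Set Y) m,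
      ContinuousOn f (RelCWComplex.closedCell m j)) :
    ∃ f' : Y → ℝ, (∀ y ∈ A, f' y = 0) ∧ (∀ y ∈ B, f' y = 1) ∧
      (∀ m < n + 1, ∀ j : RelCWComplex.cell (univ : Set Y) m,
        ContinuousOn f' (RelCWComplex.closedCell m j)) ∧
      ∀ m < n, ∀ j : RelCWComplex.cell (univ : Set Y) m,
        EqOn f' f (RelCWComplex.closedCell m j) := by
  classical
  set S : Set Y := (RelCWComplex.skeletonLT (univ : Set Y) n : Set Y) ∪ A ∪ B with hS
  have hScl : IsClosed S :=
    ((RelCWComplex.Subcomplex.closed _).union hA).union hB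
  have hcont : ∀ j : RelCWComplex.cell (univ : Set Y) n,
      ContinuousOn f (S ∩ RelCWComplex.closedCell n j) := by
    intro j
    -- Closure finiteness: the boundary of the cell lies in finitely many closed cells of lower
    -- dimension, so continuity on each of them gives continuity on their union.
    obtain ⟨I, hI⟩ := CWComplex.cellFrontier_subset_finite_closedCell n j
    have h1 : ContinuousOn f (⋃ (m < n) (i ∈ I m), RelCWComplex.closedCell m i) := by
      have e : (⋃ (m < n) (i ∈ I m), RelCWComplex.closedCell m i) =
          ⋃ p : (Σ m : Fin n, I m), RelCWComplex.closedCell (C := (univ : Set Y)) (p.1 : ℕ)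
            (p.2 : RelCWComplex.cell (univ : Set Y) p.1) := by
        ext y
        simp only [mem_iUnion]
        constructor
        · rintro ⟨m, hm, i, hi, hy⟩
          exact ⟨⟨⟨m, hm⟩, ⟨i, hi⟩⟩, hy⟩
        · rintro ⟨⟨m, i⟩, hy⟩
          exact ⟨m, m.2, i, i.2, hy⟩
      rw [e]
      exact LocallyFinite.continuousOn_iUnion (locallyFinite_of_finite _)
        (fun _ => RelCWComplex.isClosed_closedCell) fun p => hf _ p.1.2 _
    have h2 : ContinuousOn f A := continuousOn_const.congr fA
    have h3 : ContinuousOn f B := continuousOn_const.congr fB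
    have hU : IsClosed (⋃ (m < n) (i ∈ I m), RelCWComplex.closedCell (C := (univ : Set Y)) m i) :=
      (finite_lt_nat n).isClosed_biUnion fun m _ =>
        (I m).finite_toSet.isClosed_biUnion fun i _ => RelCWComplex.isClosed_closedCell
    have h4 := (h1.union_of_isClosed h2 hU hA).union_of_isClosed h3 (hU.union hA) hB
    refine h4.mono ?_
    rintro y ⟨(hy | hy) | hy, hy'⟩
    · refine Or.inl (Or.inl (hI ?_))
      have : y ∈ (RelCWComplex.skeletonLT (univ : Set Y) n : Set Y) ∩
        RelCWComplex.closedCell n j := ⟨hy, hy'⟩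
      rw [RelCWComplex.skeletonLT_inter_closedCell_eq_skeletonLT_inter_cellFrontier le_rfl]
        at this
      exact this.2
    · exact Or.inl (Or.inr hy)
    · exact Or.inr hy
  choose φ hφ hφf using fun j =>
    exists_continuousOn_extension RelCWComplex.isCompact_closedCell hScl (hcont j)
  -- Off `S` a point of a closed `n`-cell lies in the open cell. Open cells are disjoint, so the
  -- chosen cell is the only one and the extensions `φ j` do not conflict.
  let f' : Y → ℝ := fun y => if y ∈ S then f y else
    if h : ∃ j : RelCWComplex.cell (univ : Set Y) n, y ∈ RelCWComplex.closedCell n j then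
      φ h.choose y else 0
  have hlow : ∀ y ∈ S, f' y = f y := fun y hy => if_pos hy
  have hcell : ∀ j : RelCWComplex.cell (univ : Set Y) n,
      EqOn f' (φ j) (RelCWComplex.closedCell n j) := by
    intro j y hy
    by_cases hyS : y ∈ S
    · rw [hlow y hyS, hφf j y ⟨hyS, hy⟩]
    · have h : ∃ j : RelCWComplex.cell (univ : Set Y) n, y ∈ RelCWComplex.closedCell n j := ⟨j, hy⟩
      have hopen : ∀ j : RelCWComplex.cell (univ : Set Y) n, y ∈ RelCWComplex.closedCell n j →
          y ∈ RelCWComplex.openCell n j := by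
        intro j hj
        rw [← RelCWComplex.cellFrontier_union_openCell_eq_closedCell] at hj
        rcases hj with hj | hj
        · exact absurd (Or.inl (Or.inl (RelCWComplex.cellFrontier_subset_skeletonLT n j hj))) hyS
        · exact hj
      have e : h.choose = j := by
        by_contra hne
        have := RelCWComplex.disjoint_openCell_of_ne (C := (univ : Set Y))
          (i := h.choose) (j := j) (n := n) (m := n) (by simpa using hne)
        exact this.le_bot ⟨hopen _ h.choose_spec, hopen _ hy⟩
      simp only [f', if_neg hyS, dif_pos h, e]
  have hlt : ∀ m < n, ∀ j : RelCWComplex.cell (univ : Set Y) m,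
      EqOn f' f (RelCWComplex.closedCell m j) := by
    intro m hm j y hy
    refine hlow y (Or.inl (Or.inl ?_))
    refine RelCWComplex.skeletonLT_mono (C := (univ : Set Y)) (m := (m + 1 : ℕ)) (n := n) ?_ ?_
    · exact_mod_cast hm
    · exact RelCWComplex.closedCell_subset_skeletonLT m j hy
  refine ⟨f', fun y hy => ?_, fun y hy => ?_, fun m hm j => ?_, hlt⟩
  · rw [hlow y (Or.inl (Or.inr hy)), fA y hy]
  · rw [hlow y (Or.inr hy), fB y hy]
  · rcases Nat.lt_succ_iff_lt_or_eq.1 hm with h | rfl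
    · exact (hf m h j).congr (hlt m h j)
    · exact (hφ j).congr (hcell j)

/-- CW complexes are normal. -/
theorem normalSpace_of_cwComplex : NormalSpace Y := by
  classical
  refine ⟨fun A B hA hB hAB => ?_⟩
  let P : ℕ → (Y → ℝ) → Prop := fun n f => (∀ y ∈ A, f y = 0) ∧ (∀ y ∈ B, f y = 1) ∧
    ∀ m < n, ∀ j : RelCWComplex.cell (univ : Set Y) m,
      ContinuousOn f (RelCWComplex.closedCell m j)
  have step : ∀ (n : ℕ) (f : {f // P n f}), ∃ f' : {f // P (n + 1) f}, ∀ m < n,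
      ∀ j : RelCWComplex.cell (univ : Set Y) m,
        EqOn f'.1 f.1 (RelCWComplex.closedCell m j) := by
    rintro n ⟨f, h1, h2, h3⟩
    obtain ⟨f', h1', h2', h3', h4'⟩ := exists_extension_step hA hB n h1 h2 h3
    exact ⟨⟨f', h1', h2', h3'⟩, h4'⟩
  choose next hnext using step
  -- The recursion may start with a discontinuous function, since `P 0` asks for continuity on no
  -- cell. Only the values on `A` and `B` matter.
  let F : ∀ n, {f // P n f} := fun n => Nat.rec
    ⟨B.indicator 1, fun y hy => indicator_of_notMem (fun h => hAB.le_bot ⟨hy, h⟩) _,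
      fun y hy => indicator_of_mem hy _, fun m hm => absurd hm (Nat.not_lt_zero m)⟩ next n
  have hF : ∀ m (j : RelCWComplex.cell (univ : Set Y) m), ∀ n, m + 1 ≤ n →
      EqOn (F n).1 (F (m + 1)).1 (RelCWComplex.closedCell m j) := by
    intro m j n hn
    induction n, hn using Nat.le_induction with
    | base => exact fun _ _ => rfl
    | succ n hn ih => exact (hnext n (F n) m hn j).trans ih
  have hex : ∀ y : Y, ∃ (m : ℕ) (j : RelCWComplex.cell (univ : Set Y) m),
      y ∈ RelCWComplex.closedCell m j := by
    intro y
    have : y ∈ ⋃ (n : ℕ) (j : RelCWComplex.cell (univ : Set Y) n), RelCWComplex.closedCell n j := by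
      rw [CWComplex.union]
      trivial
    simpa only [mem_iUnion] using this
  choose dim cl hcl using hex
  let f : Y → ℝ := fun y => (F (dim y + 1)).1 y
  have hfF : ∀ m (j : RelCWComplex.cell (univ : Set Y) m),
      EqOn f (F (m + 1)).1 (RelCWComplex.closedCell m j) := by
    intro m j y hy
    have e1 := hF m j (max m (dim y) + 1) (by omega) hy
    have e2 := hF (dim y) (cl y) (max m (dim y) + 1) (by omega) (hcl y)
    exact e2.symm.trans e1
  have hf : Continuous f := by
    rw [continuous_iff_isClosed]
    intro Z hZ
    -- The weak topology reduces continuity to closed cells, on each of which the sequence `F` is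
    -- eventually constant.
    rw [CWComplex.closed (univ : Set Y) _ (subset_univ _)]
    intro n j
    have h := ((F (n + 1)).2.2.2 n (Nat.lt_succ_self n) j).congr (hfF n j)
    rw [inter_comm]
    exact h.preimage_isClosed_of_isClosed RelCWComplex.isClosed_closedCell hZ
  refine ⟨f ⁻¹' Iio (1 / 2), f ⁻¹' Ioi (1 / 2), isOpen_Iio.preimage hf, isOpen_Ioi.preimage hf,
    fun y hy => ?_, fun y hy => ?_, ?_⟩
  · have : f y = 0 := (F (dim y + 1)).2.1 y hy
    simp only [mem_preimage, this, mem_Iio]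
    norm_num
  · have : f y = 1 := (F (dim y + 1)).2.2.1 y hy
    simp only [mem_preimage, this, mem_Ioi]
    norm_num
  · exact Set.disjoint_left.2 fun y (h1 : f y < 1 / 2) (h2 : 1 / 2 < f y) => lt_asymm h1 h2

end CWNormal

/-! ## Nondegenerate base points -/

section WellPointed

universe u

variable {X : Type u} [TopologicalSpace X] {x₀ : X}

open unitInterval

/-- The subspace `X × {0} ∪ {x₀} × I` of `X × I`. -/
abbrev cylinderSet (x₀ : X) : Set (X × I) := {p | p.2 = 0 ∨ p.1 = x₀}

/-- The inclusion of a nondegenerate base point is a neighbourhood deformation retract: near the base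
point, where `u < 1`, the space can be deformed to the base point. -/
lemma WellPointed.exists_deformation (h : WellPointed x₀) :
    ∃ (u : C(X, ℝ)) (H : C(I × X, X)), u x₀ = 0 ∧ (∀ x, H (0, x) = x) ∧ (∀ t, H (t, x₀) = x₀) ∧
      ∀ x, u x < 1 → H (1, x) = x₀ := by
  let f : C(X, cylinderSet x₀) := ⟨fun x => ⟨(x, 0), Or.inl rfl⟩, by fun_prop⟩
  let γ : C(I, cylinderSet x₀) := ⟨fun t => ⟨(x₀, t), Or.inr rfl⟩, by fun_prop⟩
  -- Homotopy extension for the two inclusions into `X × {0} ∪ {x₀} × I` gives a retraction of the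
  -- cylinder. Its first coordinate is the deformation. At time `1`, a nonzero second coordinate
  -- forces the first one to be `x₀`.
  obtain ⟨r, h0, h1⟩ := h.2 _ f γ rfl
  have hr : Continuous fun p => (r p).val := continuous_subtype_val.comp r.continuous
  refine ⟨⟨fun x => 1 - ((r (1, x)).val.2 : ℝ), by fun_prop⟩, ⟨fun p => (r p).val.1, by fun_prop⟩,
    ?_, fun x => ?_, fun t => ?_, fun x hx => ?_⟩
  · simp [h1, γ]
  · simp [h0, f]
  · simp [h1, γ]
  · rcases (r (1, x)).2 with h | h
    · simp [h] at hx
    · exact h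

end WellPointed

/-! ## A categorical open covering of `P^m ΩX` -/

section Covering

variable {X : Type*} [TopologicalSpace X] {x₀ : X}

/-- The point that the concatenation `g_2 ⋯ g_{n+1}` reaches at the time `∑ φ (w_i) ℓ_i`. -/
def reparamEval (φ : ℝ → ℝ) (n : ℕ) (x : Assoc (n + 2) × (Fin n → MooreLoop x₀)) : X :=
  (segProd (padOne x.2) 0 n).path (evalTime (fun i => φ (Assoc.weight x.1 n i)) (padOne x.2) n)

/-- The dropped loops have weight `1`. As `φ 1 = 1`, they are run through completely and the path
goes on with the remaining ones. -/
lemma reparamEval_first {φ : ℝ → ℝ} (h1 : φ 1 = 1) {n p s : ℕ} (h : p + s = n + 1) (hs : 2 ≤ s)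
    (ρ : Assoc (p + 2)) (σ : Assoc s) (g : Fin n → MooreLoop x₀) :
    reparamEval φ n (Assoc.face 0 (by omega) hs (by omega) ρ σ, g) =
      reparamEval φ p (ρ, fun i : Fin p => g ⟨s - 1 + i, by omega⟩) := by
  unfold reparamEval
  obtain ⟨a, rfl⟩ : ∃ a, s = a + 1 := ⟨s - 1, by omega⟩
  obtain rfl : n = a + p := by omega
  have h1 : evalTime (fun i => φ (Assoc.weight (Assoc.faceSeq 0 (a + 1) ρ σ) (a + p) i))
      (padOne g) a = (segProd (padOne g) 0 a).len := by
    have := evalTime_const (c := 1) (f := padOne g) (a := 0) (n := a)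
      (w := fun i => φ (Assoc.weight (Assoc.faceSeq 0 (a + 1) ρ σ) (a + p) i))
      (fun i hi => by
        simp only [Assoc.weight_first_lt h hs ρ.2 σ.2 (show i + 1 < a + 1 by omega), h1])
    simpa using this
  simp only [Assoc.face, Nat.add_sub_cancel]
  rw [segProd_add, evalTime_add, h1, MooreLoop.mul_path_add]
  have hpad : ∀ i < p, padOne g (a + i) = padOne (fun i : Fin p => g ⟨a + i, by omega⟩) i := by
    intro i hi
    rw [padOne_of_lt _ hi, padOne_of_lt _ (by omega)]
  have h2 : segProd (padOne g) (0 + a) p =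
      segProd (padOne fun i : Fin p => g ⟨a + i, by omega⟩) 0 p :=
    segProd_congr fun i hi => by rw [zero_add, zero_add]; exact hpad i hi
  rw [h2]
  congr 1
  exact evalTime_congr (fun i hi => congrArg φ (Assoc.weight_first_ge h hs ρ.2 σ.2 hi)) hpad

/-- The merged loops carry a common weight, so their times add up to `φ` of that weight times the
length of the product. -/
lemma reparamEval_middle {φ : ℝ → ℝ} {n p s : ℕ} (k : ℕ) (hk : k < p) (h : p + s = n + 1)
    (hs : 2 ≤ s) (ρ : Assoc (p + 2)) (σ : Assoc s) (g : Fin n → MooreLoop x₀) :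
    reparamEval φ n (Assoc.face (k + 1) (by omega) hs (by omega) ρ σ, g) =
      reparamEval φ p (ρ, mergeSeq k h hs g
        (List.ofFn fun i : Fin s => g ⟨k + i, by omega⟩).prod) := by
  unfold reparamEval
  rw [← prod_ofFn_eq, ← prod_ofFn_eq, prod_mergeSeq h hs hk g]
  congr 1
  simp only [Assoc.face]
  obtain ⟨l, rfl⟩ : ∃ l, p = k + 1 + l := ⟨p - k - 1, by omega⟩
  obtain rfl : n = k + s + l := by omega
  rw [evalTime_add, evalTime_add _ _ (k + 1), evalTime_add, evalTime_add]
  congr 1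
  · congr 1
    · exact evalTime_congr (fun i hi => congrArg φ (Assoc.weight_before h hs hk.le ρ.2 σ.2 hi))
        fun i hi => (padOne_mergeSeq_lt h hs g _ hk hi).symm
    · rw [evalTime_const (c := φ (Assoc.weight ρ (k + 1 + l) k)) fun i hi =>
        congrArg φ (Assoc.weight_mid h hs hk ρ.2 σ.2 (by omega) (by omega))]
      simp only [evalTime, Finset.sum_range_one, add_zero]
      rw [padOne_mergeSeq_self h hs g _ hk, prod_ofFn_eq_shift g (by omega)]
  · exact evalTime_congr (fun i hi => congrArg φ (Assoc.weight_after h hs hk ρ.2 σ.2 (by omega)))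
      fun i hi => (padOne_mergeSeq_gt h hs g _ (by omega)).symm

/-- The dropped loops have weight `0`, and `φ 0 = 0` gives them no time. The bound `φ ≤ 1` keeps the
total time within the remaining product. -/
lemma reparamEval_last {φ : ℝ → ℝ} (h0 : φ 0 = 0) (hφ : ∀ w, φ w ≤ 1) {n p s : ℕ}
    (h : p + s = n + 1) (hs : 2 ≤ s) (ρ : Assoc (p + 2))
    (σ : Assoc s) (g : Fin n → MooreLoop x₀) :
    reparamEval φ n (Assoc.face (p + 1) (by omega) hs (by omega) ρ σ, g) =
      reparamEval φ p (ρ, fun i : Fin p => g ⟨i, by omega⟩) := by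
  unfold reparamEval
  obtain ⟨a, rfl⟩ : ∃ a, s = a + 1 := ⟨s - 1, by omega⟩
  obtain rfl : n = p + a := by omega
  have hpad : ∀ i < p, padOne g i = padOne (fun i : Fin p => g ⟨i, by omega⟩) i := by
    intro i hi
    rw [padOne_of_lt _ hi, padOne_of_lt _ (by omega)]
  simp only [Assoc.face]
  have h1 : evalTime
      (fun i => φ (Assoc.weight (Assoc.faceSeq (p + 1) (a + 1) ρ σ) (p + a) (p + i)))
      (fun i => padOne g (p + i)) a = 0 := by
    rw [evalTime_const (c := 0)
      fun i hi => by rw [Assoc.weight_last h hs ρ.2 σ.2 (by omega) (by omega), h0]]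
    simp
  have h2 : evalTime (fun i => φ (Assoc.weight (Assoc.faceSeq (p + 1) (a + 1) ρ σ) (p + a) i))
      (padOne g) p = evalTime (fun i => φ (Assoc.weight ρ p i))
        (padOne fun i : Fin p => g ⟨i, by omega⟩) p :=
    evalTime_congr (fun i hi => congrArg φ (Assoc.weight_before h hs le_rfl ρ.2 σ.2 hi)) hpad
  have h3 : segProd (padOne g) 0 p =
      segProd (padOne fun i : Fin p => g ⟨i, by omega⟩) 0 p :=
    segProd_congr fun i hi => by rw [zero_add]; exact hpad i hi
  rw [segProd_add, evalTime_add, h1, add_zero, h2, h3, MooreLoop.mul_path_of_le]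
  rw [segProd_len]
  refine Finset.sum_le_sum fun i hi => ?_
  rw [zero_add]
  exact mul_le_of_le_one_left zero_le (Real.toNNReal_le_one.2 (hφ _))

/-- The deleted unit has length `0`, and the degeneracy preserves the weights of the other loops. -/
lemma reparamEval_degen {φ : ℝ → ℝ} {n : ℕ} (j : Fin (n + 1)) (τ : Assoc (n + 1 + 2))
    (g : Fin (n + 1) → MooreLoop x₀) (hg : g j = 1) :
    reparamEval φ (n + 1) (τ, g) =
      reparamEval φ n (Assoc.degen (n := n + 1) (j + 1) (by omega) τ,
        fun i => g (j.succAbove i)) := by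
  unfold reparamEval
  rw [← prod_ofFn_eq, ← prod_ofFn_eq, prod_succAbove g j hg]
  congr 1
  simp only [Assoc.degen]
  obtain ⟨j, hj⟩ := j
  obtain ⟨l, rfl⟩ : ∃ l, n = j + l := ⟨n - j, by omega⟩
  rw [show evalTime (fun i => φ (Assoc.weight τ (j + l + 1) i)) (padOne g) (j + l + 1) =
    evalTime (fun i => φ (Assoc.weight τ (j + l + 1) i)) (padOne g) (j + (1 + l)) by
      congr 1; omega,
    evalTime_add, evalTime_add, evalTime_add _ _ j]
  have h1 : evalTime (fun i => φ (Assoc.weight τ (j + l + 1) (j + i)))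
      (fun i => padOne g (j + i)) 1 = 0 := by
    simp only [evalTime, Finset.sum_range_one, add_zero]
    rw [padOne_of_lt g hj, hg, MooreLoop.one_len, mul_zero]
  rw [h1, zero_add]
  congr 1
  · exact evalTime_congr (fun i hi => congrArg φ (Assoc.weight_degen_lt (by omega) hi).symm)
      fun i hi => (padOne_succAbove_lt g ⟨j, hj⟩ hi).symm
  · refine evalTime_congr (fun i hi => ?_) fun i hi => ?_
    · rw [Assoc.weight_degen_ge (j := j) (by omega) (by omega)]
      congr 2
      omega
    · have := padOne_succAbove_ge g ⟨j, hj⟩ (i := j + i) (Nat.le_add_right j i) (by omega)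
      rw [this, show j + (1 + i) = j + i + 1 by omega]

lemma reparamEval_projRel {φ : ℝ → ℝ} (h0 : φ 0 = 0) (h1 : φ 1 = 1) (hφ : ∀ w, φ w ≤ 1) {m : ℕ}
    {a b : ProjCells (MooreLoop x₀) m} (hab : ProjRel (loopForm x₀) m a b) :
    reparamEval φ a.1 a.2 = reparamEval φ b.1 b.2 := by
  rcases hab with ⟨hn, hp, h, hs, ρ, σ, g⟩ | ⟨k, hk, hn, hp, h, hs, ρ, σ, g⟩ |
    ⟨hn, hp, h, hs, ρ, σ, g⟩ | ⟨hn, hn', j, τ, g, hg⟩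
  · exact reparamEval_first h1 h hs ρ σ g
  · exact reparamEval_middle k hk h hs ρ σ g
  · exact reparamEval_last h0 hφ h hs ρ σ g
  · exact reparamEval_degen j τ g hg

/-- The ramp that grows from `0` to `1` on `[q - ε, q + ε]`. -/
def ramp (q ε w : ℝ) : ℝ := max 0 (min 1 ((w - (q - ε)) / (2 * ε)))

/-- The linear homotopy from the identity of `[0, 1]` to the ramp. -/
def rampHomotopy (q ε t w : ℝ) : ℝ := (1 - t) * max 0 (min 1 w) + t * ramp q ε w

lemma ramp_nonneg (q ε w : ℝ) : 0 ≤ ramp q ε w := le_max_left _ _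

lemma ramp_le_one (q ε w : ℝ) : ramp q ε w ≤ 1 := max_le zero_le_one (min_le_left _ _)

lemma ramp_mono {q ε : ℝ} (hε : 0 < ε) : Monotone (ramp q ε) := by
  intro a b h
  unfold ramp
  gcongr

lemma ramp_of_ge {q ε w : ℝ} (hε : 0 < ε) (h : q + ε ≤ w) : ramp q ε w = 1 := by
  have : 1 ≤ (w - (q - ε)) / (2 * ε) := by
    rw [le_div_iff₀ (by linarith)]
    linarith
  rw [ramp, min_eq_left this, max_eq_right zero_le_one]

lemma ramp_of_le {q ε w : ℝ} (hε : 0 < ε) (h : w ≤ q - ε) : ramp q ε w = 0 := by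
  have : (w - (q - ε)) / (2 * ε) ≤ 0 := div_nonpos_of_nonpos_of_nonneg (by linarith) (by linarith)
  rw [ramp, max_eq_left ((min_le_right _ _).trans this)]

/-- The homotopy of the natural map `P^m ΩX → X` that is given by `rampHomotopy`. -/
def projHomotopy (x₀ : X) (m : ℕ) {q ε : ℝ} (hε : 0 < ε) (h0 : ε ≤ q) (h1 : q + ε ≤ 1) :
    C(LoopProjSpace x₀ m, C(unitInterval, X)) where
  toFun := Quot.lift (fun c => ⟨fun t => reparamEval (rampHomotopy q ε t) c.1 c.2, by
      unfold reparamEval evalTime rampHomotopy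
      refine (ContinuousMap.continuous _).comp (continuous_finsetSum _ fun i _ => ?_)
      refine Continuous.mul (continuous_real_toNNReal.comp ?_) continuous_const
      fun_prop⟩) (by
    intro a b hab
    ext t
    refine reparamEval_projRel ?_ ?_ (fun w => ?_) hab
    · simp [rampHomotopy, ramp_of_le hε (show (0 : ℝ) ≤ q - ε by linarith)]
    · simp [rampHomotopy, ramp_of_ge hε h1]
    · have e1 := t.2.1
      have e2 := t.2.2
      have e3 := ramp_le_one q ε w
      have e4 : max 0 (min 1 w) ≤ 1 := max_le zero_le_one (min_le_left _ _)
      unfold rampHomotopy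
      nlinarith)
  continuous_toFun := by
    -- With values in the path space, continuity can be checked on the cells; the product of the
    -- quotient map with the interval never occurs.
    refine continuous_quot_lift _ (continuous_sigma fun n => ?_)
    refine ContinuousMap.continuous_of_continuous_uncurry _ ?_
    simp only [Function.uncurry_def, ContinuousMap.coe_mk, reparamEval]
    refine MooreLoop.continuous_path_eval ?_ ?_
    · simp only [← prod_ofFn_eq, List.ofFn_eq_map]
      exact continuous_list_prod _ fun i _ =>
        (continuous_apply i).comp (continuous_snd.comp continuous_fst)
    · unfold evalTime
      refine continuous_finsetSum _ fun i hi => ?_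
      rw [Finset.mem_range] at hi
      simp only [padOne_of_lt _ hi]
      refine Continuous.mul (continuous_real_toNNReal.comp ?_) (MooreLoop.continuous_len.comp
        ((continuous_apply _).comp (continuous_snd.comp continuous_fst)))
      have hw : Continuous fun x : (Assoc ((n : ℕ) + 2) × (Fin n → MooreLoop x₀)) × unitInterval =>
          Assoc.weight x.1.1 n i :=
        (Assoc.continuous_weight n i).comp
          (continuous_subtype_val.comp (continuous_fst.comp continuous_fst))
      unfold rampHomotopy ramp
      fun_prop

lemma projHomotopy_zero {m : ℕ} {q ε : ℝ} (hε : 0 < ε) (h0 : ε ≤ q) (h1 : q + ε ≤ 1)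
    (x : LoopProjSpace x₀ m) : projHomotopy x₀ m hε h0 h1 x 0 = natMap x₀ m x := by
  obtain ⟨⟨n, τ, g⟩, rfl⟩ := Quot.exists_rep x
  change reparamEval (rampHomotopy q ε (0 : unitInterval)) n (τ, g) = cellEval x₀ n (τ, g)
  rw [cellEval_eq, reparamEval]
  congr 1
  refine evalTime_congr (fun i hi => ?_) fun _ _ => rfl
  have e1 : Assoc.weight τ n i ≤ 1 := Assoc.weight_le_one (by omega)
  have e2 : 0 ≤ Assoc.weight τ n i := Assoc.weight_nonneg τ.2.1 hi
  -- Weights lie in `[0, 1]`, so the truncation built into `rampHomotopy` does not affect them.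
  simp [rampHomotopy, e1, e2]

/-! ### Small loops and gap sets. -/

variable (u : C(X, ℝ))

/-- A loop is small if it stays in the neighbourhood `u < 1` of the base point. -/
def SmallLoop (g : MooreLoop x₀) : Prop := ∀ t, u (g.path t) < 1

variable {u}

lemma smallLoop_one (hu : u x₀ = 0) : SmallLoop u (1 : MooreLoop x₀) := fun t => by
  rw [MooreLoop.one_path, hu]
  exact zero_lt_one

/-- The product passes through all points of both factors, apart from times past the length, when a
factor rests at `x₀`. The equivalence, not just one implication, makes the gap condition invariant
under merging. -/
lemma smallLoop_mul (hu : u x₀ = 0) {g g' : MooreLoop x₀} :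
    SmallLoop u (g * g') ↔ SmallLoop u g ∧ SmallLoop u g' := by
  constructor
  · intro h
    refine ⟨fun t => ?_, fun t => ?_⟩
    · rcases le_total t g.len with ht | ht
      · rw [← MooreLoop.mul_path_of_le g g' ht]
        exact h t
      · rw [g.path_of_le ht, hu]
        exact zero_lt_one
    · rw [← MooreLoop.mul_path_add g g' t]
      exact h _
  · rintro ⟨h, h'⟩ t
    rw [MooreLoop.mul_path]
    split_ifs
    exacts [h _, h' _]

lemma smallLoop_segProd (hu : u x₀ = 0) (f : ℕ → MooreLoop x₀) (a b : ℕ) :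
    SmallLoop u (segProd f a b) ↔ ∀ i < b, SmallLoop u (f (a + i)) := by
  induction b with
  | zero => exact ⟨fun _ i hi => absurd hi (Nat.not_lt_zero i), fun _ => smallLoop_one hu⟩
  | succ b ih =>
    rw [segProd_add, segProd_one, smallLoop_mul hu, ih]
    constructor
    · rintro ⟨h1, h2⟩ i hi
      rcases Nat.lt_succ_iff_lt_or_eq.1 hi with h | rfl
      exacts [h1 i h, h2]
    · exact fun h => ⟨fun i hi => h i (by omega), h b (by omega)⟩

/-- Smallness concerns all times in `[0, ∞)`. Scaling time by the length turns it into a condition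
on the compact unit interval, which is open for the compact-open topology. -/
lemma isOpen_smallLoop (hu : u x₀ = 0) : IsOpen {g : MooreLoop x₀ | SmallLoop u g} := by
  let F : MooreLoop x₀ → C(unitInterval, ℝ) := fun g =>
    ⟨fun t => u (g.path (Real.toNNReal t * g.len)), by fun_prop⟩
  have hF : Continuous F := by
    refine ContinuousMap.continuous_of_continuous_uncurry _ ?_
    refine u.continuous.comp (MooreLoop.continuous_path_eval continuous_fst ?_)
    exact (continuous_real_toNNReal.comp (continuous_subtype_val.comp continuous_snd)).mul
      (MooreLoop.continuous_len.comp continuous_fst)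
  have : {g : MooreLoop x₀ | SmallLoop u g} =
      F ⁻¹' {f | Set.MapsTo f Set.univ (Set.Iio 1)} := by
    ext g
    constructor
    · exact fun h t _ => h _
    · intro h t
      rcases le_total g.len t with ht | ht
      · rw [g.path_of_le ht, hu]
        exact zero_lt_one
      · rcases eq_or_ne g.len 0 with h0 | h0
        · rw [g.path_of_le (by simp [h0]), hu]
          exact zero_lt_one
        · have hle : t / g.len ≤ 1 := div_le_one_of_le₀ ht zero_le
          have := h (x := ⟨((t / g.len : ℝ≥0) : ℝ), (t / g.len).2, by exact_mod_cast hle⟩) trivial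
          simpa only [F, ContinuousMap.coe_mk, Set.mem_Iio, Real.toNNReal_coe, div_mul_cancel₀ t h0]
            using this
  rw [this]
  exact (ContinuousMap.isOpen_setOfPred_mapsTo isCompact_univ isOpen_Iio).preimage hF

/-- If the loops at which the weights are neither `0` nor `1` are small, then the point at the time
`∑ w_i ℓ_i` is near the base point. -/
lemma path_evalTime_lt (hu : u x₀ = 0) {w : ℕ → ℝ} {f : ℕ → MooreLoop x₀} {n : ℕ}
    (hw0 : ∀ i < n, 0 ≤ w i) (hw1 : ∀ i < n, w i ≤ 1) (hanti : ∀ i j, i ≤ j → j < n → w j ≤ w i)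
    (hs : ∀ i < n, w i = 0 ∨ w i = 1 ∨ SmallLoop u (f i)) :
    u ((segProd f 0 n).path (evalTime w f n)) < 1 := by
  -- The case without loops exempted by weight `0`. Loops of weight `1` are completed and stripped
  -- from the front. Once the leading weight is below `1`, so are all later ones, hence every
  -- remaining loop is small.
  have key : ∀ n a, (∀ i < n, 0 ≤ w (a + i)) → (∀ i j, i ≤ j → j < n → w (a + j) ≤ w (a + i)) →
      (∀ i < n, w (a + i) = 1 ∨ SmallLoop u (f (a + i))) → (∀ i < n, w (a + i) ≤ 1) →
      u ((segProd f a n).path (evalTime (fun i => w (a + i)) (fun i => f (a + i)) n)) < 1 := by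
    intro n
    induction n with
    | zero =>
      intro a _ _ _ _
      exact smallLoop_one hu _
    | succ n ih =>
      intro a h0 h1 h2 h3
      by_cases h : w a = 1
      · rw [add_comm n 1, segProd_add, segProd_one, evalTime_add]
        have e : evalTime (fun i => w (a + i)) (fun i => f (a + i)) 1 = (f a).len := by
          simp [evalTime, h]
        rw [e, MooreLoop.mul_path_add]
        have := ih (a + 1) (fun i hi => ?_) (fun i j hi hj => ?_) (fun i hi => ?_)
          (fun i hi => ?_)
        · simpa only [add_assoc] using this
        all_goals rw [add_assoc]
        · exact h0 (1 + i) (by omega)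
        · rw [add_assoc]
          exact h1 (1 + i) (1 + j) (by omega) (by omega)
        · exact h2 (1 + i) (by omega)
        · exact h3 (1 + i) (by omega)
      · refine (smallLoop_segProd hu f a (n + 1)).2 (fun i hi => ?_) _
        refine (h2 i hi).resolve_left fun e => h (le_antisymm (h3 0 (by omega)) ?_)
        rw [← e]
        exact h1 0 i (Nat.zero_le i) hi
  induction n with
  | zero => exact smallLoop_one hu _
  | succ n ih =>
    -- A last loop of weight `0` takes no time and is stripped from the end. If the last weight is
    -- positive, all are, and `key` applies.
    by_cases h : w n = 0
    · rw [segProd_add, evalTime_add]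
      have e : evalTime (fun i => w (n + i)) (fun i => f (n + i)) 1 = 0 := by
        simp [evalTime, h]
      rw [e, add_zero, MooreLoop.mul_path_of_le]
      · exact ih (fun i hi => hw0 i (by omega)) (fun i hi => hw1 i (by omega))
          (fun i j h1 h2 => hanti i j h1 (by omega)) fun i hi => hs i (by omega)
      · rw [segProd_len]
        refine Finset.sum_le_sum fun i hi => ?_
        rw [zero_add]
        refine mul_le_of_le_one_left zero_le (Real.toNNReal_le_one.2 (hw1 i ?_))
        have := Finset.mem_range.1 hi
        omega
    · have := key (n + 1) 0 (by simpa using hw0) (by simpa using hanti) (fun i hi => ?_)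
        (by simpa using hw1)
      · simpa using this
      · rw [zero_add]
        refine (hs i hi).resolve_left fun e => h (le_antisymm ?_ (hw0 n (by omega)))
        rw [← e]
        exact hanti i n (by omega) (by omega)

variable (u)

/-- The weights of large loops stay away from `q`. -/
def CellGap (q ε : ℝ) (n : ℕ) (x : Assoc (n + 2) × (Fin n → MooreLoop x₀)) : Prop :=
  ∀ i < n, ε < |Assoc.weight x.1 n i - q| ∨ SmallLoop u (padOne x.2 i)

variable {u}

/-- The bounds on `q` put the values `0` and `1` farther than `ε` from it, so loops dropped at
either end are unconstrained. A merged loop is small exactly when its factors are, and these share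
its weight. A unit is always small. -/
lemma cellGap_projRel (hu : u x₀ = 0) {q ε : ℝ} (h0 : ε < q) (h1 : q + ε < 1) {m : ℕ}
    {a b : ProjCells (MooreLoop x₀) m} (hab : ProjRel (loopForm x₀) m a b) :
    CellGap u q ε a.1 a.2 ↔ CellGap u q ε b.1 b.2 := by
  have w0 : ε < |(0 : ℝ) - q| := by rw [zero_sub, abs_neg]; exact lt_abs.2 (Or.inl h0)
  have w1 : ε < |(1 : ℝ) - q| := lt_abs.2 (Or.inl (by linarith))
  rcases hab with ⟨hn, hp, h, hs, ρ, σ, g⟩ | ⟨k, hk, hn, hp, h, hs, ρ, σ, g⟩ |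
    ⟨hn, hp, h, hs, ρ, σ, g⟩ | @⟨n, hn, hn', ⟨j, hj⟩, τ, g, hg⟩ <;>
    simp only [CellGap, Assoc.face, Assoc.degen]
  · rename_i n p s
    constructor
    · intro H i hi
      have := H (s - 1 + i) (by omega)
      rw [Assoc.weight_first_ge h hs ρ.2 σ.2 hi] at this
      rwa [padOne_of_lt _ (by omega)] at this ⊢
    · intro H i hi
      rcases lt_or_ge i (s - 1) with h2 | h2
      · rw [Assoc.weight_first_lt h hs ρ.2 σ.2 (by omega)]
        exact Or.inl w1
      · obtain ⟨i, rfl⟩ := exists_add_of_le h2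
        have := H i (by omega)
        rw [Assoc.weight_first_ge h hs ρ.2 σ.2 (by omega)]
        rwa [padOne_of_lt _ (by omega)] at this ⊢
  · rename_i n p s
    have hα : (loopForm x₀).α s (σ, fun i : Fin s => g ⟨k + i, by omega⟩) =
        segProd (padOne g) k s := prod_ofFn_eq_shift g (by omega)
    rw [hα]
    constructor
    · intro H i hi
      rcases lt_trichotomy i k with h2 | rfl | h2
      · have := H i (by omega)
        rw [Assoc.weight_before h hs hk.le ρ.2 σ.2 h2] at this
        rwa [padOne_mergeSeq_lt h hs g _ hk h2]
      · rw [padOne_mergeSeq_self h hs g _ hk, smallLoop_segProd hu, or_iff_not_imp_left]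
        intro h3 l hl
        have := H (i + l) (by omega)
        rw [Assoc.weight_mid h hs hk ρ.2 σ.2 (by omega) (by omega)] at this
        exact this.resolve_left h3
      · obtain ⟨l, rfl⟩ : ∃ l, i = k + 1 + l := ⟨i - (k + 1), by omega⟩
        have := H (k + s + l) (by omega)
        rw [Assoc.weight_after h hs hk ρ.2 σ.2 hi] at this
        rwa [padOne_mergeSeq_gt h hs g _ hi]
    · intro H i hi
      rcases lt_or_ge i k with h2 | h2
      · have := H i (by omega)
        rw [padOne_mergeSeq_lt h hs g _ hk h2] at this
        rwa [Assoc.weight_before h hs hk.le ρ.2 σ.2 h2]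
      rcases lt_or_ge i (k + s) with h3 | h3
      · have := H k hk
        rw [padOne_mergeSeq_self h hs g _ hk, smallLoop_segProd hu] at this
        rw [Assoc.weight_mid h hs hk ρ.2 σ.2 h2 h3]
        refine this.imp_right fun h4 => ?_
        have := h4 (i - k) (by omega)
        rwa [show k + (i - k) = i by omega] at this
      · obtain ⟨l, rfl⟩ : ∃ l, i = k + s + l := ⟨i - (k + s), by omega⟩
        have := H (k + 1 + l) (by omega)
        rw [padOne_mergeSeq_gt h hs g _ (by omega)] at this
        rwa [Assoc.weight_after h hs hk ρ.2 σ.2 (by omega)]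
  · rename_i n p s
    constructor
    · intro H i hi
      have := H i (by omega)
      rw [Assoc.weight_before h hs le_rfl ρ.2 σ.2 hi] at this
      rwa [padOne_of_lt _ (by omega)] at this ⊢
    · intro H i hi
      rcases lt_or_ge i p with h2 | h2
      · have := H i h2
        rw [Assoc.weight_before h hs le_rfl ρ.2 σ.2 h2]
        rwa [padOne_of_lt _ (by omega)] at this ⊢
      · rw [Assoc.weight_last h hs ρ.2 σ.2 h2 hi]
        exact Or.inl w0
  · constructor
    · intro H i hi
      rcases lt_or_ge i j with h2 | h2
      · have := H i (by omega)
        rw [Assoc.weight_degen_lt (by omega) h2]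
        have e := padOne_succAbove_lt g ⟨j, hj⟩ h2
        rwa [← e] at this
      · have := H (i + 1) (by omega)
        rw [Assoc.weight_degen_ge h2 hi]
        have e := padOne_succAbove_ge g ⟨j, hj⟩ h2 hi
        rwa [← e] at this
    · intro H i hi
      rcases lt_trichotomy i j with h2 | rfl | h2
      · have := H i (by omega)
        rw [Assoc.weight_degen_lt (by omega) h2] at this
        have e := padOne_succAbove_lt g ⟨j, hj⟩ h2
        rwa [e] at this
      · rw [padOne_of_lt _ hj, hg]
        exact Or.inr (smallLoop_one hu)
      · obtain ⟨i, rfl⟩ : ∃ i', i = i' + 1 := ⟨i - 1, by omega⟩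
        have := H i (by omega)
        rw [Assoc.weight_degen_ge (by omega) (by omega)] at this
        have e := padOne_succAbove_ge g ⟨j, hj⟩ (i := i) (Nat.lt_succ_iff.1 h2) (by omega)
        rwa [e] at this

/-- The open subset of `P^m ΩX` where the weights of large loops stay away from `q`. -/
def gapSet (hu : u x₀ = 0) {q ε : ℝ} (h0 : ε < q) (h1 : q + ε < 1) (m : ℕ) :
    Set (LoopProjSpace x₀ m) :=
  {x | Quot.lift (fun c : ProjCells (MooreLoop x₀) m => CellGap u q ε c.1 c.2)
    (fun _ _ hab => propext (cellGap_projRel hu h0 h1 hab)) x}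

lemma isOpen_gapSet (hu : u x₀ = 0) {q ε : ℝ} (h0 : ε < q) (h1 : q + ε < 1) (m : ℕ) :
    IsOpen (gapSet hu h0 h1 m) := by
  refine isOpen_coinduced.2 (isOpen_sigma_iff.2 fun n => ?_)
  change IsOpen {x | CellGap u q ε n x}
  simp only [CellGap, Set.ofPred_forall]
  refine (Set.finite_lt_nat n).isOpen_biInter fun i hi => ?_
  simp only [padOne_of_lt _ (show i < n from hi), Set.ofPred_or]
  refine IsOpen.union ?_ ?_
  · refine isOpen_lt continuous_const (continuous_abs.comp (Continuous.sub ?_ continuous_const))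
    exact (Assoc.continuous_weight n i).comp (continuous_subtype_val.comp continuous_fst)
  · have hc : Continuous fun x : Assoc ((n : ℕ) + 2) × (Fin n → MooreLoop x₀) => x.2 ⟨i, hi⟩ :=
      (continuous_apply _).comp continuous_snd
    exact (isOpen_smallLoop hu).preimage hc

/-- This makes the weights nonincreasing along the string of loops, which `path_evalTime_lt` needs.
-/
lemma height_mono {t : ℕ → ℝ} {n i j : ℕ} (h : i ≤ j) :
    Assoc.height t n i ≤ Assoc.height t n j :=
  Assoc.height_le.2 fun _ hl => Assoc.incr_le_height (hl.trans h)

/-- The ramp sends every weight farther than `ε` from `q` to `0` or `1`, so in the gap set only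
small loops can keep an intermediate weight. -/
lemma projHomotopy_one_lt (hu : u x₀ = 0) {m : ℕ} {q ε : ℝ} (hε : 0 < ε) (h0 : ε < q)
    (h1 : q + ε < 1) {x : LoopProjSpace x₀ m} (hx : x ∈ gapSet hu h0 h1 m) :
    u (projHomotopy x₀ m hε h0.le h1.le x 1) < 1 := by
  obtain ⟨⟨n, τ, g⟩, rfl⟩ := Quot.exists_rep x
  change CellGap u q ε n (τ, g) at hx
  change u (reparamEval (rampHomotopy q ε (1 : unitInterval)) n (τ, g)) < 1
  have e : rampHomotopy q ε (1 : unitInterval) = ramp q ε := by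
    ext w
    simp [rampHomotopy]
  rw [e]
  refine path_evalTime_lt hu (fun i _ => ramp_nonneg _ _ _) (fun i _ => ramp_le_one _ _ _)
    (fun i j hij _ => ramp_mono hε ?_) fun i hi => ?_
  · unfold Assoc.weight
    linarith [height_mono (t := τ) (n := n) hij]
  · rcases hx i hi with h | h
    · rcases lt_abs.1 h with h | h
      · exact Or.inr (Or.inl (ramp_of_ge hε (by linarith)))
      · exact Or.inl (ramp_of_le hε (by linarith))
    · exact Or.inr (Or.inr h)

/-! ### Separated levels and the pigeonhole argument. -/

/-- The `m + 1` levels that are needed to cover `P^m ΩX`. -/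
def gapLevel (m : ℕ) (k : Fin (m + 1)) : ℝ := (k + 1) / (m + 2)

/-- The radius is a third of the spacing `1 / (m + 2)` of the levels, whose extreme members have
this same distance from `0` and `1`. -/
lemma gapLevel_bounds (m : ℕ) (k : Fin (m + 1)) :
    1 / (3 * (m + 2) : ℝ) < gapLevel m k ∧ gapLevel m k + 1 / (3 * (m + 2) : ℝ) < 1 := by
  have hk : (k : ℝ) + 1 ≤ m + 1 := by exact_mod_cast k.2
  have hk0 : (0 : ℝ) ≤ k := Nat.cast_nonneg _
  have hm : (0 : ℝ) < m + 2 := by positivity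
  unfold gapLevel
  constructor
  · rw [div_lt_div_iff₀ (by positivity) hm]
    nlinarith
  · rw [show ((k : ℝ) + 1) / (m + 2) + 1 / (3 * (m + 2)) = (3 * (k + 1) + 1) / (3 * (m + 2)) by
      field_simp, div_lt_one (by positivity)]
    linarith

/-- A common `w` would put two levels within twice the radius, which is less than their spacing. -/
lemma gapLevel_injective {m : ℕ} {k l : Fin (m + 1)} {w : ℝ}
    (hk : |w - gapLevel m k| ≤ 1 / (3 * (m + 2) : ℝ))
    (hl : |w - gapLevel m l| ≤ 1 / (3 * (m + 2) : ℝ)) : k = l := by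
  have hm : (0 : ℝ) < m + 2 := by positivity
  by_contra hne
  have h1 : |gapLevel m k - gapLevel m l| ≤ 2 / (3 * (m + 2) : ℝ) := by
    have := abs_sub_le (gapLevel m k) w (gapLevel m l)
    rw [abs_sub_comm (gapLevel m k) w] at this
    calc _ ≤ _ := this
      _ ≤ 1 / (3 * (m + 2) : ℝ) + 1 / (3 * (m + 2) : ℝ) := add_le_add hk hl
      _ = _ := by ring
  have h2 : (1 : ℝ) ≤ |(k : ℝ) - l| := by
    have : (1 : ℤ) ≤ |(k : ℤ) - l| := by
      refine Int.one_le_abs (sub_ne_zero.2 fun h => hne (Fin.ext ?_))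
      exact_mod_cast h
    exact_mod_cast this
  have h3 : gapLevel m k - gapLevel m l = (k - l) / (m + 2) := by
    unfold gapLevel
    ring
  rw [h3, abs_div, abs_of_pos hm, div_le_div_iff₀ hm (by positivity)] at h1
  nlinarith

/-- Outside all gap sets every level has some weight close to it, and different levels need
different weights. But there are `m + 1` levels and at most `m` weights. -/
lemma exists_mem_gapSet (hu : u x₀ = 0) {m : ℕ} (x : LoopProjSpace x₀ m) :
    ∃ k, x ∈ gapSet hu (gapLevel_bounds m k).1 (gapLevel_bounds m k).2 m := by
  obtain ⟨⟨n, τ, g⟩, rfl⟩ := Quot.exists_rep x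
  by_contra! H
  have : ∀ k : Fin (m + 1), ∃ i : Fin n,
      |Assoc.weight τ n i - gapLevel m k| ≤ 1 / (3 * (m + 2) : ℝ) := by
    intro k
    have hk : ¬ CellGap u _ _ (n : ℕ) (τ, g) := H k
    simp only [CellGap, not_forall, not_or, not_lt] at hk
    obtain ⟨i, hi, h, -⟩ := hk
    exact ⟨⟨i, hi⟩, h⟩
  choose i hi using this
  have hinj : Function.Injective i := fun k l hkl => by
    have hl := hi l
    rw [← hkl] at hl
    exact gapLevel_injective (hi k) hl
  have := Fintype.card_le_of_injective i hinj
  simp only [Fintype.card_fin] at this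
  have := n.2
  omega

end Covering

/-! ### From a homotopy section to a categorical covering. -/

section Section

open unitInterval

universe u

variable {X : Type u} [TopologicalSpace X] {x₀ : X}

/-- If the natural map `P^m ΩX → X` has a right homotopy inverse, then `cat X ≤ m`. -/
theorem lsCat_le_of_section (hX : WellPointed x₀) {m : ℕ} (s : C(X, LoopProjSpace x₀ m))
    (hs : ((natMap x₀ m).comp s).Homotopic (ContinuousMap.id X)) : lsCat x₀ ≤ m := by
  obtain ⟨u, H, hu, H0, -, H1⟩ := hX.exists_deformation
  have hε : (0 : ℝ) < 1 / (3 * (m + 2) : ℝ) := by positivity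
  refine sInf_le ⟨m, rfl, fun k =>
    s ⁻¹' gapSet hu (gapLevel_bounds m k).1 (gapLevel_bounds m k).2 m, fun k =>
      ⟨(isOpen_gapSet hu _ _ m).preimage s.continuous, ?_⟩, ?_⟩
  · set V := s ⁻¹' gapSet hu (gapLevel_bounds m k).1 (gapLevel_bounds m k).2 m
    let ι : C(V, X) := ⟨Subtype.val, continuous_subtype_val⟩
    let P := projHomotopy x₀ m hε (gapLevel_bounds m k).1.le (gapLevel_bounds m k).2.le
    let e := ((natMap x₀ m).comp s).comp ι
    have h1 : ContinuousMap.Homotopic e ι := by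
      have := hs.comp (ContinuousMap.Homotopic.refl ι)
      rwa [ContinuousMap.id_comp] at this
    let K (t : I) : C(X, X) := ⟨fun x => H (t, x), by fun_prop⟩
    have h2 : ContinuousMap.Homotopic e ((K 1).comp e) :=
      ⟨⟨⟨fun p => H (p.1, e p.2), by fun_prop⟩, fun x => H0 _, fun x => rfl⟩⟩
    -- The homotopy `P` is followed by the end `K 1` of the deformation: `P` finishes in the region
    -- `u < 1`, which `K 1` collapses to `x₀`.
    have h3 : ContinuousMap.Homotopic ((K 1).comp e) (ContinuousMap.const V x₀) := by
      refine ⟨⟨⟨fun p => H (1, P (s p.2) p.1), ?_⟩, fun x => ?_, fun x => ?_⟩⟩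
      · have : Continuous fun p : I × V => P (s p.2) p.1 := by fun_prop
        fun_prop
      · change H (1, P (s x) 0) = H (1, natMap x₀ m (s x))
        rw [projHomotopy_zero]
      · exact H1 _ (projHomotopy_one_lt hu hε (gapLevel_bounds m k).1 (gapLevel_bounds m k).2 x.2)
    exact h1.symm.trans (h2.trans h3)
  · refine Set.eq_univ_of_forall fun x => ?_
    obtain ⟨k, hk⟩ := exists_mem_gapSet hu (s x)
    exact Set.mem_iUnion.2 ⟨k, hk⟩

end Section

/-! ## Recognizing points on the faces of an associahedron -/

namespace Assoc

/-- A vanishing inner coordinate puts a point on a face. -/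
lemma exists_faceSeq_of_apply_eq_zero {n k : ℕ} {t : ℕ → ℝ} (ht : t ∈ Assoc (n + 2))
    (hk : k < n) (h0 : t (k + 1) = 0) : ∃ p s, p + s = n + 1 ∧ 2 ≤ s ∧ k ≤ p ∧
      ∃ ρ ∈ Assoc (p + 2), ∃ σ ∈ Assoc s, t = faceSeq (k + 1) s ρ σ := by
  classical
  have hex : ∃ l, k + 1 < l ∧ excess t l < 1 + excess t k :=
    ⟨n + 1, by omega, by linarith [excess_last ht, excess_nonneg ht (i := k) (by omega)]⟩
  -- The inner block ends at the first index where the excess falls below `1 + excess t k`. Up to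
  -- there the excesses of `σ` are nonnegative; the strict drop at `l` keeps the coordinate of `ρ`
  -- at `k + 1` nonnegative.
  obtain ⟨l, ⟨hkl, hl⟩, hmin⟩ : ∃ l, (k + 1 < l ∧ excess t l < 1 + excess t k) ∧
      ∀ j, k + 1 < j → j < l → 1 + excess t k ≤ excess t j :=
    ⟨Nat.find hex, Nat.find_spec hex, fun j h1 h2 =>
      not_lt.1 fun h => Nat.find_min hex h2 ⟨h1, h⟩⟩
  have hln : l ≤ n + 1 := by
    by_contra h
    have := hmin (n + 1) (by omega) (by omega)
    linarith [excess_last ht, excess_nonneg ht (i := k) (by omega)]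
  obtain ⟨a, rfl⟩ : ∃ a, l = k + 1 + a + 1 := ⟨l - (k + 2), by omega⟩
  obtain ⟨p, rfl⟩ : ∃ p, n = p + 1 + a := ⟨n - 1 - a, by omega⟩
  have hk1 : excess t (k + 1) = excess t k + 1 := by rw [excess_succ, h0, sub_zero]
  have hrun : ∀ j ≤ a, 1 + excess t k ≤ excess t (k + 1 + j) := by
    intro j hj
    rcases Nat.eq_zero_or_pos j with rfl | hj0
    · rw [add_zero, hk1, add_comm]
    · exact hmin _ (by omega) (by omega)
  -- The coordinate `t l` is split between the last coordinate of `σ` and the coordinate `k + 1` of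
  -- `ρ`, so that the excess of `σ` ends at `0`.
  let σ : ℕ → ℝ := fun j => if j ≤ a then t (k + 1 + j) else
    if j = a + 1 then excess t (k + 1 + a) - excess t k else 0
  let ρ : ℕ → ℝ := fun j => if j ≤ k then t j else
    if j = k + 1 then 1 + excess t k - excess t (k + 1 + a + 1) else t (j + a + 1)
  have hσ : ∀ j ≤ a, excess σ j = excess t (k + 1 + j) - excess t k - 1 := by
    intro j hj
    induction j with
    | zero =>
      have : σ 0 = 0 := by simp [σ, h0]
      rw [add_zero, hk1]
      simp [excess, this]
    | succ j ih =>
      have : σ (j + 1) = t (k + 1 + j + 1) := by simp [σ, hj, add_assoc]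
      rw [excess_succ, ih (by omega), this, ← add_assoc, excess_succ t (k + 1 + j)]
      ring
  have hσl : excess σ (a + 1) = 0 := by
    have : σ (a + 1) = excess t (k + 1 + a) - excess t k := by simp [σ]
    rw [excess_succ, hσ a le_rfl, this]
    ring
  have hρ : ∀ j ≤ k, excess ρ j = excess t j := by
    intro j hj
    unfold excess
    congr 1
    refine Finset.sum_congr rfl fun l hl => ?_
    have := Finset.mem_range.1 hl
    simp [ρ, show l ≤ k by omega]
  have hρ' : ∀ j, excess ρ (k + 1 + j) = excess t (k + 1 + a + 1 + j) := by
    intro j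
    induction j with
    | zero =>
      have : ρ (k + 1) = 1 + excess t k - excess t (k + 1 + a + 1) := by simp [ρ]
      rw [add_zero, add_zero, excess_succ, hρ k le_rfl, this]
      ring
    | succ j ih =>
      have : ρ (k + 1 + j + 1) = t (k + 1 + a + 1 + j + 1) := by
        simp only [ρ, show ¬ (k + 1 + j + 1 ≤ k) by omega, show k + 1 + j + 1 ≠ k + 1 by omega,
          if_false]
        congr 1
        omega
      rw [← add_assoc, excess_succ, ih, this, ← add_assoc, excess_succ t (k + 1 + a + 1 + j)]
  refine ⟨p, a + 2, by omega, by omega, by omega, ρ, ?_, σ, ?_, ?_⟩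
  · refine mem_of_excess (fun j => ?_) (fun j hj => ?_) (fun j hj => ?_) ?_
    · simp only [ρ]
      split_ifs
      exacts [ht.1 _, by linarith, ht.1 _]
    · simp only [ρ, show ¬ (j ≤ k) by omega, show j ≠ k + 1 by omega, if_false]
      exact ht.2.1 _ (by omega)
    · rcases le_or_gt j k with h | h
      · rw [hρ j h]
        exact excess_nonneg ht (by omega)
      · obtain ⟨j, rfl⟩ := exists_add_of_le (Nat.succ_le_of_lt h)
        rw [hρ']
        exact excess_nonneg ht (by omega)
    · rw [show p + 1 = k + 1 + (p - k) by omega, hρ',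
        show k + 1 + a + 1 + (p - k) = p + 1 + a + 1 by omega]
      exact excess_last ht
  · refine mem_of_excess (fun j => ?_) (fun j hj => ?_) (fun j hj => ?_) hσl
    · simp only [σ]
      split_ifs
      exacts [ht.1 _, by linarith [hrun a le_rfl], le_rfl]
    · simp only [σ, show ¬ (j ≤ a) by omega, show j ≠ a + 1 by omega, if_false]
    · rw [hσ j (by omega)]
      linarith [hrun j (by omega)]
  · funext i
    unfold faceSeq
    split_ifs with h1 h2 h3
    · simp [ρ, show i ≤ k by omega]
    · simp only [σ, show i - (k + 1) ≤ a by omega, if_true]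
      congr 1
      omega
    · obtain rfl : i = k + 1 + a + 1 := by omega
      have e1 : σ (a + 2 - 1) = excess t (k + 1 + a) - excess t k := by
        simp [σ]
      have e2 : ρ (k + 1) = 1 + excess t k - excess t (k + 1 + a + 1) := by simp [ρ]
      rw [e1, e2, excess_succ t (k + 1 + a)]
      ring
    · simp only [ρ, show ¬ (i + 1 - (a + 2) ≤ k) by omega, show i + 1 - (a + 2) ≠ k + 1 by omega,
        if_false]
      congr 1
      omega

/-- A vanishing inner excess puts a point on one of the first faces. -/
lemma exists_faceSeq_of_excess_eq_zero {p l : ℕ} {t : ℕ → ℝ} (ht : t ∈ Assoc (p + l + 2))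
    (h0 : excess t l = 0) : ∃ ρ ∈ Assoc (p + 2), ∃ σ ∈ Assoc (l + 1),
      t = faceSeq 0 (l + 1) ρ σ := by
  -- Since the excess vanishes at `l`, the first `l + 1` coordinates already form a point of an
  -- associahedron; `ρ` starts with `0`, so the face adds nothing to the last of them.
  let σ : ℕ → ℝ := fun j => if j ≤ l then t j else 0
  let ρ : ℕ → ℝ := fun j => if j = 0 then 0 else t (l + j)
  have hσ : ∀ j ≤ l, excess σ j = excess t j := by
    intro j hj
    unfold excess
    congr 1
    refine Finset.sum_congr rfl fun i hi => ?_
    have := Finset.mem_range.1 hi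
    simp [σ, show i ≤ l by omega]
  have hρ : ∀ j, excess ρ j = excess t (l + j) := by
    intro j
    induction j with
    | zero =>
      rw [add_zero, h0]
      simp [excess, ρ]
    | succ j ih =>
      rw [excess_succ, ih, ← add_assoc, excess_succ]
      simp [ρ, add_assoc]
  refine ⟨ρ, ?_, σ, ?_, ?_⟩
  · refine mem_of_excess (fun j => ?_) (fun j hj => ?_) (fun j hj => ?_) ?_
    · simp only [ρ]
      split_ifs
      exacts [le_rfl, ht.1 _]
    · simp only [ρ, show j ≠ 0 by omega, if_false]
      exact ht.2.1 _ (by omega)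
    · rw [hρ]
      exact excess_nonneg ht (by omega)
    · rw [hρ, show l + (p + 1) = p + l + 1 by omega]
      exact excess_last ht
  · refine mem_of_excess (fun j => ?_) (fun j hj => ?_) (fun j hj => ?_) ?_
    · simp only [σ]
      split_ifs
      exacts [ht.1 _, le_rfl]
    · simp only [σ, show ¬ (j ≤ l) by omega, if_false]
    · rw [hσ j hj.le]
      exact excess_nonneg ht (by omega)
    · rw [hσ l le_rfl, h0]
  · funext i
    unfold faceSeq
    split_ifs with h1 h2 h3
    · omega
    · simp [σ, show i ≤ l by omega]
    · obtain rfl : i = l := by omega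
      simp [σ, ρ]
    · simp only [ρ, show i + 1 - (l + 1) ≠ 0 by omega, if_false]
      congr 1
      omega

/-- The face containing `t` either merges the loops `k` and `k + 1` or drops both at the end. -/
lemma weight_eq_of_apply_eq_zero {n k : ℕ} {t : ℕ → ℝ} (ht : t ∈ Assoc (n + 2)) (hk : k + 1 < n)
    (h0 : t (k + 1) = 0) : weight t n (k + 1) = weight t n k := by
  obtain ⟨p, s, h, hs, hp, ρ, hρ, σ, hσ, rfl⟩ :=
    exists_faceSeq_of_apply_eq_zero ht (by omega) h0
  rcases Nat.eq_or_lt_of_le hp with rfl | hp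
  · rw [weight_last h hs hρ hσ le_rfl (by omega), weight_last h hs hρ hσ (by omega) (by omega)]
  · rw [weight_mid h hs hp hρ hσ le_rfl (by omega), weight_mid h hs hp hρ hσ (by omega) (by omega)]

/-- No loop follows the last one to be merged with it, so the face must be the one that drops it at
the end. -/
lemma weight_last_eq_zero {n : ℕ} {t : ℕ → ℝ} (ht : t ∈ Assoc (n + 1 + 2))
    (h0 : t (n + 1) = 0) : weight t (n + 1) n = 0 := by
  obtain ⟨p, s, h, hs, hp, ρ, hρ, σ, hσ, rfl⟩ :=
    exists_faceSeq_of_apply_eq_zero ht (Nat.lt_succ_self n) h0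
  obtain rfl : n = p := by omega
  exact weight_last h hs hρ hσ le_rfl (by omega)

/-- Neighbouring weights agree and the last one vanishes. -/
lemma weight_eq_zero {n : ℕ} {t : ℕ → ℝ} (ht : t ∈ Assoc (n + 2)) (h0 : ∀ k < n, t (k + 1) = 0)
    {i : ℕ} (hi : i < n) : weight t n i = 0 := by
  obtain ⟨n, rfl⟩ : ∃ n', n = n' + 1 := ⟨n - 1, by omega⟩
  have key : ∀ j ≤ n, weight t (n + 1) j = weight t (n + 1) 0 := by
    intro j hj
    induction j with
    | zero => rfl
    | succ j ih => rw [weight_eq_of_apply_eq_zero ht (by omega) (h0 j (by omega)), ih (by omega)]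
  rw [key i (by omega), ← key n le_rfl, weight_last_eq_zero ht (h0 n (by omega))]

/-- The point lies on a first face that drops the loops before `l`, in particular the initial one.
-/
lemma weight_zero_eq_one {n l : ℕ} {t : ℕ → ℝ} (ht : t ∈ Assoc (n + 2)) (hl0 : 0 < l)
    (hl : l ≤ n) (h0 : excess t l = 0) : weight t n 0 = 1 := by
  obtain ⟨p, rfl⟩ : ∃ p, n = p + l := ⟨n - l, by omega⟩
  obtain ⟨ρ, hρ, σ, hσ, rfl⟩ := exists_faceSeq_of_excess_eq_zero ht h0
  exact weight_first_lt (by omega) (by omega) hρ hσ (by omega)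

end Assoc

/-! ## Loops that may be changed without changing the class -/

section Classes

variable {X : Type*} [TopologicalSpace X] {x₀ : X}

/-- The class of `(τ; f 0, …, f (n - 1))` in `P^m ΩX`. -/
def projClass (x₀ : X) {m n : ℕ} (hn : n < m + 1) (τ : Assoc (n + 2)) (f : ℕ → MooreLoop x₀) :
    LoopProjSpace x₀ m :=
  Quot.mk _ (.mk n hn τ fun i => f i)

lemma prod_ofFn_nat {M : Type*} [Monoid M] (f : ℕ → M) (k s : ℕ) :
    (List.ofFn fun i : Fin s => f (k + i)).prod = segProd f k s := by
  rw [prod_ofFn_eq]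
  refine segProd_congr fun i hi => ?_
  rw [zero_add, padOne_of_lt _ hi]

/-- On such a face the loops `k` and `k + 1` are absorbed into one product, or everything from `k`
on is dropped. If `k` is the last index only the second case occurs, so no condition on products is
needed there. -/
lemma projClass_eq_of_mul_eq {m n k : ℕ} (hn : n < m + 1) {τ : Assoc (n + 2)} (hk : k < n)
    (h0 : (τ : ℕ → ℝ) (k + 1) = 0) {f f' : ℕ → MooreLoop x₀}
    (hf : ∀ i < n, i ≠ k → i ≠ k + 1 → f i = f' i)
    (hmul : k + 1 < n → f k * f (k + 1) = f' k * f' (k + 1)) :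
    projClass x₀ hn τ f = projClass x₀ hn τ f' := by
  obtain ⟨p, s, h, hs, hp, ρ, hρ, σ, hσ, e⟩ :=
    Assoc.exists_faceSeq_of_apply_eq_zero τ.2 hk h0
  obtain rfl : τ = Assoc.face (k + 1) (by omega) hs (by omega) ⟨ρ, hρ⟩ ⟨σ, hσ⟩ := Subtype.ext e
  rcases Nat.eq_or_lt_of_le hp with rfl | hp
  · refine (Quot.sound (ProjRel.last hn (by omega) h hs ⟨ρ, hρ⟩ ⟨σ, hσ⟩ _)).trans
      (Eq.trans ?_ (Quot.sound (ProjRel.last hn (by omega) h hs ⟨ρ, hρ⟩ ⟨σ, hσ⟩ _)).symm)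
    congr 3
    funext i
    exact hf i (by omega) (by omega) (by omega)
  · have hα : ∀ f : ℕ → MooreLoop x₀, (loopForm x₀).α s (⟨σ, hσ⟩, fun i : Fin s => f (k + i)) =
      segProd f k s := fun f => prod_ofFn_nat f k s
    have key : mergeSeq (r := p) k h hs (fun i : Fin n => f i) (segProd f k s) =
        mergeSeq k h hs (fun i : Fin n => f' i) (segProd f' k s) := by
      funext i
      unfold mergeSeq
      split_ifs with h1 h2
      · exact hf i (by omega) (by omega) (by omega)
      · obtain ⟨b, rfl⟩ : ∃ b, s = 1 + 1 + b := ⟨s - 2, by omega⟩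
        rw [segProd_add, segProd_add f', segProd_add, segProd_add f', segProd_one, segProd_one,
          segProd_one, segProd_one, hmul (by omega)]
        congr 1
        exact segProd_congr fun j hj => hf _ (by omega) (by omega) (by omega)
      · exact hf _ (by omega) (by simp only; omega) (by simp only; omega)
    refine (Quot.sound (ProjRel.middle k hp hn (by omega) h hs ⟨ρ, hρ⟩ ⟨σ, hσ⟩ _)).trans
      (Eq.trans ?_ (Quot.sound (ProjRel.middle k hp hn (by omega) h hs ⟨ρ, hρ⟩ ⟨σ, hσ⟩ _)).symm)
    simp only [hα]
    exact congrArg (fun g => Quot.mk _ (ProjCells.mk p (by omega) ⟨ρ, hρ⟩ g)) key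

/-- The loops before `l` are dropped by a first face. -/
lemma projClass_eq_of_excess_eq_zero {m n l : ℕ} (hn : n < m + 1) {τ : Assoc (n + 2)}
    (hl0 : 0 < l) (hl : l ≤ n) (h0 : Assoc.excess τ l = 0) {f f' : ℕ → MooreLoop x₀}
    (hf : ∀ i < n, l ≤ i → f i = f' i) :
    projClass x₀ hn τ f = projClass x₀ hn τ f' := by
  obtain ⟨p, rfl⟩ : ∃ p, n = p + l := ⟨n - l, by omega⟩
  obtain ⟨ρ, hρ, σ, hσ, e⟩ := Assoc.exists_faceSeq_of_excess_eq_zero τ.2 h0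
  obtain rfl : τ = Assoc.face 0 (by omega) (show 2 ≤ l + 1 by omega) (by omega) ⟨ρ, hρ⟩ ⟨σ, hσ⟩ :=
    Subtype.ext e
  refine (Quot.sound (ProjRel.first hn (by omega) (by omega) (by omega) ⟨ρ, hρ⟩ ⟨σ, hσ⟩ _)).trans
    (Eq.trans ?_ (Quot.sound (ProjRel.first hn (by omega) (by omega) (by omega) ⟨ρ, hρ⟩
      ⟨σ, hσ⟩ _)).symm)
  congr 3
  funext i
  exact hf _ (by omega) (by simp only [Nat.add_sub_cancel]; omega)

lemma assoc_two_eq_pt (ρ : Assoc 2) : ρ = Assoc.pt := by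
  refine Subtype.ext (funext fun i => ?_)
  have h0 := Assoc.apply_zero ρ.2
  have h1 := Assoc.excess_last ρ.2
  rw [Assoc.excess_succ, Assoc.excess_zero ρ.2] at h1
  change (ρ : ℕ → ℝ) i = if i = 1 then 1 else 0
  rcases i with _ | _ | i
  · simpa using h0
  · simp only [zero_add] at h1 ⊢
    simp only [if_true]
    linarith
  · simpa using ρ.2.2.1 (i + 2) (by omega)

/-- Points all of whose inner coordinates vanish represent the base point. -/
lemma projClass_eq_base {m : ℕ} {τ : Assoc (m + 2)}
    (h0 : ∀ k < m, (τ : ℕ → ℝ) (k + 1) = 0) (f : ℕ → MooreLoop x₀) :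
    projClass x₀ (Nat.lt_succ_self m) τ f = ProjSpace.base (loopForm x₀) m := by
  rcases m with _ | m
  · obtain rfl := assoc_two_eq_pt τ
    exact congrArg (fun g => Quot.mk _ (ProjCells.mk 0 (Nat.succ_pos 0) Assoc.pt g))
      (Subsingleton.elim _ _)
  -- The only nonzero coordinate of `τ` is its last one, so `τ` is the composite of the point of
  -- `K(2)` with the vertex `(0, …, 0, m + 1)` of `K(m + 2)`. This is a last face that drops all
  -- loops.
  let σ : ℕ → ℝ := fun j => if j = m + 1 then (m : ℝ) + 1 else 0
  have hσ0 : ∀ i < m + 1, Assoc.excess σ i = i := by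
    intro i hi
    rw [Assoc.excess, Finset.sum_eq_zero, sub_zero]
    intro j hj
    have := Finset.mem_range.1 hj
    simp [σ, show j ≠ m + 1 by omega]
  have hσ : σ ∈ Assoc (m + 2) := by
    refine Assoc.mem_of_excess (fun j => ?_) (fun j hj => ?_) (fun j hj => ?_) ?_
    · simp only [σ]
      split_ifs
      exacts [by positivity, le_rfl]
    · simp [σ, show j ≠ m + 1 by omega]
    · rw [hσ0 j hj]
      exact Nat.cast_nonneg _
    · rw [Assoc.excess_succ, hσ0 m (Nat.lt_succ_self m)]
      simp [σ]
  have hτ : ∀ i ≤ m + 1, (τ : ℕ → ℝ) i = 0 := by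
    intro i hi
    rcases i with _ | i
    exacts [Assoc.apply_zero τ.2, h0 i hi]
  have hτl : (τ : ℕ → ℝ) (m + 2) = m + 2 := by
    have h1 := Assoc.excess_last τ.2
    rw [Assoc.excess_succ, Assoc.excess, Finset.sum_eq_zero fun j hj =>
      hτ j (Nat.lt_succ_iff.1 (Finset.mem_range.1 hj))] at h1
    push_cast at h1
    linarith
  obtain rfl : τ = Assoc.face 1 (by omega) (by omega) (by omega) Assoc.pt ⟨σ, hσ⟩ := by
    refine Subtype.ext (funext fun i => ?_)
    change (τ : ℕ → ℝ) i = Assoc.faceSeq 1 (m + 2) Assoc.pt σ i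
    unfold Assoc.faceSeq
    split_ifs with h1 h2 h3
    · obtain rfl : i = 0 := by omega
      rw [hτ 0 (by omega), Assoc.apply_zero Assoc.pt.2]
    · rw [hτ i (by omega)]
      simp [σ, show i - 1 ≠ m + 1 by omega]
    · obtain rfl : i = m + 2 := by omega
      rw [hτl]
      simp only [σ, Assoc.pt, show m + 2 - 1 = m + 1 by omega, if_true]
      ring
    · rw [τ.2.2.1 i (by omega), Assoc.pt.2.2.1 _ (by omega)]
  refine (Quot.sound (ProjRel.last (p := 0) _ (by omega) (by omega) (by omega) Assoc.pt
    ⟨σ, hσ⟩ _)).trans ?_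
  exact congrArg (fun g => Quot.mk _ (ProjCells.mk 0 (Nat.succ_pos _) Assoc.pt g))
    (Subsingleton.elim _ _)

end Classes

/-! ## Points of an associahedron from functions on the vertices -/

namespace Assoc

open unitInterval

/-- Excesses with `x_0 = 0` and `x_{i+1} = (x_i + 1) (1 - φ_{i+1})`. -/
def vertexExcess (φ : ℕ → I) : ℕ → ℝ
  | 0 => 0
  | i + 1 => (vertexExcess φ i + 1) * (1 - φ (i + 1))

/-- The sequence with the excesses `vertexExcess φ`. -/
def vertexSeq (m : ℕ) (φ : ℕ → I) : ℕ → ℝ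
  | 0 => 0
  | i + 1 => if i < m then (vertexExcess φ i + 1) * φ (i + 1)
    else if i = m then vertexExcess φ i + 1 else 0

lemma vertexExcess_nonneg (φ : ℕ → I) (i : ℕ) : 0 ≤ vertexExcess φ i := by
  induction i with
  | zero => exact le_rfl
  | succ i ih => exact mul_nonneg (by linarith) (sub_nonneg.2 (φ (i + 1)).2.2)

lemma excess_vertexSeq {m : ℕ} (φ : ℕ → I) {i : ℕ} (hi : i ≤ m) :
    excess (vertexSeq m φ) i = vertexExcess φ i := by
  induction i with
  | zero => simp [excess, vertexSeq, vertexExcess]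
  | succ i ih =>
    rw [excess_succ, ih (by omega), vertexSeq, if_pos (by omega), vertexExcess]
    ring

lemma vertexSeq_mem (m : ℕ) (φ : ℕ → I) : vertexSeq m φ ∈ Assoc (m + 2) := by
  refine mem_of_excess (fun i => ?_) (fun i hi => ?_) (fun i hi => ?_) ?_
  · rcases i with _ | i
    · exact le_rfl
    · have := vertexExcess_nonneg φ i
      rw [vertexSeq]
      split_ifs
      exacts [mul_nonneg (by linarith) (φ _).2.1, by linarith, le_rfl]
  · obtain ⟨i, rfl⟩ : ∃ i', i = i' + 1 := ⟨i - 1, by omega⟩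
    rw [vertexSeq, if_neg (by omega), if_neg (by omega)]
  · rw [excess_vertexSeq φ (by omega)]
    exact vertexExcess_nonneg φ i
  · rw [excess_succ, excess_vertexSeq φ le_rfl, vertexSeq, if_neg (lt_irrefl m), if_pos rfl,
      sub_self]

/-- A point of `K(m + 2)` whose inner coordinates vanish where `φ` does. -/
def vertexPoint (m : ℕ) (φ : ℕ → I) : Assoc (m + 2) := ⟨vertexSeq m φ, vertexSeq_mem m φ⟩

/-- A vanishing parameter at an inner vertex makes the loops on its two sides merge, or drops them;
at the last vertex it drops the last loop. The value `φ 0` does not enter the point. -/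
lemma vertexPoint_eq_zero {m k : ℕ} {φ : ℕ → I} (hk : k < m) (h : φ (k + 1) = 0) :
    (vertexPoint m φ : ℕ → ℝ) (k + 1) = 0 := by
  change vertexSeq m φ (k + 1) = 0
  rw [vertexSeq, if_pos hk, h]
  simp

/-- A parameter `1` at `l > 0` makes the loops before the vertex `l` irrelevant, which is how the
vertex `0` becomes movable. -/
lemma excess_vertexPoint_eq_zero {m l : ℕ} {φ : ℕ → I} (hl : l ≤ m) (h : φ l = 1) :
    excess (vertexPoint m φ) l = 0 := by
  change excess (vertexSeq m φ) l = 0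
  rw [excess_vertexSeq φ hl]
  rcases l with _ | l
  · rfl
  · rw [vertexExcess, h]
    simp

lemma continuous_vertexPoint (m : ℕ) : Continuous (vertexPoint m) := by
  have h : ∀ i, Continuous fun φ : ℕ → I => vertexExcess φ i := by
    intro i
    induction i with
    | zero => exact continuous_const
    | succ i ih =>
      simp only [vertexExcess]
      fun_prop
  refine Continuous.subtype_mk (continuous_pi fun i => ?_) _
  rcases i with _ | i
  · exact continuous_const
  · simp only [vertexSeq]
    have := h i
    split_ifs <;> fun_prop

end Assoc

/-! ## Cutting curves into loops -/

section Cut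

variable {X : Type*} [TopologicalSpace X] {x₀ : X}

/-- The part of a curve between the times `2 a` and `2 b` at which it is at `x₀`. -/
def restrictLoop {μ : C(ℝ, X)} {a b : ℕ} (h : a ≤ b) (ha : μ (2 * a) = x₀)
    (hb : μ (2 * b) = x₀) : MooreLoop x₀ :=
  ⟨(⟨fun t => μ (2 * a + min (t : ℝ) (2 * ((b - a : ℕ) : ℝ))), by fun_prop⟩, 2 * (b - a : ℕ)), by
    refine ⟨?_, fun t ht => ?_⟩
    · simpa using ha
    · have h1 : 2 * ((b - a : ℕ) : ℝ) ≤ (t : ℝ) := by exact_mod_cast ht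
      have h2 : (2 * a + 2 * ((b - a : ℕ) : ℝ) : ℝ) = 2 * b := by
        rw [Nat.cast_sub h]
        ring
      simp only [ContinuousMap.coe_mk, min_eq_right h1, h2]
      exact hb⟩

open Classical in
/-- The part of a curve between the times `2 a` and `2 b`, provided that it is a loop at `x₀`. -/
def cutLoop (x₀ : X) (μ : C(ℝ, X)) (a b : ℕ) : MooreLoop x₀ :=
  if h : a ≤ b ∧ μ (2 * a) = x₀ ∧ μ (2 * b) = x₀ then restrictLoop h.1 h.2.1 h.2.2 else 1

variable {μ : C(ℝ, X)} {a b c : ℕ}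

lemma cutLoop_path (h : a ≤ b) (ha : μ (2 * a) = x₀) (hb : μ (2 * b) = x₀) (t : ℝ≥0) :
    (cutLoop x₀ μ a b).path t = μ (2 * a + min (t : ℝ) (2 * ((b - a : ℕ) : ℝ))) := by
  rw [cutLoop, dif_pos ⟨h, ha, hb⟩]
  rfl

lemma cutLoop_len (h : a ≤ b) (ha : μ (2 * a) = x₀) (hb : μ (2 * b) = x₀) :
    (cutLoop x₀ μ a b).len = 2 * (b - a : ℕ) := by
  rw [cutLoop, dif_pos ⟨h, ha, hb⟩]
  rfl

lemma cutLoop_self (ha : μ (2 * a) = x₀) : cutLoop x₀ μ a a = 1 := by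
  refine MooreLoop.ext (fun t => ?_) ?_
  · rw [cutLoop_path le_rfl ha ha, MooreLoop.one_path]
    simpa using ha
  · rw [cutLoop_len le_rfl ha ha, MooreLoop.one_len]
    simp

/-- Moore loops keep their lengths, so the equality is strict: the product of two pieces forgets the
vertex between them. -/
lemma cutLoop_mul (hab : a ≤ b) (hbc : b ≤ c) (ha : μ (2 * a) = x₀) (hb : μ (2 * b) = x₀)
    (hc : μ (2 * c) = x₀) : cutLoop x₀ μ a b * cutLoop x₀ μ b c = cutLoop x₀ μ a c := by
  have hl := cutLoop_len hab ha hb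
  obtain ⟨p, rfl⟩ := exists_add_of_le hab
  obtain ⟨q, rfl⟩ := exists_add_of_le hbc
  have e1 : a + p + q - a = p + q := by omega
  simp only [Nat.add_sub_cancel_left] at hl
  refine MooreLoop.ext (fun t => ?_) ?_
  · rw [cutLoop_path (hab.trans hbc) ha hc, MooreLoop.mul_path]
    split_ifs with h
    · rw [cutLoop_path hab ha hb, Nat.add_sub_cancel_left, e1]
      rw [hl] at h
      have h1 : (t : ℝ) ≤ 2 * p := by exact_mod_cast h
      rw [min_eq_left h1, min_eq_left]
      push_cast
      have : (0 : ℝ) ≤ q := Nat.cast_nonneg q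
      linarith
    · rw [cutLoop_path hbc hb hc, Nat.add_sub_cancel_left, e1, hl]
      rw [hl, not_le] at h
      have h1 : 2 * (p : ℝ) ≤ (t : ℝ) := by exact_mod_cast h.le
      have h2 : ((t - 2 * p : ℝ≥0) : ℝ) = t - 2 * p := by
        rw [NNReal.coe_sub h.le]
        push_cast
        rfl
      rw [h2]
      congr 1
      push_cast
      rcases le_total ((t : ℝ) - 2 * p) (2 * q) with h3 | h3
      · rw [min_eq_left h3, min_eq_left (by linarith)]
        ring
      · rw [min_eq_right h3, min_eq_right (by linarith)]
        ring
  · rw [MooreLoop.mul_len, hl, cutLoop_len hbc hb hc, cutLoop_len (hab.trans hbc) ha hc,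
      Nat.add_sub_cancel_left, e1]
    push_cast
    ring

/-- With `a` and `b` fixed the length is constant and the default branch of `cutLoop` is never
taken. -/
lemma continuous_cutLoop {W : Type*} [TopologicalSpace W] {F : W → C(ℝ, X)} (hF : Continuous F)
    (h : a ≤ b) (ha : ∀ w, F w (2 * a) = x₀) (hb : ∀ w, F w (2 * b) = x₀) :
    Continuous fun w => cutLoop x₀ (F w) a b := by
  refine continuous_induced_rng.2 (Continuous.prodMk (?_ : Continuous fun w =>
    (cutLoop x₀ (F w) a b).path) (?_ : Continuous fun w => (cutLoop x₀ (F w) a b).len))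
  · refine ContinuousMap.continuous_of_continuous_uncurry _ ?_
    simp only [Function.uncurry_def, cutLoop_path h (ha _) (hb _)]
    fun_prop
  · simp only [cutLoop_len h (ha _) (hb _)]
    exact continuous_const

lemma segProd_cutLoop {d : ℕ → ℕ} (hd : Monotone d) {n : ℕ}
    (hμ : ∀ i ≤ n, μ (2 * d i) = x₀) :
    segProd (fun i => cutLoop x₀ μ (d i) (d (i + 1))) 0 n = cutLoop x₀ μ (d 0) (d n) := by
  induction n with
  | zero =>
    rw [cutLoop_self (hμ 0 le_rfl)]
    rfl
  | succ n ih =>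
    rw [segProd_add, ih fun i hi => hμ i (by omega), segProd_one, zero_add,
      cutLoop_mul (hd (Nat.zero_le n)) (hd (Nat.le_succ n)) (hμ _ (by omega)) (hμ _ (by omega))
        (hμ _ le_rfl)]

end Cut

/-! ## Classes of curves with marked vertices -/

section Marked

variable {X : Type*} [TopologicalSpace X] {x₀ : X}

open unitInterval

/-- A monotone choice of times at which the curve is at the base point, and which moves only
the vertices at which `φ` vanishes. -/
structure Marking (x₀ : X) (m : ℕ) (μ : C(ℝ, X)) (φ : ℕ → I) (d : ℕ → ℕ) : Prop where
  mono : Monotone d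
  curve : ∀ i ≤ m, μ (2 * d i) = x₀
  fixed : ∀ i ≤ m, φ i ≠ 0 → d i = i

/-- The point of `P^m ΩX` that is given by the pieces of a curve. -/
def curveClass (x₀ : X) (m : ℕ) (μ : C(ℝ, X)) (φ : ℕ → I) (d : ℕ → ℕ) : LoopProjSpace x₀ m :=
  projClass x₀ (Nat.lt_succ_self m) (Assoc.vertexPoint m φ)
    fun i => cutLoop x₀ μ (d i) (d (i + 1))

variable {m : ℕ} {μ : C(ℝ, X)} {φ : ℕ → I} {d d' : ℕ → ℕ}

lemma curveClass_congr (h : ∀ i ≤ m, d i = d' i) :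
    curveClass x₀ m μ φ d = curveClass x₀ m μ φ d' := by
  unfold curveClass projClass
  congr 2
  funext i
  simp only [h i i.2.le, h (i + 1) i.2]

/-- Two markings will be compared through their minimum, which lies below both. -/
lemma Marking.inf (h : Marking x₀ m μ φ d) (h' : Marking x₀ m μ φ d') :
    Marking x₀ m μ φ fun i => min (d i) (d' i) where
  mono := h.mono.min h'.mono
  curve i hi := by
    rcases min_choice (d i) (d' i) with e | e <;> rw [e]
    exacts [h.curve i hi, h'.curve i hi]
  fixed i hi hφ := by rw [h.fixed i hi hφ, h'.fixed i hi hφ, min_self]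

/-- Moving one vertex at which `φ` vanishes does not change the class. -/
lemma curveClass_eq_of_one (h1 : ∃ l ≤ m, φ l = 1) (h : Marking x₀ m μ φ d)
    (h' : Marking x₀ m μ φ d') {j : ℕ} (hj : ∀ i ≤ m, i ≠ j → d i = d' i) :
    curveClass x₀ m μ φ d = curveClass x₀ m μ φ d' := by
  by_cases hjm : j ≤ m ∧ φ j = 0
  swap
  · refine curveClass_congr fun i hi => ?_
    by_cases hij : i = j
    · have : φ i ≠ 0 := fun e => hjm ⟨hij ▸ hi, hij ▸ e⟩
      rw [h.fixed i hi this, h'.fixed i hi this]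
    · exact hj i hi hij
  obtain ⟨hjm, hφ⟩ := hjm
  -- Vertex `0` has no inner coordinate of its own. A vertex `l > 0` with parameter `1` makes the
  -- first piece disappear from the class; at the other vertices only the product of the adjacent
  -- pieces counts, or nothing of them.
  rcases j with _ | j
  · obtain ⟨l, hl, hφl⟩ := h1
    have hl0 : 0 < l := Nat.pos_of_ne_zero fun e => by
      rw [e, hφ] at hφl
      exact zero_ne_one hφl
    refine projClass_eq_of_excess_eq_zero _ hl0 hl (Assoc.excess_vertexPoint_eq_zero hl hφl)
      fun i hi hli => ?_
    rw [hj i hi.le (by omega), hj (i + 1) hi (by omega)]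
  · refine projClass_eq_of_mul_eq _ hjm (Assoc.vertexPoint_eq_zero hjm hφ)
      (fun i hi h2 h3 => ?_) fun h2 => ?_
    · rw [hj i hi.le h3, hj (i + 1) hi (by omega)]
    · rw [cutLoop_mul (h.mono (by omega)) (h.mono (by omega)) (h.curve _ (by omega))
        (h.curve _ (by omega)) (h.curve _ (by omega)), cutLoop_mul (h'.mono (by omega))
        (h'.mono (by omega)) (h'.curve _ (by omega)) (h'.curve _ (by omega))
        (h'.curve _ (by omega)), hj j (by omega) (by omega), hj (j + 1 + 1) (by omega) (by omega)]

/-- The values of `d'` are replaced by those of `d` one index at a time. Starting from index `0`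
keeps the mixed functions monotone, because `d ≤ d'`. -/
lemma curveClass_eq_of_le (h1 : ∃ l ≤ m, φ l = 1) (h : Marking x₀ m μ φ d)
    (h' : Marking x₀ m μ φ d') (hle : ∀ i, d i ≤ d' i) :
    curveClass x₀ m μ φ d = curveClass x₀ m μ φ d' := by
  have hM : ∀ k, Marking x₀ m μ φ fun i => if i < k then d i else d' i := by
    intro k
    refine ⟨fun i j hij => ?_, fun i hi => ?_, fun i hi hφ => ?_⟩
    · split_ifs
      · exact h.mono hij
      · exact (h.mono hij).trans (hle j)
      · omega
      · exact h'.mono hij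
    · split_ifs
      exacts [h.curve i hi, h'.curve i hi]
    · split_ifs
      exacts [h.fixed i hi hφ, h'.fixed i hi hφ]
  have step : ∀ k, curveClass x₀ m μ φ (fun i => if i < k then d i else d' i) =
      curveClass x₀ m μ φ d' := by
    intro k
    induction k with
    | zero => exact curveClass_congr fun i _ => if_neg (Nat.not_lt_zero i)
    | succ k ih =>
      rw [← ih]
      refine curveClass_eq_of_one h1 (hM _) (hM _) (j := k) fun i _ hik => ?_
      by_cases hi : i < k
      · rw [if_pos hi, if_pos (by omega)]
      · rw [if_neg hi, if_neg (by omega)]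
  rw [← step (m + 1)]
  exact curveClass_congr fun i hi => (if_pos (by omega)).symm

/-- The class does not depend on the marking. -/
lemma curveClass_eq (h1 : ∃ l ≤ m, φ l = 1) (h : Marking x₀ m μ φ d)
    (h' : Marking x₀ m μ φ d') : curveClass x₀ m μ φ d = curveClass x₀ m μ φ d' :=
  (curveClass_eq_of_le h1 (h.inf h') h fun _ => min_le_left _ _).symm.trans
    (curveClass_eq_of_le h1 (h.inf h') h' fun _ => min_le_right _ _)

/-- The time at which the natural map evaluates the curve. -/
def markedTime (m : ℕ) (φ : ℕ → I) (d : ℕ → ℕ) : ℝ :=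
  2 * (d 0 + ∑ i ∈ Finset.range m,
    Assoc.weight (Assoc.vertexPoint m φ) m i * ((d (i + 1) : ℝ) - d i))

/-- The pieces concatenate to the curve between its first and last marked times, and each piece
contributes its weight times its length. -/
lemma natMap_curveClass (h : Marking x₀ m μ φ d) :
    natMap x₀ m (curveClass x₀ m μ φ d) = μ (markedTime m φ d) := by
  have hw0 : ∀ i < m, 0 ≤ Assoc.weight (Assoc.vertexPoint m φ) m i := fun i hi =>
    Assoc.weight_nonneg (Assoc.vertexPoint m φ).2.1 hi
  have hw1 : ∀ i < m, Assoc.weight (Assoc.vertexPoint m φ) m i ≤ 1 := fun i hi =>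
    Assoc.weight_le_one (by omega)
  change cellEval x₀ m (Assoc.vertexPoint m φ, _) = _
  rw [cellEval, prod_ofFn_eq]
  have e1 : segProd (padOne fun i : Fin m => cutLoop x₀ μ (d i) (d (i + 1))) 0 m =
      cutLoop x₀ μ (d 0) (d m) := by
    rw [← segProd_cutLoop h.mono h.curve]
    exact segProd_congr fun i hi => by rw [zero_add, padOne_of_lt _ hi]
  rw [e1, cutLoop_path (h.mono (Nat.zero_le m)) (h.curve 0 (Nat.zero_le m)) (h.curve m le_rfl)]
  have e2 : ((∑ i : Fin m, (Assoc.weight (Assoc.vertexPoint m φ) m i).toNNReal *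
      (cutLoop x₀ μ (d i) (d (i + 1))).len : ℝ≥0) : ℝ) = 2 * ∑ i ∈ Finset.range m,
        Assoc.weight (Assoc.vertexPoint m φ) m i * ((d (i + 1) : ℝ) - d i) := by
    rw [NNReal.coe_sum, Finset.mul_sum, Finset.sum_range]
    refine Finset.sum_congr rfl fun i _ => ?_
    rw [cutLoop_len (h.mono (Nat.le_add_right _ 1)) (h.curve _ i.2.le) (h.curve _ i.2)]
    rw [NNReal.coe_mul, Real.coe_toNNReal _ (hw0 i i.2), NNReal.coe_mul, NNReal.coe_natCast,
      Nat.cast_sub (h.mono (Nat.le_add_right (i : ℕ) 1)), NNReal.coe_ofNat]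
    ring
  simp only at e2 ⊢
  rw [e2, min_eq_left]
  · rw [markedTime, mul_add]
  · have e3 : ((d m - d 0 : ℕ) : ℝ) = ∑ i ∈ Finset.range m, ((d (i + 1) : ℝ) - d i) := by
      rw [Finset.sum_range_sub (fun i => (d i : ℝ)), Nat.cast_sub (h.mono (Nat.zero_le m))]
    rw [e3]
    refine mul_le_mul_of_nonneg_left (Finset.sum_le_sum fun i hi => ?_) (by norm_num)
    refine mul_le_of_le_one_left (sub_nonneg.2 ?_) (hw1 i (Finset.mem_range.1 hi))
    exact_mod_cast h.mono (Nat.le_succ i)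

/-- Summation by parts against the identity marking. Where `d i ≠ i` the parameter vanishes, so the
weights on both sides of the vertex `i` agree; at the two ends the weight is `1`, respectively `0`.
All corrections cancel, and the resulting time does not mention `d`. -/
lemma markedTime_eq (h1 : ∃ l ≤ m, φ l = 1) (h : Marking x₀ m μ φ d) :
    markedTime m φ d = 2 * ∑ i ∈ Finset.range m, Assoc.weight (Assoc.vertexPoint m φ) m i := by
  set w := Assoc.weight (Assoc.vertexPoint m φ) m with hw
  have hfix : ∀ i ≤ m, ((d i : ℝ) - i ≠ 0) → φ i = 0 := fun i hi hd => by
    by_contra hφ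
    exact hd (by rw [h.fixed i hi hφ, sub_self])
  rcases m with _ | m
  · obtain ⟨l, hl, hφ⟩ := h1
    obtain rfl : l = 0 := by omega
    have := h.fixed 0 le_rfl (by rw [hφ]; exact one_ne_zero)
    simp [markedTime, this]
  -- The displacement `d i - i` is summed up to `n`; only the boundary term survives, and `hlast`
  -- removes it for `n = m`.
  have key : ∀ n ≤ m, (d 0 : ℝ) + ∑ i ∈ Finset.range (n + 1),
      w i * (((d (i + 1) : ℝ) - (i + 1 : ℕ)) - (d i - i)) = w n * (d (n + 1) - (n + 1 : ℕ)) := by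
    intro n hn
    induction n with
    | zero =>
      have : (d 0 : ℝ) * (1 - w 0) = 0 := by
        by_cases hd : (d 0 : ℝ) = 0
        · rw [hd, zero_mul]
        · have hφ0 := hfix 0 (Nat.zero_le _) (by simpa using hd)
          obtain ⟨l, hl, hφ⟩ := h1
          have hl0 : 0 < l := Nat.pos_of_ne_zero fun e => by
            rw [e, hφ0] at hφ
            exact zero_ne_one hφ
          rw [hw, Assoc.weight_zero_eq_one (Assoc.vertexPoint (m + 1) φ).2 hl0 hl
            (Assoc.excess_vertexPoint_eq_zero hl hφ), sub_self, mul_zero]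
      rw [zero_add, Finset.sum_range_one]
      push_cast
      linarith
    | succ n ih =>
      have : ((d (n + 1) : ℝ) - (n + 1 : ℕ)) * (w n - w (n + 1)) = 0 := by
        by_cases hd : (d (n + 1) : ℝ) - (n + 1 : ℕ) = 0
        · rw [hd, zero_mul]
        · rw [hw, Assoc.weight_eq_of_apply_eq_zero (Assoc.vertexPoint (m + 1) φ).2 (by omega)
            (Assoc.vertexPoint_eq_zero (by omega) (hfix _ (by omega) hd)), sub_self, mul_zero]
      rw [Finset.sum_range_succ, ← add_assoc, ih (by omega)]
      linarith
  have hlast : w m * (d (m + 1) - (m + 1 : ℕ)) = 0 := by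
    by_cases hd : (d (m + 1) : ℝ) - (m + 1 : ℕ) = 0
    · rw [hd, mul_zero]
    · rw [hw, Assoc.weight_last_eq_zero (Assoc.vertexPoint (m + 1) φ).2
        (Assoc.vertexPoint_eq_zero (Nat.lt_succ_self m) (hfix _ le_rfl hd)), zero_mul]
  have hk := key m le_rfl
  rw [hlast] at hk
  rw [markedTime]
  congr 1
  rw [← sub_eq_zero, add_sub_assoc, ← Finset.sum_sub_distrib, ← hk]
  congr 1
  refine Finset.sum_congr rfl fun i _ => ?_
  push_cast
  ring

end Marked

/-! ## Sections of the natural maps from contractions of subsets -/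

section Sections

open unitInterval

universe u

variable {X : Type u} [TopologicalSpace X]

/-- Functions and excursions on a space that are obtained from a covering by `m + 1` categorical
subsets: `exc i (x, ·)` is a path from `x`, which ends at the base point if `x` is in the `i`-th
subset, where `wt i x > 1 / 2`. -/
structure ExcursionData (x₀ : X) (m : ℕ) where
  wt : ℕ → C(X, ℝ)
  exc : ℕ → C(X × ℝ, X)
  exists_wt : ∀ x, ∃ l ≤ m, wt l x = 1
  wt_base : wt 0 x₀ = 1
  exc_zero : ∀ i x, exc i (x, 0) = x
  exc_one : ∀ i ≤ m, ∀ x, 1 / 2 < wt i x → exc i (x, 1) = x₀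
  null : ∃ N : C(I × I, X), (∀ z : I, N (0, z) = exc 0 (x₀, (z : ℝ))) ∧ (∀ z, N (1, z) = x₀) ∧
    (∀ a, N (a, 0) = x₀) ∧ ∀ a, N (a, 1) = x₀

/-- The tent over `[2 j - 1, 2 j + 1]`. -/
def tent (j : ℕ) (t : ℝ) : ℝ := max 0 (1 - |t - 2 * j|)

lemma tent_self (j : ℕ) : tent j (2 * j) = 1 := by simp [tent]

lemma tent_of_ne {i j : ℕ} (h : i ≠ j) : tent i (2 * j) = 0 := by
  refine max_eq_left ?_
  have : (1 : ℝ) ≤ |(j : ℝ) - i| := by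
    have : (1 : ℤ) ≤ |(j : ℤ) - i| := by
      refine Int.one_le_abs (sub_ne_zero.2 fun e => h ?_)
      exact_mod_cast e.symm
    exact_mod_cast this
  rw [← mul_sub, abs_mul, abs_two]
  linarith

lemma continuous_tent (j : ℕ) : Continuous (tent j) := by
  unfold tent
  fun_prop

/-- The curve that runs through the excursions one after another, scaled by a factor. -/
def excursions (E : ℕ → C(X × ℝ, X)) : ℕ → C(X × ℝ × ℝ, X)
  | 0 => ⟨fun p => E 0 (p.1, p.2.1 * tent 0 p.2.2), by
      have := continuous_tent 0
      fun_prop⟩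
  | n + 1 => ⟨fun p => E (n + 1) (excursions E n p, p.2.1 * tent (n + 1) p.2.2), by
      have := continuous_tent (n + 1)
      fun_prop⟩

lemma excursions_of_eq_zero {E : ℕ → C(X × ℝ, X)} (hE : ∀ i x, E i (x, 0) = x) {n : ℕ} {x : X}
    {c t : ℝ} (h : ∀ j ≤ n, c * tent j t = 0) : excursions E n (x, c, t) = x := by
  induction n with
  | zero =>
    change E 0 (x, c * tent 0 t) = x
    rw [h 0 le_rfl, hE]
  | succ n ih =>
    change E (n + 1) (excursions E n (x, c, t), c * tent (n + 1) t) = x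
    rw [h _ le_rfl, hE, ih fun j hj => h j (by omega)]

/-- At time `2 j` all tents but the `j`-th vanish, so the other excursions leave their starting
points fixed. -/
lemma excursions_apply {E : ℕ → C(X × ℝ, X)} (hE : ∀ i x, E i (x, 0) = x) {n j : ℕ} (hj : j ≤ n)
    (x : X) (c : ℝ) : excursions E n (x, c, 2 * j) = E j (x, c) := by
  induction n with
  | zero =>
    obtain rfl : j = 0 := by omega
    change E 0 (x, c * tent 0 (2 * (0 : ℕ))) = _
    rw [tent_self, mul_one]
  | succ n ih =>
    change E (n + 1) (excursions E n (x, c, 2 * j), c * tent (n + 1) (2 * j)) = _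
    rcases Nat.eq_or_lt_of_le hj with rfl | hj
    · rw [tent_self, mul_one, excursions_of_eq_zero hE]
      intro i hi
      rw [tent_of_ne (by omega), mul_zero]
    · rw [tent_of_ne (by omega), mul_zero, hE, ih (by omega)]

/-- For a set `B` of natural numbers, a monotone retraction of the natural numbers to `B`. -/
def retractIdx (B : Finset ℕ) (i : ℕ) : ℕ :=
  -- The least element is inserted to serve the indices that lie below all of `B`.
  (insert (sInf (B : Set ℕ)) (B.filter (· ≤ i))).max' (Finset.insert_nonempty _ _)

lemma retractIdx_mono (B : Finset ℕ) : Monotone (retractIdx B) := fun _ _ h =>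
  Finset.max'_subset _ (Finset.insert_subset_insert _
    (Finset.monotone_filter_right B fun _ _ h' => le_trans h' h))

lemma retractIdx_mem {B : Finset ℕ} (hB : B.Nonempty) (i : ℕ) : retractIdx B i ∈ B := by
  have h := Finset.max'_mem (insert (sInf (B : Set ℕ)) (B.filter (· ≤ i)))
    (Finset.insert_nonempty _ _)
  rcases Finset.mem_insert.1 h with h | h
  · rw [retractIdx, h]
    exact Nat.sInf_mem (s := (B : Set ℕ)) hB
  · exact Finset.filter_subset _ _ h

lemma retractIdx_eq {B : Finset ℕ} {i : ℕ} (hi : i ∈ B) : retractIdx B i = i := by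
  refine le_antisymm (Finset.max'_le _ _ _ fun j hj => ?_) (Finset.le_max' _ _ ?_)
  · rcases Finset.mem_insert.1 hj with rfl | hj
    · exact Nat.sInf_le hi
    · exact (Finset.mem_filter.1 hj).2
  · exact Finset.mem_insert_of_mem (Finset.mem_filter.2 ⟨hi, le_rfl⟩)

/-! ### The section built from excursions. -/

namespace ExcursionData

variable {x₀ : X} {m : ℕ} (D : ExcursionData x₀ m)

/-- The curve through all the excursions. -/
def curve : C(X, C(ℝ, X)) :=
  ContinuousMap.curry ⟨fun p : X × ℝ => excursions D.exc m (p.1, 1, p.2), by fun_prop⟩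

lemma curve_apply (x : X) (t : ℝ) : D.curve x t = excursions D.exc m (x, 1, t) := rfl

/-- The parameters of the vertices. -/
def vert (x : X) (i : ℕ) : I := Set.projIcc 0 1 zero_le_one (4 * D.wt i x - 3)

lemma continuous_vert : Continuous D.vert :=
  continuous_pi fun i => continuous_projIcc.comp (by fun_prop)

lemma vert_eq_one {x : X} {i : ℕ} (h : D.wt i x = 1) : D.vert x i = 1 :=
  Set.projIcc_of_right_le _ (by rw [h]; norm_num)

/-- The curve is at `x₀` as soon as the function exceeds `1 / 2`, but the parameter becomes positive
only above `3 / 4`. The margin is what allows markings to be kept constant near a point. -/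
lemma vert_eq_zero {x : X} {i : ℕ} (h : D.wt i x ≤ 3 / 4) : D.vert x i = 0 :=
  Set.projIcc_of_le_left _ (by linarith)

lemma exists_vert (x : X) : ∃ l ≤ m, D.vert x l = 1 := by
  obtain ⟨l, hl, h⟩ := D.exists_wt x
  exact ⟨l, hl, D.vert_eq_one h⟩

lemma curve_eq_base {x : X} {i : ℕ} (hi : i ≤ m) (h : 1 / 2 < D.wt i x) :
    D.curve x (2 * i) = x₀ := by
  rw [curve_apply, excursions_apply D.exc_zero hi, D.exc_one i hi x h]

/-- Every choice of `B` between the vertices above `3 / 4` and those above `1 / 2` will do; it is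
nonempty because some function has the value `1`. -/
lemma marking_retractIdx {x : X} {B : Finset ℕ} (h1 : ∀ i ∈ B, i ≤ m ∧ 1 / 2 < D.wt i x)
    (h2 : ∀ i ≤ m, i ∉ B → D.wt i x ≤ 3 / 4) :
    Marking x₀ m (D.curve x) (D.vert x) (retractIdx B) := by
  have hB : B.Nonempty := by
    obtain ⟨l, hl, h⟩ := D.exists_wt x
    refine ⟨l, by_contra fun hlB => ?_⟩
    have := h2 l hl hlB
    rw [h] at this
    norm_num at this
  refine ⟨retractIdx_mono B, fun i _ => ?_, fun i hi hφ => retractIdx_eq ?_⟩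
  · exact D.curve_eq_base (h1 _ (retractIdx_mem hB i)).1 (h1 _ (retractIdx_mem hB i)).2
  · exact by_contra fun hiB => hφ (D.vert_eq_zero (h2 i hi hiB))

/-- The vertices whose excursions end at the base point. -/
def active (x : X) : Finset ℕ :=
  open Classical in (Finset.range (m + 1)).filter fun i => 1 / 2 < D.wt i x

lemma mem_active {x : X} {i : ℕ} : i ∈ D.active x ↔ i ≤ m ∧ 1 / 2 < D.wt i x := by
  simp [active]

lemma marking_active (x : X) :
    Marking x₀ m (D.curve x) (D.vert x) (retractIdx (D.active x)) := by
  refine D.marking_retractIdx (fun i hi => D.mem_active.1 hi) fun i hi hiB => ?_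
  have : ¬ 1 / 2 < D.wt i x := fun h => hiB (D.mem_active.2 ⟨hi, h⟩)
  linarith

/-- The set of active vertices may jump, but near `y` the set belonging to `y` still gives a
marking. By `curveClass_eq` this gives the same class, and with a fixed set the pieces vary
continuously. -/
lemma continuous_curveClass :
    Continuous fun x => curveClass x₀ m (D.curve x) (D.vert x) (retractIdx (D.active x)) := by
  rw [continuous_iff_continuousAt]
  intro y
  set B := D.active y with hB
  let F : Finset ℕ := (Finset.range (m + 1)).filter (· ∉ B)
  let W : Set X := (⋂ i ∈ B, D.wt i ⁻¹' Set.Ioi (1 / 2)) ∩ ⋂ i ∈ F, D.wt i ⁻¹' Set.Iio (3 / 4)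
  have hW : IsOpen W :=
    (isOpen_biInter_finset fun i _ => isOpen_Ioi.preimage (D.wt i).continuous).inter
      (isOpen_biInter_finset fun i _ => isOpen_Iio.preimage (D.wt i).continuous)
  have hWmem : ∀ x, x ∈ W ↔ (∀ i ∈ B, 1 / 2 < D.wt i x) ∧ ∀ i ∈ F, D.wt i x < 3 / 4 := by
    intro x
    simp only [W, Set.mem_inter_iff, Set.mem_iInter, Set.mem_preimage, Set.mem_Ioi, Set.mem_Iio]
  have hy : y ∈ W := by
    refine (hWmem y).2 ⟨fun i hi => (D.mem_active.1 hi).2, fun i hi => ?_⟩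
    rw [Finset.mem_filter, Finset.mem_range] at hi
    have : ¬ 1 / 2 < D.wt i y := fun h => hi.2 (D.mem_active.2 ⟨by omega, h⟩)
    linarith
  have hmark : ∀ x ∈ W, Marking x₀ m (D.curve x) (D.vert x) (retractIdx B) := fun x hx =>
    D.marking_retractIdx (fun i hi => ⟨(D.mem_active.1 hi).1, ((hWmem x).1 hx).1 i hi⟩) fun i hi hiB =>
      (((hWmem x).1 hx).2 i (Finset.mem_filter.2 ⟨Finset.mem_range.2 (by omega), hiB⟩)).le
  refine ContinuousOn.continuousAt ?_ (hW.mem_nhds hy)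
  refine ContinuousOn.congr (f := fun x => curveClass x₀ m (D.curve x) (D.vert x) (retractIdx B))
    ?_ fun x hx => curveClass_eq (D.exists_vert x) (D.marking_active x) (hmark x hx)
  rw [continuousOn_iff_continuous_domRestrict]
  refine continuous_quot_mk.comp (continuous_sigmaMk.comp (Continuous.prodMk ?_ ?_))
  · exact (Assoc.continuous_vertexPoint m).comp (D.continuous_vert.comp continuous_subtype_val)
  · refine continuous_pi fun i => ?_
    exact continuous_cutLoop (D.curve.continuous.comp continuous_subtype_val)
      (retractIdx_mono B (Nat.le_succ i)) (fun x => (hmark x x.2).curve i i.2.le)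
      fun x => (hmark x x.2).curve (i + 1) i.2

/-- The free section of the natural map. -/
def freeSection : C(X, LoopProjSpace x₀ m) := ⟨_, D.continuous_curveClass⟩

/-- The time at which the natural map evaluates the curve. -/
def time (x : X) : ℝ :=
  2 * ∑ i ∈ Finset.range m, Assoc.weight (Assoc.vertexPoint m (D.vert x)) m i

lemma continuous_time : Continuous D.time := by
  refine continuous_const.mul (continuous_finsetSum _ fun i _ => ?_)
  exact (Assoc.continuous_weight m i).comp (continuous_subtype_val.comp
    ((Assoc.continuous_vertexPoint m).comp D.continuous_vert))

lemma markedTime_retractIdx (x : X) :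
    markedTime m (D.vert x) (retractIdx (D.active x)) = D.time x :=
  markedTime_eq (D.exists_vert x) (D.marking_active x)

/-- The points of `P^m ΩX` with a path that starts at their image. -/
abbrev pathsOver (x₀ : X) (m : ℕ) : Set (LoopProjSpace x₀ m × C(I, X)) :=
  {p | p.2 0 = natMap x₀ m p.1}

/-- The homotopy from the composite of the free section and the natural map to the identity. -/
def freeHomotopy : C(X, C(I, X)) :=
  ContinuousMap.curry ⟨fun p : X × I => excursions D.exc m (p.1, 1 - p.2, D.time p.1), by
    have := D.continuous_time
    fun_prop⟩

lemma freeHomotopy_apply (x : X) (r : I) :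
    D.freeHomotopy x r = excursions D.exc m (x, 1 - r, D.time x) := rfl

/-- At full scale the excursions form the curve itself, and `time` is the marked time of the active
vertices. -/
lemma freeHomotopy_zero (x : X) : D.freeHomotopy x 0 = natMap x₀ m (D.freeSection x) := by
  refine Eq.trans ?_ (natMap_curveClass (D.marking_active x)).symm
  rw [markedTime_retractIdx, curve_apply, freeHomotopy_apply]
  simp

lemma freeHomotopy_one (x : X) : D.freeHomotopy x 1 = x := by
  rw [freeHomotopy_apply, excursions_of_eq_zero D.exc_zero]
  simp

/-- The free section with the free homotopy. -/
def freeLift : C(X, pathsOver x₀ m) :=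
  ⟨fun x => ⟨(D.freeSection x, D.freeHomotopy x), D.freeHomotopy_zero x⟩, by fun_prop⟩

/-- The parameters of the vertices over the base point, scaled except for the first one. -/
def scaledVert (s : I) (i : ℕ) : I := if i = 0 then 1 else unitInterval.symm s * D.vert x₀ i

lemma continuous_scaledVert : Continuous D.scaledVert := by
  refine continuous_pi fun i => ?_
  unfold scaledVert
  split_ifs <;> fun_prop

lemma scaledVert_zero : D.scaledVert 0 = D.vert x₀ := by
  funext i
  unfold scaledVert
  split_ifs with h
  · rw [h, D.vert_eq_one D.wt_base]
  · rw [unitInterval.symm_zero, one_mul]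

lemma scaledVert_one_succ (k : ℕ) : D.scaledVert 1 (k + 1) = 0 := by
  rw [scaledVert, if_neg (Nat.succ_ne_zero k), unitInterval.symm_one, zero_mul]

/-- Scaling makes no vanishing parameter nonzero, since vertex `0` already has parameter `1` at
`x₀`. The same marking, and hence the same loops, serve for all `s`. -/
lemma marking_scaledVert (s : I) :
    Marking x₀ m (D.curve x₀) (D.scaledVert s) (retractIdx (D.active x₀)) := by
  refine ⟨(D.marking_active x₀).mono, (D.marking_active x₀).curve, fun i hi h =>
    (D.marking_active x₀).fixed i hi ?_⟩
  unfold scaledVert at h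
  split_ifs at h with h0
  · rw [h0, D.vert_eq_one D.wt_base]
    exact one_ne_zero
  · exact right_ne_zero_of_mul h

/-- All inner coordinates vanish at the end, so all weights do; only the initial time of vertex `0`
is left. -/
lemma markedTime_scaledVert_one :
    markedTime m (D.scaledVert 1) (retractIdx (D.active x₀)) = 0 := by
  have h0 : retractIdx (D.active x₀) 0 = 0 :=
    (D.marking_scaledVert 1).fixed 0 (Nat.zero_le m) one_ne_zero
  rw [markedTime, h0, Finset.sum_eq_zero]
  · simp
  · intro i hi
    rw [Assoc.weight_eq_zero (Assoc.vertexPoint m _).2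
      (fun k hk => Assoc.vertexPoint_eq_zero hk (D.scaledVert_one_succ k)) (Finset.mem_range.1 hi),
      zero_mul]

/-- The paths over the base point from the value of the free section to the base point. -/
def scaledLift : C(I, pathsOver x₀ m) where
  toFun s := ⟨(curveClass x₀ m (D.curve x₀) (D.scaledVert s) (retractIdx (D.active x₀)),
    ⟨fun r => excursions D.exc m (x₀, 1 - r,
      markedTime m (D.scaledVert s) (retractIdx (D.active x₀))), by fun_prop⟩), by
    refine Eq.trans ?_ (natMap_curveClass (D.marking_scaledVert s)).symm
    simp [curve_apply]⟩
  continuous_toFun := by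
    have hv : Continuous fun s => Assoc.vertexPoint m (D.scaledVert s) :=
      (Assoc.continuous_vertexPoint m).comp D.continuous_scaledVert
    refine Continuous.subtype_mk (Continuous.prodMk ?_ ?_) _
    · exact continuous_quot_mk.comp (continuous_sigmaMk.comp (hv.prodMk continuous_const))
    · refine ContinuousMap.continuous_of_continuous_uncurry _ ?_
      have hT : Continuous fun s =>
          markedTime m (D.scaledVert s) (retractIdx (D.active x₀)) := by
        refine continuous_const.mul (continuous_const.add (continuous_finsetSum _ fun i _ =>
          Continuous.mul ?_ continuous_const))
        exact (Assoc.continuous_weight m i).comp (continuous_subtype_val.comp hv)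
      exact (excursions D.exc m).continuous.comp
        (continuous_const.prodMk (Continuous.prodMk (by fun_prop) (hT.comp continuous_fst)))

lemma scaledLift_zero : D.scaledLift 0 = D.freeLift x₀ := by
  refine Subtype.ext (Prod.ext ?_ (ContinuousMap.ext fun r => ?_))
  · change curveClass x₀ m (D.curve x₀) (D.scaledVert 0) _ = _
    rw [scaledVert_zero]
    rfl
  · change excursions D.exc m (x₀, 1 - r, markedTime m (D.scaledVert 0) _) = _
    rw [scaledVert_zero, markedTime_retractIdx]
    rfl

lemma scaledLift_one_fst : (D.scaledLift 1).1.1 = ProjSpace.base (loopForm x₀) m := by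
  change curveClass x₀ m (D.curve x₀) (D.scaledVert 1) (retractIdx (D.active x₀)) = _
  exact projClass_eq_base
    (fun k hk => Assoc.vertexPoint_eq_zero hk (D.scaledVert_one_succ k)) _

lemma scaledLift_one_snd (r : I) : (D.scaledLift 1).1.2 r = D.exc 0 (x₀, 1 - r) := by
  change excursions D.exc m (x₀, 1 - r, markedTime m (D.scaledVert 1) _) = _
  rw [markedTime_scaledVert_one, ← excursions_apply D.exc_zero (Nat.zero_le m)]
  simp

lemma scaledLift_apply_one (s : I) : (D.scaledLift s).1.2 1 = x₀ := by
  change excursions D.exc m (x₀, 1 - ((1 : I) : ℝ), _) = _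
  rw [excursions_of_eq_zero D.exc_zero]
  simp

/-- A path from the value of the free lift at the base point to the base point. -/
lemma exists_path : ∃ γ : C(I, pathsOver x₀ m), γ 0 = D.freeLift x₀ ∧
    γ 1 = ⟨(ProjSpace.base (loopForm x₀) m, ContinuousMap.const I x₀), rfl⟩ ∧
    ∀ s, (γ s).1.2 1 = x₀ := by
  obtain ⟨N, N0, N1, N2, N3⟩ := D.null
  let γ₁ : Path (D.freeLift x₀) (D.scaledLift 1) := ⟨D.scaledLift, D.scaledLift_zero, rfl⟩
  -- What remains after the first path is the base point with the reversed excursion of `x₀` along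
  -- index `0`; `null` contracts this loop with fixed ends.
  let γ₂ : Path (D.scaledLift 1)
      (⟨(ProjSpace.base (loopForm x₀) m, ContinuousMap.const I x₀), rfl⟩ : pathsOver x₀ m) :=
    { toFun := fun a => ⟨(ProjSpace.base (loopForm x₀) m,
        ⟨fun r => N (a, unitInterval.symm r), by fun_prop⟩), by
          refine Eq.trans ?_ (natMap_base x₀ m).symm
          simp [N3]⟩
      continuous_toFun := by
        refine Continuous.subtype_mk (Continuous.prodMk continuous_const ?_) _
        refine ContinuousMap.continuous_of_continuous_uncurry _ ?_
        simp only [Function.uncurry_def, ContinuousMap.coe_mk]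
        fun_prop
      source' := by
        refine Subtype.ext (Prod.ext D.scaledLift_one_fst.symm (ContinuousMap.ext fun r => ?_))
        rw [scaledLift_one_snd]
        exact N0 _
      target' := Subtype.ext (Prod.ext rfl (ContinuousMap.ext fun r => N1 _)) }
  refine ⟨γ₁.trans γ₂, (γ₁.trans γ₂).source, (γ₁.trans γ₂).target, fun s => ?_⟩
  have hs : (γ₁.trans γ₂) s ∈ Set.range (γ₁.trans γ₂) := ⟨s, rfl⟩
  rw [Path.trans_range] at hs
  rcases hs with ⟨a, ha⟩ | ⟨a, ha⟩ <;> change ((γ₁.trans γ₂) s).1.2 1 = x₀ <;> rw [← ha]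
  · exact D.scaledLift_apply_one a
  · change N (a, unitInterval.symm 1) = x₀
    rw [unitInterval.symm_one, N2]

/-- The natural map has a pointed right homotopy inverse. -/
theorem exists_section (D : ExcursionData x₀ m) (hX : WellPointed x₀) : ∃ s : C(X, LoopProjSpace x₀ m),
    s x₀ = ProjSpace.base (loopForm x₀) m ∧
      ContinuousMap.HomotopicRel ((natMap x₀ m).comp s) (ContinuousMap.id X) {x₀} := by
  obtain ⟨γ, h0, h1, h2⟩ := D.exists_path
  -- Points and paths are moved together. At the end, each path leads from the image of the new
  -- section to some point `ε x`; its endpoint during `H` leads from `ε x` back to `x`. Over `x₀`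
  -- the final path is constant and the endpoint never moves, so both homotopies are relative.
  obtain ⟨H, H0, H1⟩ := hX.2 _ D.freeLift γ h0
  have hH : Continuous fun p => (H p).val := continuous_subtype_val.comp H.continuous
  let s : C(X, LoopProjSpace x₀ m) := ⟨fun x => (H (1, x)).val.1, by fun_prop⟩
  let ε : C(X, X) := ⟨fun x => (H (1, x)).val.2 1, by fun_prop⟩
  have hs : s x₀ = ProjSpace.base (loopForm x₀) m := by
    change (H (1, x₀)).val.1 = _
    rw [H1, h1]
  refine ⟨s, hs, ContinuousMap.HomotopicRel.trans (g := ε) ⟨⟨⟨⟨fun p => (H (1, p.2)).val.2 p.1,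
    by fun_prop⟩, fun x => (H (1, x)).2, fun x => rfl⟩, fun t x hx => ?_⟩⟩
    ⟨⟨⟨⟨fun p => (H (unitInterval.symm p.1, p.2)).val.2 1, by fun_prop⟩, fun x => ?_, fun x => ?_⟩,
      fun t x hx => ?_⟩⟩⟩
  · obtain rfl : x = x₀ := hx
    change (H (1, x)).val.2 t = natMap x m (s x)
    rw [hs, H1, h1, natMap_base]
    rfl
  · change (H (unitInterval.symm 0, x)).val.2 1 = (H (1, x)).val.2 1
    rw [unitInterval.symm_zero]
  · change (H (unitInterval.symm 1, x)).val.2 1 = x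
    rw [unitInterval.symm_one, H0]
    exact D.freeHomotopy_one x
  · obtain rfl : x = x₀ := hx
    change (H (unitInterval.symm t, x)).val.2 1 = (H (1, x)).val.2 1
    rw [H1, H1, h2, h2]

end ExcursionData
end Sections

/-! ## Contractions from categorical coverings -/

section Excursions

open unitInterval

universe u

variable {X : Type u} [TopologicalSpace X] {x₀ : X}

/-- The inclusion is homotopic to the restriction of `e`, which factors through `U`. -/
lemma IsCategorical.preimage {U : Set X} (hU : IsCategorical x₀ U) {e : C(X, X)}
    (he : e.Homotopic (ContinuousMap.id X)) : IsCategorical x₀ (e ⁻¹' U) := by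
  let v : C(e ⁻¹' U, X) := ⟨Subtype.val, continuous_subtype_val⟩
  let r : C(e ⁻¹' U, U) := ⟨fun w => ⟨e w, w.2⟩, by fun_prop⟩
  exact ((he.comp (.refl v)).symm).trans (hU.comp (.refl r))

/-- A cut off contraction of an open set extends to the whole space. -/
lemma exists_excursion {W : Set X} (hW : IsOpen W) (G : C(I × W, X)) (hG : ∀ w, G (0, w) = w)
    (h : C(X, ℝ)) (hh : ∀ x, h x ≠ 0 → x ∈ W) :
    ∃ E : C(X × ℝ, X), (∀ x, E (x, 0) = x) ∧
      ∀ x (hx : x ∈ W), 1 / 2 ≤ h x → ∀ z : I, E (x, z) = G (z, ⟨x, hx⟩) := by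
  classical
  let c : ℝ → I := Set.projIcc 0 1 zero_le_one
  have hc : Continuous c := continuous_projIcc
  -- The factor `c (4 * h - 1)` vanishes for `h ≤ 1 / 4` and equals `1` for `h ≥ 1 / 2`. So the
  -- contraction is complete on the inner part and stops before the edge of `W`.
  let E : X × ℝ → X := fun p => if hp : p.1 ∈ W then G (c p.2 * c (4 * h p.1 - 1), ⟨p.1, hp⟩) else p.1
  have h1 : ContinuousOn E {p | p.1 ∈ W} := by
    rw [continuousOn_iff_continuous_domRestrict]
    have : Set.domRestrict {p : X × ℝ | p.1 ∈ W} E = fun p =>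
        G (c p.1.2 * c (4 * h p.1.1 - 1), ⟨p.1.1, p.2⟩) := by
      ext p
      exact dif_pos p.2
    rw [this]
    fun_prop
  have h2 : ContinuousOn E {p | h p.1 < 1 / 4} := by
    refine continuous_fst.continuousOn.congr fun p hp => ?_
    by_cases hpW : p.1 ∈ W
    · have h0 : c (4 * h p.1 - 1) = 0 :=
        Set.projIcc_of_le_left _ (by have : h p.1 < 1 / 4 := hp; linarith)
      simp only [E, dif_pos hpW, h0, mul_zero, hG]
    · exact dif_neg hpW
  have hE : Continuous E := by
    refine continuous_iff_continuousAt.2 fun p => ?_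
    by_cases hp : p.1 ∈ W
    · exact h1.continuousAt ((hW.preimage continuous_fst).mem_nhds hp)
    · have h0 : h p.1 = 0 := not_not.1 fun h0 => hp (hh _ h0)
      refine h2.continuousAt ((isOpen_lt (by fun_prop) continuous_const).mem_nhds ?_)
      change h p.1 < 1 / 4
      rw [h0]
      norm_num
  refine ⟨⟨E, hE⟩, fun x => ?_, fun x hx hx' z => ?_⟩
  · change E (x, 0) = x
    by_cases hx : x ∈ W
    · have h0 : c 0 = 0 := Set.projIcc_left _
      simp only [E, dif_pos hx, h0, zero_mul, hG]
    · exact dif_neg hx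
  · have h0 : c (4 * h x - 1) = 1 := Set.projIcc_of_right_le _ (by linarith)
    have hz : c z = z := Set.projIcc_val _ z
    change E (x, z) = _
    simp only [E, dif_pos hx, h0, mul_one, hz]

/-- A contraction of a set to one of its points can be chosen to move this point along a
nullhomotopic loop. -/
lemma IsCategorical.exists_homotopy {W : Set X} (hW : IsCategorical x₀ W) (hx : x₀ ∈ W) :
    ∃ (G : ContinuousMap.Homotopy (⟨Subtype.val, continuous_subtype_val⟩ : C(W, X))
        (ContinuousMap.const W x₀)) (p : Path x₀ x₀),
      (∀ t, G (t, ⟨x₀, hx⟩) = p t) ∧ p.Homotopic (Path.refl x₀) := by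
  obtain ⟨F⟩ := hW
  let p : Path x₀ x₀ := ⟨⟨fun t => F (t, ⟨x₀, hx⟩), by fun_prop⟩, F.apply_zero _, F.apply_one _⟩
  -- After the given contraction the whole set is carried back along the track of `x₀`, so the new
  -- track is a path followed by its inverse.
  let K : ContinuousMap.Homotopy (ContinuousMap.const W x₀) (ContinuousMap.const W x₀) :=
    ⟨⟨fun q => p.symm q.1, by fun_prop⟩, fun _ => p.symm.source, fun _ => p.symm.target⟩
  refine ⟨F.trans K, p.trans p.symm, fun t => ?_, ⟨(Path.Homotopy.reflTransSymm p).symm⟩⟩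
  rw [ContinuousMap.Homotopy.trans_apply, Path.trans_apply]
  rfl

/-- A space of category at most `m` and of the homotopy type of a CW complex has a numerable
categorical covering with `m + 1` members. -/
lemma exists_numerable_covering (hCW : HasCWHomotopyType X) {m : ℕ} (hm : lsCat x₀ ≤ m) :
    ∃ (W : ℕ → Set X) (h : ℕ → C(X, ℝ)), (∀ i, IsOpen (W i)) ∧ (∀ i, IsCategorical x₀ (W i)) ∧
      (∀ i x, h i x ≠ 0 → x ∈ W i) ∧ ∀ x, ∃ l ≤ m, h l x = 1 := by
  obtain ⟨Y, _, _, ⟨_⟩, ⟨e⟩⟩ := hCW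
  have : NormalSpace Y := normalSpace_of_cwComplex
  have hne : {c : ℕ∞ | ∃ n : ℕ, c = n ∧ ∃ U : Fin (n + 1) → Set X,
      (∀ i, IsOpen (U i) ∧ IsCategorical x₀ (U i)) ∧ ⋃ i, U i = Set.univ}.Nonempty := by
    by_contra h
    rw [lsCat, Set.not_nonempty_iff_eq_empty.1 h, sInf_empty, top_le_iff] at hm
    exact ENat.natCast_ne_top m hm
  obtain ⟨n, hn, U, hU, hcov⟩ := csInf_mem hne
  have hnm : n ≤ m := by
    have h : (n : ℕ∞) ≤ m := hn ▸ hm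
    exact_mod_cast h
  obtain ⟨b, hb⟩ := BumpCovering.exists_isSubordinate_of_locallyFinite (s := Set.univ)
    isClosed_univ (fun i => e.invFun ⁻¹' U i)
    (fun i => (hU i).1.preimage e.invFun.continuous) (locallyFinite_of_finite _) (by
      rw [← Set.preimage_iUnion, hcov, Set.preimage_univ])
  -- Indices beyond `n` repeat the last member, as the category may be smaller than `m`.
  let ι : ℕ → Fin (n + 1) := fun i => ⟨min i n, by omega⟩
  refine ⟨fun i => (e.invFun.comp e.toFun) ⁻¹' U (ι i), fun i => (b (ι i)).comp e.toFun,
    fun i => (hU _).1.preimage (e.invFun.comp e.toFun).continuous,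
    fun i => (hU _).2.preimage e.left_inv,
    fun i x hx => hb (ι i) (subset_tsupport _ hx), fun x => ?_⟩
  have h1 := b.ind_apply (e x) (Set.mem_univ _)
  set j := b.ind (e x) (Set.mem_univ _)
  refine ⟨j, by omega, ?_⟩
  have hj : ι j = j := Fin.ext (min_eq_left (by omega))
  change b (ι j) (e x) = 1
  rw [hj, h1]

/-- The covering is renumbered so that a function with value `1` at `x₀` has index `0`. The
excursion of that index is taken from a contraction along which `x₀` traces a nullhomotopic loop. -/
lemma exists_excursionData (hCW : HasCWHomotopyType X) {m : ℕ} (hm : lsCat x₀ ≤ m) :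
    Nonempty (ExcursionData x₀ m) := by
  obtain ⟨W, h, hW, hcat, hsupp, hone⟩ := exists_numerable_covering hCW hm
  obtain ⟨l, hl, hl1⟩ := hone x₀
  have hx₀ : x₀ ∈ W l := hsupp l x₀ (by rw [hl1]; exact one_ne_zero)
  have hE : ∀ i, ∃ E : C(X × ℝ, X), (∀ x, E (x, 0) = x) ∧
      ∀ x, 1 / 2 < h i x → E (x, 1) = x₀ := fun i => by
    obtain ⟨G⟩ := hcat i
    obtain ⟨E, E0, E1⟩ := exists_excursion (hW i) G.toContinuousMap G.apply_zero (h i) (hsupp i)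
    exact ⟨E, E0, fun x hx =>
      (E1 x (hsupp i x (by linarith)) hx.le 1).trans (G.apply_one _)⟩
  choose E E0 E1 using hE
  obtain ⟨G, p, hGp, ⟨N⟩⟩ := (hcat l).exists_homotopy hx₀
  obtain ⟨B, B0, B1⟩ := exists_excursion (hW l) G.toContinuousMap G.apply_zero (h l) (hsupp l)
  have hB : ∀ x, 1 / 2 < h l x → B (x, 1) = x₀ := fun x hx =>
    (B1 x (hsupp l x (by linarith)) hx.le 1).trans (G.apply_one _)
  let π : Equiv.Perm ℕ := Equiv.swap 0 l
  have hπ : ∀ k, k ≤ m → π k ≤ m := fun k hk => by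
    rw [Equiv.swap_apply_def]
    split_ifs <;> omega
  have hπ0 : π 0 = l := Equiv.swap_apply_left 0 l
  refine ⟨⟨fun i => h (π i), Function.update (fun i => E (π i)) 0 B, ?_, ?_, ?_, ?_, ?_⟩⟩
  · intro x
    obtain ⟨k, hk, hkx⟩ := hone x
    exact ⟨π k, hπ k hk, by rw [Equiv.swap_apply_self]; exact hkx⟩
  · rw [hπ0, hl1]
  · intro i x
    rcases eq_or_ne i 0 with rfl | hi
    · rw [Function.update_self, B0]
    · rw [Function.update_of_ne hi, E0]
  · intro i _ x hx
    rcases eq_or_ne i 0 with rfl | hi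
    · rw [hπ0] at hx
      rw [Function.update_self, hB x hx]
    · rw [Function.update_of_ne hi, E1 _ x hx]
  · refine ⟨N.toContinuousMap, fun z => ?_, fun z => N.apply_one z, fun a => N.source a,
      fun a => N.target a⟩
    rw [Function.update_self, B1 x₀ hx₀ (by rw [hl1]; norm_num)]
    exact (N.apply_zero z).trans (hGp z).symm

end Excursions

end

/-! ### The two implications combined. -/

theorem mainTheorem1 {X : Type*} [TopologicalSpace X] [ConnectedSpace X] (x₀ : X)
    (hX : WellPointed x₀) (hCW : HasCWHomotopyType X) (m : ℕ) :
    lsCat x₀ ≤ m ↔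
      ∃ σ : C(X, LoopProjSpace x₀ m), σ x₀ = ProjSpace.base (loopForm x₀) m ∧
        ContinuousMap.HomotopicRel ((natMap x₀ m).comp σ) (ContinuousMap.id X) {x₀} := by
  refine ⟨fun h => ?_, fun ⟨s, _, ⟨F⟩⟩ => lsCat_le_of_section hX s ⟨F.toHomotopy⟩⟩
  obtain ⟨D⟩ := exists_excursionData hCW h
  exact D.exists_section hX
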